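/- **Setting and notation.** $[x]_\times$ is the skew-symmetric matrix with $[x]_\times y=x\times y$, $[\cdot]_\otimes$ is its inverse on skew-symmetric $3\times3$ matrices, and $\psi(M)=[\tfrac12(M-M^\top)]_\otimes$. For $X\in SO(3)$ let $|X|_I=\sqrt{\mathrm{tr}(I-X)/4}$, and let $\mathcal R_a(\theta,u)=I+\sin\theta\,[u]_\times+(1-\cos\theta)[u]_\times^2$. Let $A=A^\top\in\mathbb R^{3\times 3}$ with $\bar A=\tfrac12(\mathrm{tr}(A)I-A)$ positive definite, $\xi=\lambda_{\min}^{\bar A}/\lambda_{\max}^{\bar A}$, $0<k<1/\sqrt{6-\max\{1,4\xi^2\}}$, $\mathcal Q\subset\mathbb N$ a finite index set, and $\nu:\mathcal Q\to\mathbb S^2$. Put $$U_A(X)=\frac{\mathrm{tr}(A(I-X))}{4\lambda_{\max}^{\bar A}},\quad V_A(X)=2\big(1-\sqrt{1-U_A(X)}\big),\quad \Gamma_A(X,q)=X\,\mathfrak R_A(X,q),\quad \mathfrak R_A(X,q)=\mathcal R_a\big(2\arcsin(kU_A(X)),\nu(q)\big),$$ $\Phi_{U_A}(X,q)=U_A(\Gamma_A(X,q))$,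 $\Phi_{V_A}(X,q)=V_A(\Gamma_A(X,q))$, $$\Theta_A(X,q)=\mathfrak R_A(X,q)^\top+\frac{4k\,\nu(q)\psi(AX)^\top}{4\lambda^{\bar A}_{\max}\sqrt{1-k^2U_A(X)^2}},$$ $$\nabla\Phi_{U_A}(X,q)=\frac{1}{4\lambda_{\max}^{\bar A}}X\big[\Theta_A(X,q)^\top\psi(A\Gamma_A(X,q))\big]_\times,\qquad \nabla\Phi_{V_A}(X,q)=\frac{\nabla\Phi_{U_A}(X,q)}{\sqrt{1-\Phi_{U_A}(X,q)}}.$$ **Designs.** Let $\Phi$, $A$, $k$, $\mathcal Q$, $\nu$, $\delta$ be chosen, with $k$ as above, by one of the following. * D1: $\Phi=\Phi_{U_A}$, $A=I$, $\mathcal Q=\{1,\dots,6\}$, $\nu(p)=e_p$ and $\nu(p+3)=-e_p$ for $p\in\{1,2,3\}$, where $(e_1,e_2,e_3)$ is an orthonormal basis of $\mathbb R^3$, and $0<\delta<\Delta_I:=(-1+\sqrt{1+4k^2})^3/(24k^4)$. * D2: as D1, but with $\Phi=\Phi_{V_A}$ and $0<\delta<2\sqrt{\Delta_I}$. * D3: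 $\Phi=\Phi_{U_A}$, $A$ is positive definite with eigenvalues $0<\lambda_1<\lambda_2<\lambda_3$ and orthonormal eigenvectors $v_1,v_2,v_3$, $\mathcal Q=\{1,2\}$, $\nu(1)=u$, $\nu(2)=-u$ for a unit vector $u$ such that, if $\lambda_2\lambda_3-\lambda_1\lambda_2-\lambda_1\lambda_3\ge0$, then $u^\top v_1=0$ and $(u^\top v_i)^2=\lambda_i/(\lambda_2+\lambda_3)$ for $i\in\{2,3\}$, and otherwise $(u^\top v_i)^2=1-4\prod_{j\ne i}\lambda_j\big/\sum_\ell\sum_{m\ne\ell}\lambda_\ell\lambda_m$ for $i\in\{1,2,3\}$; and $0<\delta<\Delta_{III}:=4k^2\bar V^2(1-k^2\bar V^2)\Lambda$, where $\bar V=(-1+\sqrt{1+4k^2\xi\Lambda})/(2k^2\Lambda)$, and $\Lambda=\lambda_1/(\lambda_2+\lambda_3)$ in the first case, $\Lambda=4\lambda_1\lambda_2\lambda_3\big/\big((\lambda_2+\lambda_3)\sum_\ell\sum_{m\neq\ell}\lambda_\ell\lambda_m\big)$ in the second. * D4: as D3, but with $\Phi=\Phi_{V_A}$ and $0<\delta<2\big(-\sqrt{1-\xi}+\sqrt{1-\xi+\Delta_{III}}\big)$.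 **System.** The attitude $R(t)\in SO(3)$ satisfies $\dot R=R[\omega]_\times$, the measured angular velocity is $\omega_y=\omega+b_\omega$ with a constant bias $b_\omega\in\mathbb R^3$, the estimates are $\hat R\in SO(3)$ and $\hat b_\omega\in\mathbb R^3$, and the errors are $\tilde R=R\hat R^\top$ and $\tilde b_\omega=b_\omega-\hat b_\omega$. With gains $\gamma_P,\gamma_I>0$, the hybrid observer is $$\dot{\hat R}=\hat R[\omega_y-\hat b_\omega+\gamma_P\beta]_\times,\quad \dot{\hat b}_\omega=-\gamma_I\beta,\quad \dot q=0\quad\text{while }\Phi(\tilde R,q)-\min_{p\in\mathcal Q}\Phi(\tilde R,p)\le\delta,\qquad \beta=\hat R^\top[\tilde R^\top\nabla\Phi(\tilde R,q)]_\otimes,$$ $$q^+\in\arg\min_{p\in\mathcal Q}\Phi(\tilde R,p)\ \ (\hat R,\hat b_\omega\text{ unchanged})\quad\text{when }\Phi(\tilde R,q)-\min_{p\in\mathcal Q}\Phi(\tilde R,p)\ge\delta.$$ Solutions are hybrid arcs (locally absolutely continuous between jumps, the differential equations holding almost everywhere) on hybrid time domains starting at $(t_0,0)$, $t_0\ge 0$.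 Let $e=(|\tilde R|_I,\|\tilde b_\omega\|)^\top$. **Theorem.** Suppose that $\omega$ is bounded on $[0,\infty)$. Then every solution has finitely many jumps, and every maximal solution is complete. Moreover, the equilibrium $e=0$ is uniformly globally exponentially stable in the following sense: there is a constant $K>0$, depending only on the design and on the gains, such that for all $c$ and $r$ there is a rate $\lambda>0$ (depending on the design, the gains, $c$ and $r$) such that, for all $t_0\ge0$, all $\omega$ with $\sup_{t\ge0}\|\omega(t)\|\le c$, all $R$ and $b_\omega$, and all solutions with $\|e(t_0,0)\|\le r$, $$\|e(t,j)\|\le K e^{-\lambda(t-t_0+j)}\|e(t_0,0)\|\qquad\text{for all }(t,j)\text{ in the domain of the solution.}$$ -/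

import Mathlib

open scoped Matrix

noncomputable section

namespace HybridObserver

/-- Column vectors of `ℝ³`. The Euclidean norm is `vnorm`, not the default sup norm. -/
abbrev Vec3 := Fin 3 → ℝ

/-- Real `3 × 3` matrices. -/
abbrev Mat3 := Matrix (Fin 3) (Fin 3) ℝ

/-- The rotation group `SO(3)`. -/
abbrev SO3 : Submonoid Mat3 := Matrix.specialOrthogonalGroup (Fin 3) ℝ

/-- Euclidean norm on `ℝ³`. -/
def vnorm (v : Vec3) : ℝ := ‖WithLp.toLp 2 v‖

/-- The skew-symmetric matrix `[x]_×` with `[x]_× y = x × y`. -/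
def skew (x : Vec3) : Mat3 :=
  !![0, -x 2, x 1;
     x 2, 0, -x 0;
     -x 1, x 0, 0]

/-- The map `ψ`: the vector of the skew-symmetric part of a matrix. On skew-symmetric matrices it is
the inverse `[·]_⊗` of `[·]_×`. -/
def psi (M : Mat3) : Vec3 :=
  ![(M 2 1 - M 1 2) / 2, (M 0 2 - M 2 0) / 2, (M 1 0 - M 0 1) / 2]

/-- Normalized Euclidean distance to the identity: `|X|_I² = tr(I - X) / 4`. -/
def rotNorm (X : Mat3) : ℝ := √((1 - X).trace / 4)

/-- Angle-axis parametrization of rotations. -/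
def angleAxis (θ : ℝ) (u : Vec3) : Mat3 :=
  1 + Real.sin θ • skew u + (1 - Real.cos θ) • (skew u * skew u)

/-- `Ā = (tr(A) I - A) / 2`. -/
def bar (A : Mat3) : Mat3 := (1 / 2 : ℝ) • (A.trace • (1 : Mat3) - A)

/-- Largest eigenvalue of a symmetric matrix. -/
def eigMax (M : Mat3) : ℝ := sSup (spectrum ℝ M)

/-- Smallest eigenvalue of a symmetric matrix. -/
def eigMin (M : Mat3) : ℝ := sInf (spectrum ℝ M)

/-- `ξ`, the ratio of the extreme eigenvalues of `Ā`. -/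
def xi (A : Mat3) : ℝ := eigMin (bar A) / eigMax (bar A)

/-- The upper bound `k̄` on the warping gain. -/
def kBound (A : Mat3) : ℝ := 1 / √(6 - max 1 (4 * xi A ^ 2))

/-! ### Potential functions and angular warping -/

/-- `U_A(X) = tr(A (I - X)) / (4 λ_max(Ā))`. -/
def potU (A X : Mat3) : ℝ := (A * (1 - X)).trace / (4 * eigMax (bar A))

/-- `V_A(X) = 2 (1 - √(1 - U_A(X)))`. -/
def potV (A X : Mat3) : ℝ := 2 * (1 - √(1 - potU A X))

/-- The warping rotation: angle `2 arcsin(k U_A(X))` about the axis `n`. -/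
def warpRot (A : Mat3) (k : ℝ) (n : Vec3) (X : Mat3) : Mat3 :=
  angleAxis (2 * Real.arcsin (k * potU A X)) n

/-- The warping transformation `Γ_A`. -/
def warp (A : Mat3) (k : ℝ) (n : Vec3) (X : Mat3) : Mat3 := X * warpRot A k n X

/-- The matrix `Θ_A`. -/
def theta (A : Mat3) (k : ℝ) (n : Vec3) (X : Mat3) : Mat3 :=
  (warpRot A k n X)ᵀ +
    (4 * k / (4 * eigMax (bar A) * √(1 - k ^ 2 * potU A X ^ 2))) •
      Matrix.vecMulVec n (psi (A * X))

/-- Gradient of `U_A ∘ Γ_A` for the metric `⟨X Ω₁, X Ω₂⟩ = tr(Ω₁ᵀ Ω₂)` on `SO(3)`. -/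
def gradWarpU (A : Mat3) (k : ℝ) (n : Vec3) (X : Mat3) : Mat3 :=
  (1 / (4 * eigMax (bar A))) •
    (X * skew ((theta A k n X)ᵀ *ᵥ psi (A * warp A k n X)))

/-- Gradient of `V_A ∘ Γ_A` for the same metric, at points where `U_A (Γ_A(X)) ≠ 1`. -/
def gradWarpV (A : Mat3) (k : ℝ) (n : Vec3) (X : Mat3) : Mat3 :=
  (√(1 - potU A (warp A k n X)))⁻¹ • gradWarpU A k n X

/-- Which of the two potential functions is composed with the warping. -/
inductive PotKind
  | U
  | V

/-- The parameters of the hybrid observer other than its gains. -/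
structure Design where
  /-- the choice between `Φ_{U_A}` and `Φ_{V_A}` -/
  kind : PotKind
  /-- the weighting matrix -/
  A : Mat3
  /-- the warping gain -/
  k : ℝ
  /-- the finite index set `𝒬` -/
  Q : Finset ℕ
  /-- the warping axes; only the values on `𝒬` matter -/
  ν : ℕ → Vec3
  /-- the hysteresis gap -/
  δ : ℝ

namespace Design

/-- The potential function `Φ`. -/
def Φ (P : Design) (X : Mat3) (q : ℕ) : ℝ :=
  match P.kind with
  | .U => potU P.A (warp P.A P.k (P.ν q) X)
  | .V => potV P.A (warp P.A P.k (P.ν q) X)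

/-- The gradient `∇Φ`. -/
def gradΦ (P : Design) (X : Mat3) (q : ℕ) : Mat3 :=
  match P.kind with
  | .U => gradWarpU P.A P.k (P.ν q) X
  | .V => gradWarpV P.A P.k (P.ν q) X

/-- `min_{p ∈ 𝒬} Φ(X, p)`; the set is finite, so that the infimum is a minimum. -/
def minΦ (P : Design) (X : Mat3) : ℝ := sInf ((fun p => P.Φ X p) '' (P.Q : Set ℕ))

/-- `argmin_{p ∈ 𝒬} Φ(X, p)`. -/
def argminΦ (P : Design) (X : Mat3) : Set ℕ := {p | p ∈ P.Q ∧ P.Φ X p = P.minΦ X}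

/-- The flow set `ℱ ⊆ SO(3) × 𝒬`. -/
def flowSet (P : Design) : Set (Mat3 × ℕ) :=
  {z | z.1 ∈ SO3 ∧ z.2 ∈ P.Q ∧ P.Φ z.1 z.2 - P.minΦ z.1 ≤ P.δ}

/-- The jump set `𝒥 ⊆ SO(3) × 𝒬`. -/
def jumpSet (P : Design) : Set (Mat3 × ℕ) :=
  {z | z.1 ∈ SO3 ∧ z.2 ∈ P.Q ∧ P.δ ≤ P.Φ z.1 z.2 - P.minΦ z.1}

end Design

/-! ### The four designs -/

/-- `Δ_I(k)`. -/
def gapI (k : ℝ) : ℝ := (-1 + √(1 + 4 * k ^ 2)) ^ 3 / (24 * k ^ 4)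

/-- `Δ_II(k)`. -/
def gapII (k : ℝ) : ℝ := 2 * √(gapI k)

/-- Six warping axes `± e₁, ± e₂, ± e₃` for an orthonormal basis `e₁, e₂, e₃`, with `A = I`. -/
def Design.IsSixAxes (P : Design) : Prop :=
  P.A = 1 ∧ P.Q = Finset.Icc 1 6 ∧
    ∃ e : OrthonormalBasis (Fin 3) ℝ (EuclideanSpace ℝ (Fin 3)),
      ∀ p : Fin 3, P.ν ((p : ℕ) + 1) = (e p).ofLp ∧
        P.ν ((p : ℕ) + 1 + 3) = -P.ν ((p : ℕ) + 1)

/-- Design D1. -/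
def Design.IsD1 (P : Design) : Prop :=
  P.kind = .U ∧ P.IsSixAxes ∧ (0 < P.k ∧ P.k < kBound P.A) ∧ 0 < P.δ ∧ P.δ < gapI P.k

/-- Design D2. -/
def Design.IsD2 (P : Design) : Prop :=
  P.kind = .V ∧ P.IsSixAxes ∧ (0 < P.k ∧ P.k < kBound P.A) ∧ 0 < P.δ ∧ P.δ < gapII P.k

/-- The first case in the choice of the warping axis; `l 0, l 1, l 2` are the eigenvalues
`λ₁, λ₂, λ₃`. -/
def SpreadEig (l : Fin 3 → ℝ) : Prop := 0 ≤ l 1 * l 2 - l 0 * l 1 - l 0 * l 2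

/-- `∑_ℓ ∑_{k ≠ ℓ} λ_ℓ λ_k`. -/
def pairSum (l : Fin 3 → ℝ) : ℝ := ∑ a, ∑ b ∈ Finset.univ.erase a, l a * l b

open Classical in
/-- The constant `Λ`. -/
def capLambda (l : Fin 3 → ℝ) : ℝ :=
  if SpreadEig l then l 0 / (l 1 + l 2)
  else 4 * (∏ j, l j) / ((l 1 + l 2) * pairSum l)

/-- The constant `V̄`. -/
def Vbar (A : Mat3) (l : Fin 3 → ℝ) (k : ℝ) : ℝ :=
  (-1 + √(1 + 4 * k ^ 2 * xi A * capLambda l)) / (2 * k ^ 2 * capLambda l)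

/-- `Δ_III(A, k)`. -/
def gapIII (A : Mat3) (l : Fin 3 → ℝ) (k : ℝ) : ℝ :=
  4 * k ^ 2 * Vbar A l k ^ 2 * (1 - k ^ 2 * Vbar A l k ^ 2) * capLambda l

/-- `Δ_IV(A, k)`. -/
def gapIV (A : Mat3) (l : Fin 3 → ℝ) (k : ℝ) : ℝ :=
  2 * (-√(1 - xi A) + √(1 - xi A + gapIII A l k))

/-- Two opposite warping axes `± u`, for a positive definite `A` with distinct eigenvalues
`0 < l 0 < l 1 < l 2` and corresponding orthonormal eigenvectors `v 0, v 1, v 2`. -/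
def Design.IsTwoAxes (P : Design) (l : Fin 3 → ℝ) : Prop :=
  P.A.PosDef ∧ (0 < l 0 ∧ l 0 < l 1 ∧ l 1 < l 2) ∧ P.Q = {1, 2} ∧
    ∃ v : OrthonormalBasis (Fin 3) ℝ (EuclideanSpace ℝ (Fin 3)),
      (∀ i, P.A *ᵥ (v i).ofLp = l i • (v i).ofLp) ∧
      ∃ u : Vec3, u ⬝ᵥ u = 1 ∧ P.ν 1 = u ∧ P.ν 2 = -u ∧
        (SpreadEig l →
          u ⬝ᵥ (v 0).ofLp = 0 ∧
            (u ⬝ᵥ (v 1).ofLp) ^ 2 = l 1 / (l 1 + l 2) ∧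
            (u ⬝ᵥ (v 2).ofLp) ^ 2 = l 2 / (l 1 + l 2)) ∧
        (¬ SpreadEig l →
          ∀ i, (u ⬝ᵥ (v i).ofLp) ^ 2 =
            1 - 4 * (∏ j ∈ Finset.univ.erase i, l j) / pairSum l)

/-- Design D3. -/
def Design.IsD3 (P : Design) : Prop :=
  P.kind = .U ∧ ∃ l : Fin 3 → ℝ, P.IsTwoAxes l ∧ (0 < P.k ∧ P.k < kBound P.A) ∧
    0 < P.δ ∧ P.δ < gapIII P.A l P.k

/-- Design D4. -/
def Design.IsD4 (P : Design) : Prop :=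
  P.kind = .V ∧ ∃ l : Fin 3 → ℝ, P.IsTwoAxes l ∧ (0 < P.k ∧ P.k < kBound P.A) ∧
    0 < P.δ ∧ P.δ < gapIV P.A l P.k

/-! ### The rigid body -/

/-- `R` is an `SO(3)`-valued, locally absolutely continuous solution of `Ṙ = R [ω]_×` on `[0, ∞)`
(the differential equation holds almost everywhere). -/
def IsAttitude (ω : ℝ → Vec3) (R : ℝ → Mat3) : Prop :=
  (∀ t, 0 ≤ t → R t ∈ SO3) ∧
  (∀ a b, 0 ≤ a → a ≤ b → ∀ i j, AbsolutelyContinuousOnInterval (fun t => R t i j) a b) ∧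
  (∀ᵐ t, 0 ≤ t → ∀ i j, HasDerivAt (fun s => R s i j) ((R t * skew (ω t)) i j) t)

/-! ### Hybrid arcs and solutions of the observer -/

/-- `E` is a hybrid time domain with initial time `t₀`: a union of infinitely many intervals
`[τ_j, τ_{j+1}] × {j}`, or of finitely many, the last one being an interval with left end point
`τ_N` that belongs to it: `[τ_N, T]`, `[τ_N, T)` or `[τ_N, ∞)`. -/
def IsHybridTimeDomain (t₀ : ℝ) (E : Set (ℝ × ℕ)) : Prop :=
  ∃ τ : ℕ → ℝ, Monotone τ ∧ τ 0 = t₀ ∧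
    (E = {z | τ z.2 ≤ z.1 ∧ z.1 ≤ τ (z.2 + 1)} ∨
      ∃ (N : ℕ) (I : Set ℝ), I.OrdConnected ∧ IsLeast I (τ N) ∧
        E = {z | (z.2 < N ∧ τ z.2 ≤ z.1 ∧ z.1 ≤ τ (z.2 + 1)) ∨ (z.2 = N ∧ z.1 ∈ I)})

/-- The state `(R̂, b̂_ω, q)` of the observer along a hybrid time domain. Values outside `dom` are
irrelevant. -/
structure Arc where
  dom : Set (ℝ × ℕ)
  /-- attitude estimate -/
  Rh : ℝ → ℕ → Mat3
  /-- bias estimate -/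
  bh : ℝ → ℕ → Vec3
  /-- discrete variable -/
  q : ℝ → ℕ → ℕ

namespace Arc

/-- The interval `I_j = {t | (t, j) ∈ dom}`. -/
def slice (x : Arc) (j : ℕ) : Set ℝ := {t | (t, j) ∈ x.dom}

/-- The attitude estimation error `R̃ = R R̂ᵀ`. -/
def Rt (x : Arc) (R : ℝ → Mat3) (t : ℝ) (j : ℕ) : Mat3 := R t * (x.Rh t j)ᵀ

/-- The bias estimation error `b̃_ω = b_ω - b̂_ω`. -/
def bt (x : Arc) (b : Vec3) (t : ℝ) (j : ℕ) : Vec3 := b - x.bh t j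

/-- The Euclidean norm of `e = (|R̃|_I, ‖b̃_ω‖)`. -/
def err (x : Arc) (R : ℝ → Mat3) (b : Vec3) (t : ℝ) (j : ℕ) : ℝ :=
  √(rotNorm (x.Rt R t j) ^ 2 + vnorm (x.bt b t j) ^ 2)

/-- The innovation `β = R̂ᵀ [R̃ᵀ ∇Φ(R̃, q)]_⊗`. -/
def beta (x : Arc) (P : Design) (R : ℝ → Mat3) (t : ℝ) (j : ℕ) : Vec3 :=
  (x.Rh t j)ᵀ *ᵥ psi ((x.Rt R t j)ᵀ * P.gradΦ (x.Rt R t j) (x.q t j))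

/-- `x` is a solution, with initial time `t₀`, of the hybrid observer with parameters `P` and gains
`γP`, `γI`, when the true attitude is `R`, the true angular velocity is `ω`, the gyro bias is `b`,
and hence the measured angular velocity is `ω + b`. -/
structure IsSolution (P : Design) (γP γI t₀ : ℝ) (ω : ℝ → Vec3) (R : ℝ → Mat3) (b : Vec3)
    (x : Arc) : Prop where
  isDomain : IsHybridTimeDomain t₀ x.dom
  mem_SO3 : ∀ t j, (t, j) ∈ x.dom → x.Rh t j ∈ SO3
  mem_Q : ∀ t j, (t, j) ∈ x.dom → x.q t j ∈ P.Q
  -- local absolute continuity on every interval of flow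
  ac_Rh : ∀ j, ∀ s ∈ x.slice j, ∀ t ∈ x.slice j, ∀ m n,
    AbsolutelyContinuousOnInterval (fun r => x.Rh r j m n) s t
  ac_bh : ∀ j, ∀ s ∈ x.slice j, ∀ t ∈ x.slice j, ∀ m,
    AbsolutelyContinuousOnInterval (fun r => x.bh r j m) s t
  -- flows: the state stays in the flow set and obeys the differential equations
  flow_mem : ∀ j, ∀ t ∈ interior (x.slice j), (x.Rt R t j, x.q t j) ∈ P.flowSet
  flow_q : ∀ j, ∀ s ∈ x.slice j, ∀ t ∈ x.slice j, x.q s j = x.q t j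
  flow_Rh : ∀ j, ∀ᵐ t, t ∈ x.slice j → ∀ m n,
    HasDerivAt (fun r => x.Rh r j m n)
      ((x.Rh t j * skew ((ω t + b) - x.bh t j + γP • x.beta P R t j)) m n) t
  flow_bh : ∀ j, ∀ᵐ t, t ∈ x.slice j → ∀ m,
    HasDerivAt (fun r => x.bh r j m) ((-(γI • x.beta P R t j)) m) t
  -- jumps: they start in the jump set and change the discrete variable only
  jump_mem : ∀ t j, (t, j) ∈ x.dom → (t, j + 1) ∈ x.dom → (x.Rt R t j, x.q t j) ∈ P.jumpSet
  jump_q : ∀ t j, (t, j) ∈ x.dom → (t, j + 1) ∈ x.dom →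
    x.q t (j + 1) ∈ P.argminΦ (x.Rt R t j)
  jump_Rh : ∀ t j, (t, j) ∈ x.dom → (t, j + 1) ∈ x.dom → x.Rh t (j + 1) = x.Rh t j
  jump_bh : ∀ t j, (t, j) ∈ x.dom → (t, j + 1) ∈ x.dom → x.bh t (j + 1) = x.bh t j

/-- `y` extends `x`: it has a larger domain and agrees with `x` on the domain of `x`. -/
def Extends (y x : Arc) : Prop :=
  x.dom ⊆ y.dom ∧
    ∀ t j, (t, j) ∈ x.dom → y.Rh t j = x.Rh t j ∧ y.bh t j = x.bh t j ∧ y.q t j = x.q t j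

/-- `x` is a solution that cannot be extended. -/
def IsMaximalSolution (P : Design) (γP γI t₀ : ℝ) (ω : ℝ → Vec3) (R : ℝ → Mat3) (b : Vec3)
    (x : Arc) : Prop :=
  x.IsSolution P γP γI t₀ ω R b ∧
    ∀ y : Arc, y.IsSolution P γP γI t₀ ω R b → y.Extends x → y.dom = x.dom

/-- The domain of `x` is unbounded. -/
def IsComplete (x : Arc) : Prop := ∀ M : ℝ, ∃ t j, (t, j) ∈ x.dom ∧ M ≤ t + (j : ℝ)

/-- The number of jumps of `x` is finite. -/
def FinitelyManyJumps (x : Arc) : Prop := ∃ J : ℕ, ∀ t j, (t, j) ∈ x.dom → j ≤ J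

end Arc

end HybridObserver

end

open HybridObserver

/-! Geometry of the warped potentials. Write a rotation $X$ as a unit quaternion $(\eta,e)$. Then
$|X|_I=\|e\|$ and $U_A(X)=e\cdot\bar Ae/\lambda_{\max}$, and warping multiplies by the quaternion
$(\sqrt{1-s^2},\,s\,n)$ with $s=kU_A(X)$, so statements about $\Phi$ become vector algebra. If
$\psi(A\Gamma)=0$ and $\Gamma\ne I$, then $\Gamma$ is a half-turn about a unit eigenvector $a$ of
$\bar A$. Inverting the warping expresses $X$ through $s$ alone, and $x=U_A(X)$ solves a scalar
equation $x=m-(kx)^2d$. At such a point another warping axis lowers $\Phi$ by more than $\delta$, so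
no undesired critical point lies in the flow set. The four designs differ only in this argument;
what is kept of it is `Design.Admissible`.

Decay. For each $q$ the flow set is compact, on it $\psi(A\Gamma)$ vanishes only for $\Gamma=I$, and
$\Theta_A$ is uniformly invertible. Hence the vector $g=[\tilde R^\top\nabla\Phi]_\otimes$ has norm
comparable to $|\tilde R|_I$ (`exists_innov_bounds`). The function $\Phi+\|\tilde
b_\omega\|^2/\gamma_I$ has derivative $-2\gamma_P\|g\|^2$ along flows and loses at least $\delta$ at
each jump. This bounds the number of jumps and the bias error in terms of the initial error, but
gives no decay of the bias. Adding $\varepsilon\,\psi(\tilde R)\cdot R\tilde b_\omega$ contributes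
$-\tfrac\varepsilon2\|\tilde b_\omega\|^2$, up to a multiple of $|\tilde R|_I^2$ that depends on the
bounds for $\omega$ and $\tilde b_\omega$ (`cross_deriv_le`). For small $\varepsilon$ the sum decays
exponentially, and it stays between fixed multiples of $\|e\|^2$ that do not depend on
$\varepsilon$. So $K$ depends on neither $c$ nor $r$; only the rate does. The at most $J$ jumps cost
one factor `Real.exp 1` in $K$.

Completeness. The bound on jumps leaves a last interval of flow. If it were bounded, the solution
could be extended: by its limit at the end point, by a jump, or by a local flow. The local flow
comes from Picard–Lindelöf for the error system, whose right-hand side contains $R(t)$ but not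
$\omega$ and is therefore continuous in time (`isComplete`). -/

namespace HybridObserver

/-! ### Vectors, skew-symmetric matrices and rotations -/

theorem dotProduct_three (u v : Vec3) : u ⬝ᵥ v = u 0 * v 0 + u 1 * v 1 + u 2 * v 2 := by
  simp [dotProduct, Fin.sum_univ_three]

theorem vnorm_nonneg (v : Vec3) : 0 ≤ vnorm v := norm_nonneg _

theorem vnorm_sq (v : Vec3) : vnorm v ^ 2 = v ⬝ᵥ v := by
  rw [vnorm, EuclideanSpace.norm_sq_eq, dotProduct_three]
  simp [Fin.sum_univ_three, sq]

theorem dotProduct_self_nonneg' (v : Vec3) : 0 ≤ v ⬝ᵥ v := by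
  rw [← vnorm_sq]; positivity

theorem vnorm_eq_sqrt (v : Vec3) : vnorm v = √(v ⬝ᵥ v) := by
  rw [← vnorm_sq, Real.sqrt_sq (vnorm_nonneg v)]

theorem abs_dotProduct_le (u v : Vec3) : |u ⬝ᵥ v| ≤ vnorm u * vnorm v := by
  apply abs_le_of_sq_le_sq _ (mul_nonneg (vnorm_nonneg u) (vnorm_nonneg v))
  rw [mul_pow, vnorm_sq, vnorm_sq]
  simp only [dotProduct_three]
  -- Lagrange's identity: the difference of the two sides is the squared norm of the cross product.
  nlinarith [sq_nonneg (u 0 * v 1 - u 1 * v 0), sq_nonneg (u 0 * v 2 - u 2 * v 0),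
    sq_nonneg (u 1 * v 2 - u 2 * v 1)]

theorem vnorm_add_le (u v : Vec3) : vnorm (u + v) ≤ vnorm u + vnorm v := by
  simpa [vnorm] using norm_add_le (WithLp.toLp 2 u) (WithLp.toLp 2 v)

theorem vnorm_smul (c : ℝ) (v : Vec3) : vnorm (c • v) = |c| * vnorm v := by
  simpa [vnorm] using norm_smul c (WithLp.toLp 2 v)

theorem vnorm_neg (v : Vec3) : vnorm (-v) = vnorm v := by
  simp [vnorm]

theorem abs_apply_le_vnorm (v : Vec3) (i : Fin 3) : |v i| ≤ vnorm v := by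
  simpa [vnorm] using PiLp.norm_apply_le (WithLp.toLp 2 v) i

theorem eq_zero_of_dotProduct_self {v : Vec3} (h : v ⬝ᵥ v = 0) : v = 0 := by
  rw [dotProduct_three] at h
  have h0 : v 0 = 0 := by nlinarith [sq_nonneg (v 0), sq_nonneg (v 1), sq_nonneg (v 2)]
  have h1 : v 1 = 0 := by nlinarith [sq_nonneg (v 0), sq_nonneg (v 1), sq_nonneg (v 2)]
  have h2 : v 2 = 0 := by nlinarith [sq_nonneg (v 0), sq_nonneg (v 1), sq_nonneg (v 2)]
  ext i; fin_cases i <;> simp [h0, h1, h2]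

theorem skew_apply (x : Vec3) :
    (skew x 0 0 = 0 ∧ skew x 0 1 = -x 2 ∧ skew x 0 2 = x 1) ∧
    (skew x 1 0 = x 2 ∧ skew x 1 1 = 0 ∧ skew x 1 2 = -x 0) ∧
    (skew x 2 0 = -x 1 ∧ skew x 2 1 = x 0 ∧ skew x 2 2 = 0) := by
  simp [skew]

theorem mulVec_three (M : Mat3) (v : Vec3) (i : Fin 3) :
    (M *ᵥ v) i = M i 0 * v 0 + M i 1 * v 1 + M i 2 * v 2 := by
  simp [Matrix.mulVec, dotProduct, Fin.sum_univ_three]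

theorem skew_mulVec_apply (x y : Vec3) :
    (skew x *ᵥ y) 0 = x 1 * y 2 - x 2 * y 1 ∧ (skew x *ᵥ y) 1 = x 2 * y 0 - x 0 * y 2 ∧
      (skew x *ᵥ y) 2 = x 0 * y 1 - x 1 * y 0 := by
  simp only [mulVec_three, skew_apply]
  refine ⟨?_, ?_, ?_⟩ <;> ring

theorem psi_skew (x : Vec3) : psi (skew x) = x := by
  ext i; fin_cases i <;> simp [psi, skew]

theorem psi_smul (c : ℝ) (M : Mat3) : psi (c • M) = c • psi M := by
  ext i; fin_cases i <;> simp [psi] <;> ring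

theorem skew_smul (c : ℝ) (v : Vec3) : skew (c • v) = c • skew v := by
  ext i j; fin_cases i <;> fin_cases j <;> simp [skew]

theorem skew_add (u v : Vec3) : skew (u + v) = skew u + skew v := by
  ext i j; fin_cases i <;> fin_cases j <;> simp [skew] <;> ring

theorem skew_neg (v : Vec3) : skew (-v) = -skew v := by
  ext i j; fin_cases i <;> fin_cases j <;> simp [skew]

theorem skew_transpose (v : Vec3) : (skew v)ᵀ = -skew v := by
  ext i j; fin_cases i <;> fin_cases j <;> simp [skew]

theorem trace_mul_skew (M : Mat3) (v : Vec3) : (M * skew v).trace = -2 * (psi M ⬝ᵥ v) := by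
  simp [Matrix.trace, Fin.sum_univ_three, Matrix.mul_apply, skew, psi, dotProduct]
  ring

theorem vnorm_skew_mulVec_le (u v : Vec3) : vnorm (skew u *ᵥ v) ≤ vnorm u * vnorm v := by
  apply le_of_sq_le_sq _ (mul_nonneg (vnorm_nonneg u) (vnorm_nonneg v))
  rw [mul_pow, vnorm_sq, vnorm_sq, vnorm_sq]
  simp only [dotProduct_three, skew_mulVec_apply]
  nlinarith [sq_nonneg (u 0 * v 0 + u 1 * v 1 + u 2 * v 2)]

section SpecialOrthogonal

variable {X Y : Mat3}

theorem SO3.mul_transpose (h : X ∈ SO3) : X * Xᵀ = 1 := by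
  have := (Matrix.mem_specialOrthogonalGroup_iff.1 h).1
  simpa [Matrix.star_eq_conjTranspose] using (Matrix.mem_orthogonalGroup_iff _ _).1 this

theorem SO3.transpose_mul (h : X ∈ SO3) : Xᵀ * X = 1 := by
  have := (Matrix.mem_specialOrthogonalGroup_iff.1 h).1
  simpa [Matrix.star_eq_conjTranspose] using (Matrix.mem_orthogonalGroup_iff' _ _).1 this

theorem SO3.det_eq_one (h : X ∈ SO3) : X.det = 1 :=
  (Matrix.mem_specialOrthogonalGroup_iff.1 h).2

theorem SO3.of_mul_transpose (h : X * Xᵀ = 1) (hd : X.det = 1) : X ∈ SO3 := by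
  refine Matrix.mem_specialOrthogonalGroup_iff.2 ⟨?_, hd⟩
  rw [Matrix.mem_orthogonalGroup_iff]
  simpa [Matrix.star_eq_conjTranspose] using h

theorem SO3.transpose_mem (h : X ∈ SO3) : Xᵀ ∈ SO3 :=
  SO3.of_mul_transpose (by simpa using SO3.transpose_mul h) (by simpa using SO3.det_eq_one h)

theorem SO3.mulVec_dotProduct_mulVec (h : X ∈ SO3) (u v : Vec3) :
    (X *ᵥ u) ⬝ᵥ (X *ᵥ v) = u ⬝ᵥ v := by
  rw [Matrix.dotProduct_mulVec, Matrix.vecMul_mulVec, SO3.transpose_mul h, Matrix.vecMul_one]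

theorem SO3.vnorm_mulVec (h : X ∈ SO3) (v : Vec3) : vnorm (X *ᵥ v) = vnorm v := by
  rw [vnorm_eq_sqrt, vnorm_eq_sqrt, SO3.mulVec_dotProduct_mulVec h]

/-- The cofactor identity for the cross product. It needs no orthogonality, so it serves both
rotations and eigenbases of determinant $-1$. -/
theorem skew_mulVec_conj (M : Mat3) (v : Vec3) :
    Mᵀ * skew (M *ᵥ v) * M = M.det • skew v := by
  rw [Matrix.det_fin_three]
  ext i j
  fin_cases i <;> fin_cases j <;>
    simp [skew, Matrix.mul_apply, Fin.sum_univ_three, mulVec_three] <;> ring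

theorem SO3.mul_skew_mul_transpose (h : X ∈ SO3) (v : Vec3) :
    X * skew v * Xᵀ = skew (X *ᵥ v) := by
  have := skew_mulVec_conj X v
  rw [SO3.det_eq_one h, one_smul] at this
  rw [← this]
  simp only [← mul_assoc, SO3.mul_transpose h, one_mul]
  rw [mul_assoc, SO3.mul_transpose h, mul_one]

theorem SO3.abs_apply_le (h : X ∈ SO3) (i j : Fin 3) : |X i j| ≤ 1 := by
  have h1 := congrFun (congrFun (SO3.mul_transpose h) i) i
  rw [Matrix.mul_apply', Matrix.one_apply_eq] at h1
  have h2 : vnorm (X i) = 1 := by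
    rw [vnorm_eq_sqrt, Real.sqrt_eq_one]; exact h1
  exact h2 ▸ abs_apply_le_vnorm (X i) j

end SpecialOrthogonal

/-! ### Unit quaternions -/

/-- The matrix of the quaternion with scalar part `η` and vector part `e`. -/
def quatMat (η : ℝ) (e : Vec3) : Mat3 :=
  (η ^ 2 - e ⬝ᵥ e) • (1 : Mat3) + (2 : ℝ) • Matrix.vecMulVec e e + (2 * η) • skew e

/-- The Hamilton product. Being a polynomial identity, it holds without normalization, and it turns
composition with a warping rotation into vector algebra. -/
theorem quatMat_mul (η ζ : ℝ) (e f : Vec3) :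
    quatMat η e * quatMat ζ f =
      quatMat (η * ζ - e ⬝ᵥ f) (η • f + ζ • e + skew e *ᵥ f) := by
  ext i j
  fin_cases i <;> fin_cases j <;>
    simp [quatMat, skew_apply, Matrix.mul_apply, Fin.sum_univ_three, Matrix.vecMulVec_apply,
      dotProduct_three, skew_mulVec_apply] <;> ring

theorem quatMat_transpose (η : ℝ) (e : Vec3) : (quatMat η e)ᵀ = quatMat η (-e) := by
  ext i j
  fin_cases i <;> fin_cases j <;>
    simp [quatMat, skew_apply, Matrix.vecMulVec_apply, dotProduct_three] <;> ring

theorem quatMat_neg (η : ℝ) (e : Vec3) : quatMat (-η) (-e) = quatMat η e := by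
  ext i j
  fin_cases i <;> fin_cases j <;>
    simp [quatMat, skew_apply, Matrix.vecMulVec_apply, dotProduct_three]

theorem quatMat_norm_mul (η ζ : ℝ) (e f : Vec3) :
    (η * ζ - e ⬝ᵥ f) ^ 2 +
      (η • f + ζ • e + skew e *ᵥ f) ⬝ᵥ (η • f + ζ • e + skew e *ᵥ f) =
      (η ^ 2 + e ⬝ᵥ e) * (ζ ^ 2 + f ⬝ᵥ f) := by
  simp [dotProduct_three, skew_mulVec_apply]; ring

theorem quatMat_one_zero : quatMat 1 0 = 1 := by
  ext i j
  fin_cases i <;> fin_cases j <;> simp [quatMat, skew_apply]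

theorem quatMat_det (η : ℝ) (e : Vec3) : (quatMat η e).det = (η ^ 2 + e ⬝ᵥ e) ^ 3 := by
  rw [Matrix.det_fin_three]
  simp [quatMat, skew_apply, Matrix.vecMulVec_apply, dotProduct_three]
  ring

theorem quatMat_mem_SO3 {η : ℝ} {e : Vec3} (h : η ^ 2 + e ⬝ᵥ e = 1) : quatMat η e ∈ SO3 := by
  apply SO3.of_mul_transpose
  · rw [quatMat_transpose, quatMat_mul]
    have h1 : η • -e + η • e + skew e *ᵥ -e = 0 := by
      ext i; fin_cases i <;> simp [skew_mulVec_apply] <;> ring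
    have h2 : η * η - e ⬝ᵥ -e = 1 := by rw [dotProduct_neg]; linarith [sq η]
    rw [h1, h2, quatMat_one_zero]
  · rw [quatMat_det, h, one_pow]

theorem four_mul_div_mul_div {x y z r : ℝ} (hr : r ≠ 0) (h : x * y = r ^ 2 * z) :
    4 * (x / (2 * r)) * (y / (2 * r)) = z := by
  field_simp; linarith

theorem exists_sq_eq {x : ℝ} (hx : 0 < x) : ∃ r : ℝ, r ^ 2 = x ∧ r ≠ 0 :=
  ⟨√x, Real.sq_sqrt hx.le, (Real.sqrt_pos.2 hx).ne'⟩

-- The entries of $X$ determine the symmetric matrix $4qq^\top$ of the quaternion $q$ to be found.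
-- Some diagonal entry $r^2$ of it is positive, and the corresponding row divided by $2r$ is $q$.
-- Choosing the pivot by cases covers the half-turns, where the scalar part vanishes.
set_option maxHeartbeats 1000000 in
theorem SO3.exists_quat {X : Mat3} (hX : X ∈ SO3) :
    ∃ (η : ℝ) (e : Vec3), η ^ 2 + e ⬝ᵥ e = 1 ∧ X = quatMat η e := by
  have hr := SO3.mul_transpose hX
  have hc := SO3.transpose_mul hX
  -- Since $\det X=1$, each entry equals its cofactor; these quadratic relations distinguish
  -- rotations from reflections.
  have cof (i j : Fin 3) : X.adjugate i j = X j i := by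
    have : X.adjugate = Xᵀ := by
      have := Matrix.adjugate_mul X
      rw [SO3.det_eq_one hX, one_smul] at this
      calc X.adjugate = X.adjugate * (X * Xᵀ) := by rw [hr, mul_one]
        _ = Xᵀ := by rw [← mul_assoc, this, one_mul]
    rw [this]; rfl
  have r (i j : Fin 3) := congrFun (congrFun hr i) j
  have c (i j : Fin 3) := congrFun (congrFun hc i) j
  simp only [Matrix.mul_apply, Fin.sum_univ_three, Matrix.transpose_apply] at r c
  have r00 := r 0 0; have r11 := r 1 1; have r22 := r 2 2
  have r01 := r 0 1; have r02 := r 0 2; have r12 := r 1 2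
  have c00 := c 0 0; have c11 := c 1 1; have c22 := c 2 2
  have c01 := c 0 1; have c02 := c 0 2; have c12 := c 1 2
  have k00 := cof 0 0; have k01 := cof 0 1; have k02 := cof 0 2
  have k10 := cof 1 0; have k11 := cof 1 1; have k12 := cof 1 2
  have k20 := cof 2 0; have k21 := cof 2 1; have k22 := cof 2 2
  clear r c cof
  simp [Matrix.adjugate_fin_three] at r00 r11 r22 r01 r02 r12 c00 c11 c22 c01 c02 c12 k00 k01 k02 k10 k11 k12 k20 k21 k22
  generalize ha : X 0 0 = a at *
  generalize hb : X 0 1 = b at *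
  generalize hcc : X 0 2 = c at *
  generalize hd : X 1 0 = d at *
  generalize he : X 1 1 = e at *
  generalize hf : X 1 2 = f at *
  generalize hg : X 2 0 = g at *
  generalize hh : X 2 1 = h at *
  generalize hi : X 2 2 = i at *
  -- With $Q=4qq^\top$ written in the entries of $X$, the fact `tmij` is
  -- $Q_{mi}Q_{mj}=Q_{mm}Q_{ij}$: the matrix $Q$ has rank one.
  have t011 : (h - f) * (h - f) = (1 + a + e + i) * (1 + a - e - i) := by grind
  have t012 : (h - f) * (c - g) = (1 + a + e + i) * (b + d) := by grind
  have t013 : (h - f) * (d - b) = (1 + a + e + i) * (c + g) := by grind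
  have t022 : (c - g) * (c - g) = (1 + a + e + i) * (1 - a + e - i) := by grind
  have t023 : (c - g) * (d - b) = (1 + a + e + i) * (f + h) := by grind
  have t033 : (d - b) * (d - b) = (1 + a + e + i) * (1 - a - e + i) := by grind
  have t102 : (h - f) * (b + d) = (1 + a - e - i) * (c - g) := by grind
  have t103 : (h - f) * (c + g) = (1 + a - e - i) * (d - b) := by grind
  have t122 : (b + d) * (b + d) = (1 + a - e - i) * (1 - a + e - i) := by grind
  have t123 : (b + d) * (c + g) = (1 + a - e - i) * (f + h) := by grind
  have t133 : (c + g) * (c + g) = (1 + a - e - i) * (1 - a - e + i) := by grind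
  have t201 : (c - g) * (b + d) = (1 - a + e - i) * (h - f) := by grind
  have t203 : (c - g) * (f + h) = (1 - a + e - i) * (d - b) := by grind
  have t213 : (b + d) * (f + h) = (1 - a + e - i) * (c + g) := by grind
  have t233 : (f + h) * (f + h) = (1 - a + e - i) * (1 - a - e + i) := by grind
  have t301 : (d - b) * (c + g) = (1 - a - e + i) * (h - f) := by grind
  have t302 : (d - b) * (f + h) = (1 - a - e + i) * (c - g) := by grind
  have t312 : (c + g) * (f + h) = (1 - a - e + i) * (b + d) := by grind
  have key (q0 q1 q2 q3 : ℝ)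
      (h00 : 4 * q0 * q0 = (1 + a + e + i)) (h01 : 4 * q0 * q1 = (h - f))
      (h02 : 4 * q0 * q2 = (c - g)) (h03 : 4 * q0 * q3 = (d - b))
      (h11 : 4 * q1 * q1 = (1 + a - e - i)) (h12 : 4 * q1 * q2 = (b + d)) (h13 : 4 * q1 * q3 = (c + g))
      (h22 : 4 * q2 * q2 = (1 - a + e - i)) (h23 : 4 * q2 * q3 = (f + h))
      (h33 : 4 * q3 * q3 = (1 - a - e + i)) :
      ∃ (η : ℝ) (v : Vec3), η ^ 2 + v ⬝ᵥ v = 1 ∧ X = quatMat η v := by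
    refine ⟨q0, ![q1, q2, q3], ?_, ?_⟩
    · simp; linarith
    · ext m n
      fin_cases m <;> fin_cases n <;>
        simp [quatMat, skew_apply, ha, hb, hcc, hd, he, hf, hg, hh, hi] <;> linarith
  by_cases hp : 0 < (1 + a + e + i)
  · obtain ⟨r, hr2, hr0⟩ := exists_sq_eq hp
    exact key ((1 + a + e + i) / (2 * r)) ((h - f) / (2 * r)) ((c - g) / (2 * r)) ((d - b) / (2 * r))
      (four_mul_div_mul_div hr0 (by rw [hr2]))
      (four_mul_div_mul_div hr0 (by rw [hr2]))
      (four_mul_div_mul_div hr0 (by rw [hr2]))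
      (four_mul_div_mul_div hr0 (by rw [hr2]))
      (four_mul_div_mul_div hr0 (t011.trans (by rw [hr2])))
      (four_mul_div_mul_div hr0 (t012.trans (by rw [hr2])))
      (four_mul_div_mul_div hr0 (t013.trans (by rw [hr2])))
      (four_mul_div_mul_div hr0 (t022.trans (by rw [hr2])))
      (four_mul_div_mul_div hr0 (t023.trans (by rw [hr2])))
      (four_mul_div_mul_div hr0 (t033.trans (by rw [hr2])))
  by_cases hp : 0 < (1 + a - e - i)
  · obtain ⟨r, hr2, hr0⟩ := exists_sq_eq hp
    exact key ((h - f) / (2 * r)) ((1 + a - e - i) / (2 * r)) ((b + d) / (2 * r)) ((c + g) / (2 * r))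
      (four_mul_div_mul_div hr0 ((t011.trans (mul_comm _ _)).trans (by rw [hr2])))
      (four_mul_div_mul_div hr0 (by rw [hr2, mul_comm]))
      (four_mul_div_mul_div hr0 (t102.trans (by rw [hr2])))
      (four_mul_div_mul_div hr0 (t103.trans (by rw [hr2])))
      (four_mul_div_mul_div hr0 (by rw [hr2]))
      (four_mul_div_mul_div hr0 (by rw [hr2]))
      (four_mul_div_mul_div hr0 (by rw [hr2]))
      (four_mul_div_mul_div hr0 (t122.trans (by rw [hr2])))
      (four_mul_div_mul_div hr0 (t123.trans (by rw [hr2])))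
      (four_mul_div_mul_div hr0 (t133.trans (by rw [hr2])))
  by_cases hp : 0 < (1 - a + e - i)
  · obtain ⟨r, hr2, hr0⟩ := exists_sq_eq hp
    exact key ((c - g) / (2 * r)) ((b + d) / (2 * r)) ((1 - a + e - i) / (2 * r)) ((f + h) / (2 * r))
      (four_mul_div_mul_div hr0 ((t022.trans (mul_comm _ _)).trans (by rw [hr2])))
      (four_mul_div_mul_div hr0 (t201.trans (by rw [hr2])))
      (four_mul_div_mul_div hr0 (by rw [hr2, mul_comm]))
      (four_mul_div_mul_div hr0 (t203.trans (by rw [hr2])))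
      (four_mul_div_mul_div hr0 ((t122.trans (mul_comm _ _)).trans (by rw [hr2])))
      (four_mul_div_mul_div hr0 (by rw [hr2, mul_comm]))
      (four_mul_div_mul_div hr0 (t213.trans (by rw [hr2])))
      (four_mul_div_mul_div hr0 (by rw [hr2]))
      (four_mul_div_mul_div hr0 (by rw [hr2]))
      (four_mul_div_mul_div hr0 (t233.trans (by rw [hr2])))
  -- The four diagonal entries add up to 4, so the last one is positive when the others are not.
  have hp : 0 < (1 - a - e + i) := by linarith
  obtain ⟨r, hr2, hr0⟩ := exists_sq_eq hp
  exact key ((d - b) / (2 * r)) ((c + g) / (2 * r)) ((f + h) / (2 * r)) ((1 - a - e + i) / (2 * r))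
      (four_mul_div_mul_div hr0 ((t033.trans (mul_comm _ _)).trans (by rw [hr2])))
      (four_mul_div_mul_div hr0 (t301.trans (by rw [hr2])))
      (four_mul_div_mul_div hr0 (t302.trans (by rw [hr2])))
      (four_mul_div_mul_div hr0 (by rw [hr2, mul_comm]))
      (four_mul_div_mul_div hr0 ((t133.trans (mul_comm _ _)).trans (by rw [hr2])))
      (four_mul_div_mul_div hr0 (t312.trans (by rw [hr2])))
      (four_mul_div_mul_div hr0 (by rw [hr2, mul_comm]))
      (four_mul_div_mul_div hr0 ((t233.trans (mul_comm _ _)).trans (by rw [hr2])))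
      (four_mul_div_mul_div hr0 (by rw [hr2, mul_comm]))
      (four_mul_div_mul_div hr0 (by rw [hr2]))

/-! ### Potential functions in quaternion coordinates -/

/-- This is where $\bar A$ comes from: the potential is its quadratic form on the vector part of the
quaternion. -/
theorem trace_mul_one_sub_quatMat {A : Mat3} (hA : Aᵀ = A) {η : ℝ} {e : Vec3}
    (h : η ^ 2 + e ⬝ᵥ e = 1) :
    (A * (1 - quatMat η e)).trace = 4 * (e ⬝ᵥ (bar A *ᵥ e)) := by
  have s (i j : Fin 3) : A i j = A j i := congrFun (congrFun hA j) i
  have e1 : η ^ 2 = 1 - e ⬝ᵥ e := by linarith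
  simp only [quatMat, e1]
  simp [Matrix.trace, Fin.sum_univ_three, Matrix.mul_apply, skew_apply, dotProduct_three,
    mulVec_three, bar, Matrix.vecMulVec_apply, s 1 0, s 2 0, s 2 1, Matrix.one_apply]
  ring

theorem psi_mul_quatMat {A : Mat3} (hA : Aᵀ = A) (η : ℝ) (e : Vec3) :
    psi (A * quatMat η e) = (2 : ℝ) • (η • (bar A *ᵥ e) - skew e *ᵥ (bar A *ᵥ e)) := by
  have s (i j : Fin 3) : A i j = A j i := congrFun (congrFun hA j) i
  ext i
  fin_cases i <;>
  · simp [Matrix.trace, Fin.sum_univ_three, Matrix.mul_apply, skew_apply,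
      dotProduct_three, quatMat, psi,
      mulVec_three, bar, Matrix.vecMulVec_apply, s 1 0, s 2 0, s 2 1, Matrix.one_apply]
    ring

theorem dotProduct_smul_sub_skew (η : ℝ) (e w : Vec3) :
    (η • w - skew e *ᵥ w) ⬝ᵥ (η • w - skew e *ᵥ w) =
      (η ^ 2 + e ⬝ᵥ e) * (w ⬝ᵥ w) - (e ⬝ᵥ w) ^ 2 := by
  simp [dotProduct_three, skew_mulVec_apply]
  ring

theorem psi_mul_quatMat_sq {A : Mat3} (hA : Aᵀ = A) {η : ℝ} {e : Vec3}
    (h : η ^ 2 + e ⬝ᵥ e = 1) :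
    psi (A * quatMat η e) ⬝ᵥ psi (A * quatMat η e) =
      4 * ((bar A *ᵥ e) ⬝ᵥ (bar A *ᵥ e) - (e ⬝ᵥ (bar A *ᵥ e)) ^ 2) := by
  rw [psi_mul_quatMat hA, smul_dotProduct, dotProduct_smul, dotProduct_smul_sub_skew, h]
  simp; ring

theorem potU_quatMat {A : Mat3} (hA : Aᵀ = A) {η : ℝ} {e : Vec3}
    (h : η ^ 2 + e ⬝ᵥ e = 1) :
    potU A (quatMat η e) = (e ⬝ᵥ (bar A *ᵥ e)) / eigMax (bar A) := by
  rw [potU, trace_mul_one_sub_quatMat hA h, mul_div_mul_left _ _ (by norm_num)]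

theorem rotNorm_sq_quatMat {η : ℝ} {e : Vec3} (h : η ^ 2 + e ⬝ᵥ e = 1) :
    rotNorm (quatMat η e) ^ 2 = e ⬝ᵥ e := by
  have e1 : η ^ 2 = 1 - e ⬝ᵥ e := by linarith
  have : (1 - quatMat η e).trace / 4 = e ⬝ᵥ e := by
    simp only [quatMat, e1]
    simp [Matrix.trace, Fin.sum_univ_three, skew_apply, dotProduct_three, Matrix.vecMulVec_apply]
    ring
  rw [rotNorm, this, Real.sq_sqrt (dotProduct_self_nonneg' e)]

/-- Quaternions carry half-angles, so the angle $2\arcsin s$ yields a quaternion that is linear in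
$s$ in its vector part. -/
theorem angleAxis_two_arcsin {s : ℝ} (h₁ : -1 ≤ s) (h₂ : s ≤ 1) {n : Vec3} (hn : n ⬝ᵥ n = 1) :
    angleAxis (2 * Real.arcsin s) n = quatMat √(1 - s ^ 2) (s • n) := by
  have hs : √(1 - s ^ 2) ^ 2 = 1 - s ^ 2 := Real.sq_sqrt (by nlinarith)
  rw [angleAxis, Real.sin_two_mul, Real.cos_two_mul, Real.sin_arcsin h₁ h₂, Real.cos_arcsin]
  generalize √(1 - s ^ 2) = c at *
  have e1 : c ^ 2 - (s • n) ⬝ᵥ (s • n) = 1 - 2 * s ^ 2 := by simp [hn, hs]; ring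
  rw [quatMat, e1]
  rw [dotProduct_three] at hn
  ext i j
  fin_cases i <;> fin_cases j <;>
    simp [skew_apply, Matrix.vecMulVec_apply, hs, Matrix.mul_apply, Fin.sum_univ_three] <;>
    first | ring1 | linear_combination (-2 * s ^ 2) * hn

theorem unit_sqrt_smul {s : ℝ} (h₁ : -1 ≤ s) (h₂ : s ≤ 1) {n : Vec3} (hn : n ⬝ᵥ n = 1) :
    √(1 - s ^ 2) ^ 2 + (s • n) ⬝ᵥ (s • n) = 1 := by
  rw [Real.sq_sqrt (by nlinarith)]
  simp [hn]; ring

/-! ### Spectral bounds -/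

/-- Bounds on the quadratic forms of `bar A` by its extreme eigenvalues. -/
structure BarBounds (A : Mat3) : Prop where
  symm : Aᵀ = A
  eigMin_pos : 0 < eigMin (bar A)
  eigMin_le : ∀ e : Vec3, eigMin (bar A) * (e ⬝ᵥ e) ≤ e ⬝ᵥ (bar A *ᵥ e)
  le_eigMax : ∀ e : Vec3, e ⬝ᵥ (bar A *ᵥ e) ≤ eigMax (bar A) * (e ⬝ᵥ e)
  sq_le_eigMax : ∀ e : Vec3,
    (bar A *ᵥ e) ⬝ᵥ (bar A *ᵥ e) ≤ eigMax (bar A) * (e ⬝ᵥ (bar A *ᵥ e))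

theorem bar_diagonalized {A V : Mat3} {l : Fin 3 → ℝ} (hV : Vᵀ * V = 1) (hV' : V * Vᵀ = 1)
    (hA : A = Vᵀ * Matrix.diagonal l * V) :
    bar A = Vᵀ * Matrix.diagonal (fun i => ((∑ j, l j) - l i) / 2) * V := by
  have ht : A.trace = ∑ j, l j := by
    rw [hA, Matrix.trace_mul_comm, ← mul_assoc, hV', one_mul, Matrix.trace_diagonal]
  have : Matrix.diagonal (fun i => ((∑ j, l j) - l i) / 2) =
      (1 / 2 : ℝ) • ((∑ j, l j) • (1 : Mat3) - Matrix.diagonal l) := by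
    ext i j
    by_cases h : i = j
    · subst h; simp; ring
    · simp [h]
  rw [bar, ht, this, hA]
  simp only [Matrix.mul_smul, Matrix.smul_mul, Matrix.mul_sub, Matrix.sub_mul, mul_one, hV]

theorem spectrum_diagonalized {V : Mat3} {m : Fin 3 → ℝ} (hV : Vᵀ * V = 1) (hV' : V * Vᵀ = 1) :
    spectrum ℝ (Vᵀ * Matrix.diagonal m * V) = Set.range m := by
  let u : Mat3ˣ := ⟨V, Vᵀ, hV', hV⟩
  have := spectrum.units_conjugate' (R := ℝ) (a := Matrix.diagonal m) (u := u)
  rw [spectrum_diagonal] at this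
  exact this

/-- The eigenvalue of $\bar A$ paired with $\lambda_i$ is $(\mathrm{tr}A-\lambda_i)/2$, which
reverses the order. Hence index 0 carries the largest eigenvalue here, and index 2 the smallest in
`eigMin_diagonalized`. -/
theorem eigMax_diagonalized {V : Mat3} {m : Fin 3 → ℝ} (hV : Vᵀ * V = 1) (hV' : V * Vᵀ = 1)
    (hm : ∀ i, m i ≤ m 0) : eigMax (Vᵀ * Matrix.diagonal m * V) = m 0 := by
  rw [eigMax, spectrum_diagonalized hV hV']
  exact IsGreatest.csSup_eq ⟨⟨0, rfl⟩, by rintro _ ⟨i, rfl⟩; exact hm i⟩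

theorem eigMin_diagonalized {V : Mat3} {m : Fin 3 → ℝ} (hV : Vᵀ * V = 1) (hV' : V * Vᵀ = 1)
    (hm : ∀ i, m 2 ≤ m i) : eigMin (Vᵀ * Matrix.diagonal m * V) = m 2 := by
  rw [eigMin, spectrum_diagonalized hV hV']
  exact IsLeast.csInf_eq ⟨⟨2, rfl⟩, by rintro _ ⟨i, rfl⟩; exact hm i⟩

theorem diagonalized_mulVec (V : Mat3) (m : Fin 3 → ℝ) (e : Vec3) :
    (Vᵀ * Matrix.diagonal m * V) *ᵥ e = Vᵀ *ᵥ (fun i => m i * (V *ᵥ e) i) := by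
  rw [← Matrix.mulVec_mulVec, ← Matrix.mulVec_mulVec]
  congr 1
  ext i
  rw [Matrix.mulVec_diagonal]

theorem transpose_mulVec_dotProduct {V : Mat3} (hV' : V * Vᵀ = 1) (u v : Vec3) :
    (Vᵀ *ᵥ u) ⬝ᵥ (Vᵀ *ᵥ v) = u ⬝ᵥ v := by
  rw [Matrix.dotProduct_mulVec, Matrix.vecMul_mulVec, Matrix.transpose_transpose, hV',
    Matrix.vecMul_one]

theorem mulVec_dotProduct_of_orthogonal {V : Mat3} (hV : Vᵀ * V = 1) (u v : Vec3) :
    (V *ᵥ u) ⬝ᵥ (V *ᵥ v) = u ⬝ᵥ v := by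
  simpa using transpose_mulVec_dotProduct (V := Vᵀ) (by simpa using hV) u v

theorem diagonalized_dotProduct {V : Mat3} (m : Fin 3 → ℝ) (e : Vec3) :
    e ⬝ᵥ ((Vᵀ * Matrix.diagonal m * V) *ᵥ e) = (V *ᵥ e) ⬝ᵥ (fun i => m i * (V *ᵥ e) i) := by
  rw [diagonalized_mulVec, Matrix.dotProduct_mulVec, Matrix.vecMul_transpose]

theorem BarBounds.of_diagonalized {A V : Mat3} {m : Fin 3 → ℝ} (hA : Aᵀ = A) (hV : Vᵀ * V = 1)
    (hV' : V * Vᵀ = 1) (hB : bar A = Vᵀ * Matrix.diagonal m * V) (h0 : ∀ i, m i ≤ m 0)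
    (h2 : ∀ i, m 2 ≤ m i) (hpos : 0 < m 2) : BarBounds A := by
  have hM : eigMax (bar A) = m 0 := by rw [hB, eigMax_diagonalized hV hV' h0]
  have hm : eigMin (bar A) = m 2 := by rw [hB, eigMin_diagonalized hV hV' h2]
  refine ⟨hA, hm ▸ hpos, fun e => ?_, fun e => ?_, fun e => ?_⟩
  · rw [hm, hB, diagonalized_dotProduct, ← mulVec_dotProduct_of_orthogonal hV e e]
    simp only [dotProduct_three]
    nlinarith [mul_nonneg (sub_nonneg.2 (h2 0)) (sq_nonneg ((V *ᵥ e) 0)),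
      mul_nonneg (sub_nonneg.2 (h2 1)) (sq_nonneg ((V *ᵥ e) 1))]
  · rw [hM, hB, diagonalized_dotProduct, ← mulVec_dotProduct_of_orthogonal hV e e]
    simp only [dotProduct_three]
    nlinarith [mul_nonneg (sub_nonneg.2 (h0 1)) (sq_nonneg ((V *ᵥ e) 1)),
      mul_nonneg (sub_nonneg.2 (h0 2)) (sq_nonneg ((V *ᵥ e) 2))]
  · rw [hM, hB, diagonalized_dotProduct, diagonalized_mulVec, transpose_mulVec_dotProduct hV']
    simp only [dotProduct_three]
    have p (i) : 0 ≤ m i := hpos.le.trans (h2 i)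
    nlinarith [mul_nonneg (mul_nonneg (p 1) (sub_nonneg.2 (h0 1))) (sq_nonneg ((V *ᵥ e) 1)),
      mul_nonneg (mul_nonneg (p 2) (sub_nonneg.2 (h0 2))) (sq_nonneg ((V *ᵥ e) 2))]

theorem BarBounds.eigMin_le_eigMax {A : Mat3} (h : BarBounds A) : eigMin (bar A) ≤ eigMax (bar A) := by
  have h1 := h.eigMin_le ![1, 0, 0]
  have h2 := h.le_eigMax ![1, 0, 0]
  have : (![1, 0, 0] : Vec3) ⬝ᵥ ![1, 0, 0] = 1 := by simp
  rw [this] at h1 h2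
  linarith

theorem BarBounds.eigMax_pos {A : Mat3} (h : BarBounds A) : 0 < eigMax (bar A) := h.eigMin_pos.trans_le h.eigMin_le_eigMax

theorem BarBounds.xi_pos {A : Mat3} (h : BarBounds A) : 0 < xi A := div_pos h.eigMin_pos h.eigMax_pos

theorem BarBounds.xi_le_one {A : Mat3} (h : BarBounds A) : xi A ≤ 1 := (div_le_one h.eigMax_pos).2 h.eigMin_le_eigMax

/-- As $\xi\le1$, the maximum is at most 4 and the bound on $k$ is at most $1/\sqrt2$. Nothing else
about the upper bound on $k$ enters the proof. -/
theorem two_mul_sq_lt_one_of_lt_kBound {A : Mat3} (h : BarBounds A) {k : ℝ} (hk : 0 < k)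
    (hk' : k < kBound A) : 2 * k ^ 2 < 1 := by
  have hx : xi A ^ 2 ≤ 1 := by nlinarith [h.xi_pos, h.xi_le_one]
  have hm : max 1 (4 * xi A ^ 2) ≤ 4 := max_le (by norm_num) (by linarith)
  have hpos : 0 < 6 - max 1 (4 * xi A ^ 2) := by linarith
  have h1 : k ^ 2 < kBound A ^ 2 := by nlinarith
  rw [kBound, div_pow, one_pow, Real.sq_sqrt hpos.le, lt_div_iff₀ hpos] at h1
  nlinarith [sq_nonneg k]

/-! ### Warped potentials at critical points -/

theorem quad_quatMat_bounds {A : Mat3} (h : BarBounds A) {X : Mat3} (hX : X ∈ SO3) :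
    xi A * rotNorm X ^ 2 ≤ potU A X ∧ potU A X ≤ rotNorm X ^ 2 ∧ rotNorm X ^ 2 ≤ 1 := by
  obtain ⟨η, e, hu, rfl⟩ := SO3.exists_quat hX
  rw [potU_quatMat h.symm hu, rotNorm_sq_quatMat hu, xi]
  refine ⟨?_, ?_, by nlinarith [sq_nonneg η]⟩
  · rw [div_mul_eq_mul_div]
    exact div_le_div_of_nonneg_right (h.eigMin_le e) h.eigMax_pos.le
  · rw [div_le_iff₀ h.eigMax_pos, mul_comm]
    exact h.le_eigMax e

theorem potU_nonneg {A : Mat3} (h : BarBounds A) {X : Mat3} (hX : X ∈ SO3) : 0 ≤ potU A X :=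
  le_trans (mul_nonneg h.xi_pos.le (sq_nonneg _)) (quad_quatMat_bounds h hX).1

theorem potU_le_one {A : Mat3} (h : BarBounds A) {X : Mat3} (hX : X ∈ SO3) : potU A X ≤ 1 :=
  (quad_quatMat_bounds h hX).2.1.trans (quad_quatMat_bounds h hX).2.2

theorem mul_potU_bounds {A : Mat3} (h : BarBounds A) {k : ℝ} (hk : 0 < k) (hk2 : 2 * k ^ 2 < 1)
    {X : Mat3} (hX : X ∈ SO3) : 0 ≤ k * potU A X ∧ k * potU A X < 1 ∧
      2 * (k * potU A X) ^ 2 < 1 := by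
  have h0 := potU_nonneg h hX
  have h1 := potU_le_one h hX
  have hs : 0 ≤ k * potU A X := mul_nonneg hk.le h0
  have h2 : (k * potU A X) ^ 2 ≤ k ^ 2 := by
    rw [mul_pow]
    exact mul_le_of_le_one_right (sq_nonneg k) (by nlinarith)
  exact ⟨hs, by nlinarith, by linarith⟩

theorem warpRot_eq_quatMat {A : Mat3} (h : BarBounds A) {k : ℝ} (hk : 0 < k)
    (hk2 : 2 * k ^ 2 < 1) {n : Vec3} (hn : n ⬝ᵥ n = 1) {X : Mat3} (hX : X ∈ SO3) :
    warpRot A k n X = quatMat √(1 - (k * potU A X) ^ 2) ((k * potU A X) • n) := by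
  obtain ⟨h0, h1, -⟩ := mul_potU_bounds h hk hk2 hX
  exact angleAxis_two_arcsin (by linarith) h1.le hn

theorem warpRot_mem_SO3 {A : Mat3} (h : BarBounds A) {k : ℝ} (hk : 0 < k)
    (hk2 : 2 * k ^ 2 < 1) {n : Vec3} (hn : n ⬝ᵥ n = 1) {X : Mat3} (hX : X ∈ SO3) :
    warpRot A k n X ∈ SO3 := by
  obtain ⟨h0, h1, -⟩ := mul_potU_bounds h hk hk2 hX
  rw [warpRot_eq_quatMat h hk hk2 hn hX]
  exact quatMat_mem_SO3 (unit_sqrt_smul (by linarith) h1.le hn)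

theorem warp_mem_SO3 {A : Mat3} (h : BarBounds A) {k : ℝ} (hk : 0 < k)
    (hk2 : 2 * k ^ 2 < 1) {n : Vec3} (hn : n ⬝ᵥ n = 1) {X : Mat3} (hX : X ∈ SO3) :
    warp A k n X ∈ SO3 :=
  mul_mem hX (warpRot_mem_SO3 h hk hk2 hn hX)

theorem bar_transpose {A : Mat3} (hA : Aᵀ = A) : (bar A)ᵀ = bar A := by
  simp [bar, Matrix.transpose_sub, hA]

theorem dotProduct_bar_comm {A : Mat3} (hA : Aᵀ = A) (u v : Vec3) :
    u ⬝ᵥ (bar A *ᵥ v) = v ⬝ᵥ (bar A *ᵥ u) := by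
  rw [Matrix.dotProduct_mulVec, ← Matrix.mulVec_transpose, bar_transpose hA, dotProduct_comm]

/-- Pairing $\psi(AY)=2(\eta\bar Ae-e\times\bar Ae)$ with $\bar Ae$ leaves $\eta\|\bar Ae\|^2=0$. If
$\eta=0$, then $\|e\|=1$ and $\psi=0$ is equality in the Cauchy–Schwarz inequality for $e$ and $\bar
Ae$, so these are parallel. If $\bar Ae=0$, definiteness gives $e=0$, hence $Y=I$. -/
theorem exists_eigenvector_of_psi_eq_zero {A : Mat3} (h : BarBounds A) {Y : Mat3} (hY : Y ∈ SO3)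
    (hpsi : psi (A * Y) = 0) (h1 : Y ≠ 1) :
    ∃ a : Vec3, a ⬝ᵥ a = 1 ∧ Y = quatMat 0 a ∧ bar A *ᵥ a = (a ⬝ᵥ (bar A *ᵥ a)) • a := by
  obtain ⟨η, e, hu, rfl⟩ := SO3.exists_quat hY
  have hsq := psi_mul_quatMat_sq h.symm hu
  rw [hpsi, zero_dotProduct] at hsq
  have hη : η * ((bar A *ᵥ e) ⬝ᵥ (bar A *ᵥ e)) = 0 := by
    have h2 := psi_mul_quatMat h.symm η e
    rw [hpsi] at h2
    have h3 := congrArg (fun v => (bar A *ᵥ e) ⬝ᵥ v) h2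
    simp only [dotProduct_zero, dotProduct_smul, dotProduct_sub] at h3
    have h4 : (bar A *ᵥ e) ⬝ᵥ (skew e *ᵥ (bar A *ᵥ e)) = 0 := by
      generalize bar A *ᵥ e = w
      simp only [dotProduct_three, skew_mulVec_apply]; ring
    rw [h4] at h3
    simpa using h3.symm
  rcases mul_eq_zero.1 hη with rfl | hB
  · have hu' : e ⬝ᵥ e = 1 := by linarith
    refine ⟨e, hu', rfl, sub_eq_zero.1 (eq_zero_of_dotProduct_self ?_)⟩
    generalize bar A *ᵥ e = w at *
    simp only [sub_dotProduct, dotProduct_sub, smul_dotProduct, dotProduct_smul, smul_eq_mul,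
      hu', dotProduct_comm w e]
    linarith
  · exfalso
    have hB' := eq_zero_of_dotProduct_self hB
    have h5 := h.eigMin_le e
    rw [hB', dotProduct_zero] at h5
    have h6 : e ⬝ᵥ e = 0 := by
      have := dotProduct_self_nonneg' e
      nlinarith [h.eigMin_pos]
    have he := eq_zero_of_dotProduct_self h6
    subst he
    apply h1
    have : (η - 1) * (η + 1) = 0 := by
      rw [dotProduct_zero] at hu; nlinarith
    rcases mul_eq_zero.1 this with h7 | h7
    · rw [sub_eq_zero.1 h7, quatMat_one_zero]
    · rw [show η = -1 by linarith, ← quatMat_one_zero, ← quatMat_neg 1 0, neg_zero]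

/-- The warping rotation depends on $X$ only through $s=kU_A(X)$. Multiplying $\Gamma$ by its
transpose therefore recovers $X$ up to this one number. -/
theorem eq_quatMat_of_warp_eq {A : Mat3} (h : BarBounds A) {k : ℝ} (hk : 0 < k)
    (hk2 : 2 * k ^ 2 < 1) {u : Vec3} (hn : u ⬝ᵥ u = 1) {X : Mat3} (hX : X ∈ SO3) {a : Vec3}
    (hw : warp A k u X = quatMat 0 a) :
    X = quatMat ((k * potU A X) * (a ⬝ᵥ u))
      (√(1 - (k * potU A X) ^ 2) • a - (k * potU A X) • (skew a *ᵥ u)) := by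
  have h1 := SO3.mul_transpose (warpRot_mem_SO3 h hk hk2 hn hX)
  have h2 : X = warp A k u X * (warpRot A k u X)ᵀ := by
    rw [warp, mul_assoc, h1, mul_one]
  rw [hw, warpRot_eq_quatMat h hk hk2 hn hX, quatMat_transpose, quatMat_mul] at h2
  generalize k * potU A X = s at *
  generalize √(1 - s ^ 2) = c at *
  rw [h2]
  congr 1
  · simp
  · simp [Matrix.mulVec_neg, Matrix.mulVec_smul, sub_eq_add_neg]

theorem unit_skew_combination {a u : Vec3} (ha : a ⬝ᵥ a = 1) (hu : u ⬝ᵥ u = 1) {c s : ℝ}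
    (hcs : c ^ 2 + s ^ 2 = 1) :
    (s * (a ⬝ᵥ u)) ^ 2 +
      (c • a - s • (skew a *ᵥ u)) ⬝ᵥ (c • a - s • (skew a *ᵥ u)) = 1 := by
  have h1 : (s * (a ⬝ᵥ u)) ^ 2 +
      (c • a - s • (skew a *ᵥ u)) ⬝ᵥ (c • a - s • (skew a *ᵥ u)) =
      c ^ 2 * (a ⬝ᵥ a) + s ^ 2 * ((a ⬝ᵥ a) * (u ⬝ᵥ u)) := by
    simp [dotProduct_three, skew_mulVec_apply]; ring
  rw [h1, ha, hu]; linarith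

theorem quad_combination {A : Mat3} (hA : Aᵀ = A) {a : Vec3}
    (hev : bar A *ᵥ a = (a ⬝ᵥ (bar A *ᵥ a)) • a) (u : Vec3) (α β : ℝ) :
    (α • a - β • (skew a *ᵥ u)) ⬝ᵥ (bar A *ᵥ (α • a - β • (skew a *ᵥ u))) =
      α ^ 2 * (a ⬝ᵥ (bar A *ᵥ a)) +
        β ^ 2 * ((skew a *ᵥ u) ⬝ᵥ (bar A *ᵥ (skew a *ᵥ u))) := by
  have h1 : (skew a *ᵥ u) ⬝ᵥ (bar A *ᵥ a) = 0 := by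
    rw [hev, dotProduct_smul]
    have : (skew a *ᵥ u) ⬝ᵥ a = 0 := by
      simp only [dotProduct_three, skew_mulVec_apply]; ring
    rw [this, smul_zero]
  have h2 := dotProduct_bar_comm hA a (skew a *ᵥ u)
  rw [h1] at h2
  simp only [Matrix.mulVec_sub, Matrix.mulVec_smul, sub_dotProduct, dotProduct_sub,
    smul_dotProduct, dotProduct_smul, h1, h2, smul_eq_mul]
  ring

/-- The drop of the quadratic form of `bar A` from the eigenvector `a` to `a × u`. -/
noncomputable def quadDrop (A : Mat3) (a u : Vec3) : ℝ :=
  (a ⬝ᵥ (bar A *ᵥ a) - (skew a *ᵥ u) ⬝ᵥ (bar A *ᵥ (skew a *ᵥ u))) / eigMax (bar A)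

/-- Evaluating $U_A$ on the recovered $X$ closes the loop: $x=U_A(X)$ satisfies $x=m-(kx)^2d$. There
is no mixed term because $a\times u$ is orthogonal to the eigenvector $a$. -/
theorem potU_of_warp_eq {A : Mat3} (h : BarBounds A) {k : ℝ} (hk : 0 < k)
    (hk2 : 2 * k ^ 2 < 1) {u : Vec3} (hn : u ⬝ᵥ u = 1) {X : Mat3} (hX : X ∈ SO3) {a : Vec3}
    (ha : a ⬝ᵥ a = 1) (hev : bar A *ᵥ a = (a ⬝ᵥ (bar A *ᵥ a)) • a)
    (hw : warp A k u X = quatMat 0 a) :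
    potU A X = (a ⬝ᵥ (bar A *ᵥ a)) / eigMax (bar A) - (k * potU A X) ^ 2 * quadDrop A a u := by
  have hX' := eq_quatMat_of_warp_eq h hk hk2 hn hX hw
  obtain ⟨-, -, h2⟩ := mul_potU_bounds h hk hk2 hX
  have hc : √(1 - (k * potU A X) ^ 2) ^ 2 = 1 - (k * potU A X) ^ 2 :=
    Real.sq_sqrt (by nlinarith)
  generalize hs : k * potU A X = s at *
  generalize √(1 - s ^ 2) = c at *
  rw [hX', potU_quatMat h.symm (unit_skew_combination ha hn (by linarith)),
    quad_combination h.symm hev, hc, quadDrop]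
  ring

/-- The axis $-u$ gives the transposed rotation, so the new warped point is $\Gamma$ times the
transpose squared. The half-angle doubles: $s$ becomes $2s\sqrt{1-s^2}$ in the formula for $U_A(X)$.
-/
theorem potU_warp_neg_of_warp_eq {A : Mat3} (h : BarBounds A) {k : ℝ} (hk : 0 < k)
    (hk2 : 2 * k ^ 2 < 1) {u : Vec3} (hn : u ⬝ᵥ u = 1) {X : Mat3} (hX : X ∈ SO3) {a : Vec3}
    (ha : a ⬝ᵥ a = 1) (hev : bar A *ᵥ a = (a ⬝ᵥ (bar A *ᵥ a)) • a)
    (hw : warp A k u X = quatMat 0 a) :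
    potU A (warp A k (-u) X) = (a ⬝ᵥ (bar A *ᵥ a)) / eigMax (bar A) -
      4 * (k * potU A X) ^ 2 * (1 - (k * potU A X) ^ 2) * quadDrop A a u := by
  have hX' := eq_quatMat_of_warp_eq h hk hk2 hn hX hw
  have hn' : (-u) ⬝ᵥ (-u) = 1 := by simpa using hn
  have hW := warpRot_eq_quatMat h hk hk2 hn' hX
  obtain ⟨-, -, h2⟩ := mul_potU_bounds h hk hk2 hX
  have hc : √(1 - (k * potU A X) ^ 2) ^ 2 = 1 - (k * potU A X) ^ 2 :=
    Real.sq_sqrt (by nlinarith)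
  rw [warp, hW]
  generalize hs : k * potU A X = s at *
  generalize √(1 - s ^ 2) = c at *
  rw [hX', quatMat_mul]
  have hu3 := hn
  rw [dotProduct_three] at hu3
  have ha3 := ha
  rw [dotProduct_three] at ha3
  have e1 : s * (a ⬝ᵥ u) * c - (c • a - s • (skew a *ᵥ u)) ⬝ᵥ s • -u = (2 * c * s) * (a ⬝ᵥ u) := by
    simp [dotProduct_three, skew_mulVec_apply]; ring
  have e2 : (s * (a ⬝ᵥ u)) • s • -u + c • (c • a - s • (skew a *ᵥ u)) +
      skew (c • a - s • (skew a *ᵥ u)) *ᵥ s • -u =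
      (1 - 2 * s ^ 2) • a - (2 * c * s) • (skew a *ᵥ u) := by
    ext i
    fin_cases i <;> simp [dotProduct_three, skew_mulVec_apply]
    · linear_combination a 0 * hc - a 0 * s ^ 2 * hu3
    · linear_combination a 1 * hc - a 1 * s ^ 2 * hu3
    · linear_combination a 2 * hc - a 2 * s ^ 2 * hu3
  rw [e1, e2, potU_quatMat h.symm (unit_skew_combination ha hn (by nlinarith)),
    quad_combination h.symm hev, quadDrop]
  have hcs : (2 * c * s) ^ 2 = 4 * s ^ 2 * (1 - s ^ 2) := by rw [← hc]; ring
  rw [hcs]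
  ring

/-! ### Admissible designs -/

/-- What the stability analysis uses about a design: bounds on the weighting matrix, unit axes, a
small warping gain, and no undesired critical point of `Φ` in the flow set. -/
structure Design.Admissible (P : Design) : Prop where
  bounds : BarBounds P.A
  k_pos : 0 < P.k
  two_mul_k_sq_lt : 2 * P.k ^ 2 < 1
  nonempty : P.Q.Nonempty
  unit : ∀ q ∈ P.Q, P.ν q ⬝ᵥ P.ν q = 1
  δ_pos : 0 < P.δ
  gap : ∀ X ∈ SO3, ∀ q ∈ P.Q, psi (P.A * warp P.A P.k (P.ν q) X) = 0 →
    warp P.A P.k (P.ν q) X ≠ 1 → ∃ p ∈ P.Q, P.δ < P.Φ X q - P.Φ X p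

/-! ### The six-axes designs -/

theorem bar_one : bar (1 : Mat3) = 1 := by
  ext i j
  by_cases h : i = j
  · subst h; simp [bar, Matrix.trace_one]; norm_num
  · simp [bar, h]

theorem barBounds_one : BarBounds (1 : Mat3) :=
  BarBounds.of_diagonalized (V := 1) (m := 1) (by simp) (by simp) (by simp)
    (by simp [bar_one]) (by simp) (by simp) (by simp)

theorem eigMax_bar_one : eigMax (bar (1 : Mat3)) = 1 := by
  have := eigMax_diagonalized (V := 1) (m := 1) (by simp) (by simp) (by simp)
  simpa [bar_one] using this

theorem potU_one_quatMat {η : ℝ} {e : Vec3} (hu : η ^ 2 + e ⬝ᵥ e = 1) :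
    potU 1 (quatMat η e) = 1 - η ^ 2 := by
  rw [potU_quatMat (by simp) hu, eigMax_bar_one, bar_one, Matrix.one_mulVec]
  linarith

/-- The last two components satisfy $a^2+b^2=1-A^2$, so one of them, $x$, has $x^2\ge(1-A^2)/2$.
Choosing $\sigma$ so that $cA$ and $\sigma x$ have opposite signs gives $(cA-\sigma x)^2\ge
c^2A^2+x^2\ge\tfrac12$. -/
theorem exists_third_sq_le {a b c s A B C p q : ℝ} (hcs : c ^ 2 + s ^ 2 = 1) (hc : 1 / 2 ≤ c ^ 2)
    (hn : A ^ 2 + B ^ 2 + C ^ 2 = 1) (hpq : p * B + q * C = 0)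
    (hpq2 : p ^ 2 + q ^ 2 = 1 - A ^ 2) (ha : a = c * B - s * p) (hb : b = c * C - s * q) :
    ∃ σ : ℝ, (σ = 1 ∨ σ = -1) ∧
      (1 / 2 ≤ (c * A - σ * a) ^ 2 ∨ 1 / 2 ≤ (c * A - σ * b) ^ 2) := by
  have hab : a ^ 2 + b ^ 2 = 1 - A ^ 2 := by
    rw [ha, hb]
    linear_combination c ^ 2 * hn - 2 * c * s * hpq + s ^ 2 * hpq2 + (1 - A ^ 2) * hcs
  have key (x : ℝ) (hx : (1 - A ^ 2) / 2 ≤ x ^ 2) :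
      ∃ σ : ℝ, (σ = 1 ∨ σ = -1) ∧ 1 / 2 ≤ (c * A - σ * x) ^ 2 := by
    have hA : A ^ 2 / 2 ≤ (c * A) ^ 2 := by nlinarith [sq_nonneg A]
    rcases le_total 0 (c * A * x) with h | h
    · exact ⟨-1, Or.inr rfl, by nlinarith⟩
    · exact ⟨1, Or.inl rfl, by nlinarith⟩
  by_cases h : (1 - A ^ 2) / 2 ≤ a ^ 2
  · obtain ⟨σ, h1, h2⟩ := key a h
    exact ⟨σ, h1, Or.inl h2⟩
  · obtain ⟨σ, h1, h2⟩ := key b (by linarith)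
    exact ⟨σ, h1, Or.inr h2⟩

/-- If `u, f, g` are orthonormal, then one of `±f, ±g` lowers the potential at an undesired critical
point with the warping axis `u`. -/
theorem exists_axis_gap {k : ℝ} (hk : 0 < k) (hk2 : 2 * k ^ 2 < 1) {u f g : Vec3}
    (huu : u ⬝ᵥ u = 1) (hff : f ⬝ᵥ f = 1) (hgg : g ⬝ᵥ g = 1)
    (hexp : ∀ v w : Vec3, v ⬝ᵥ w =
      (v ⬝ᵥ u) * (w ⬝ᵥ u) + (v ⬝ᵥ f) * (w ⬝ᵥ f) + (v ⬝ᵥ g) * (w ⬝ᵥ g))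
    {X : Mat3} (hX : X ∈ SO3) {a : Vec3} (ha : a ⬝ᵥ a = 1)
    (hw : warp 1 k u X = quatMat 0 a) :
    potU 1 (warp 1 k u X) = 1 ∧ potU 1 X = 1 - (k * potU 1 X) ^ 2 * (a ⬝ᵥ u) ^ 2 ∧
    ∃ σ : ℝ, (σ = 1 ∨ σ = -1) ∧ ∃ w : Vec3, (w = f ∨ w = g) ∧
      potU 1 (warp 1 k (σ • w) X) ≤ 1 - (k * potU 1 X) ^ 2 / 2 := by
  have hX' := eq_quatMat_of_warp_eq barBounds_one hk hk2 huu hX hw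
  have hrot (n : Vec3) (hn : n ⬝ᵥ n = 1) := warpRot_eq_quatMat barBounds_one hk hk2 hn hX
  have h1 : potU 1 (warp 1 k u X) = 1 := by
    rw [hw, potU_one_quatMat (by simp [ha])]; simp
  refine ⟨h1, ?_⟩
  obtain ⟨h0, h1, h2⟩ := mul_potU_bounds barBounds_one hk hk2 hX
  have hc : √(1 - (k * potU 1 X) ^ 2) ^ 2 = 1 - (k * potU 1 X) ^ 2 :=
    Real.sq_sqrt (by nlinarith)
  have hnorm (n : Vec3) (hn : n ⬝ᵥ n = 1) :=
    unit_sqrt_smul (s := k * potU 1 X) (by linarith) h1.le hn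
  simp only [warp]
  generalize hs : k * potU 1 X = s at *
  generalize √(1 - s ^ 2) = c at *
  have hcs : c ^ 2 + s ^ 2 = 1 := by linarith
  have hunit := unit_skew_combination ha huu hcs
  constructor
  · rw [hX', potU_one_quatMat hunit]; ring
  have hua : (skew a *ᵥ u) ⬝ᵥ a = 0 := by
    simp only [dotProduct_three, skew_mulVec_apply]; ring
  have huu' : (skew a *ᵥ u) ⬝ᵥ u = 0 := by
    simp only [dotProduct_three, skew_mulVec_apply]; ring
  have hsq : (skew a *ᵥ u) ⬝ᵥ (skew a *ᵥ u) = 1 - (a ⬝ᵥ u) ^ 2 := by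
    have : (skew a *ᵥ u) ⬝ᵥ (skew a *ᵥ u) = (a ⬝ᵥ a) * (u ⬝ᵥ u) - (a ⬝ᵥ u) ^ 2 := by
      simp only [dotProduct_three, skew_mulVec_apply]; ring
    rw [this, ha, huu, one_mul]
  have e1 := hexp a a
  have e2 := hexp (skew a *ᵥ u) a
  have e3 := hexp (skew a *ᵥ u) (skew a *ᵥ u)
  rw [ha] at e1
  rw [hua, huu'] at e2
  rw [hsq, huu'] at e3
  obtain ⟨σ, hσ, h⟩ := exists_third_sq_le (c := c) (s := s) (A := a ⬝ᵥ u) (B := a ⬝ᵥ f)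
    (C := a ⬝ᵥ g) (p := (skew a *ᵥ u) ⬝ᵥ f) (q := (skew a *ᵥ u) ⬝ᵥ g) hcs (by linarith)
    (by linarith) (by linarith) (by linarith) rfl rfl
  have hσ2 : σ ^ 2 = 1 := by rcases hσ with rfl | rfl <;> norm_num
  have fin (w : Vec3) (hww : w ⬝ᵥ w = 1)
      (hw2 : 1 / 2 ≤ (c * (a ⬝ᵥ u) - σ * (c * (a ⬝ᵥ w) - s * ((skew a *ᵥ u) ⬝ᵥ w))) ^ 2) :
      potU 1 (X * warpRot 1 k (σ • w) X) ≤ 1 - s ^ 2 / 2 := by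
    have hσw : (σ • w) ⬝ᵥ (σ • w) = 1 := by
      simp only [smul_dotProduct, dotProduct_smul, hww, smul_eq_mul]; linarith
    rw [hrot _ hσw, hX', quatMat_mul, potU_one_quatMat]
    · have : s * (a ⬝ᵥ u) * c - (c • a - s • (skew a *ᵥ u)) ⬝ᵥ s • σ • w =
          s * (c * (a ⬝ᵥ u) - σ * (c * (a ⬝ᵥ w) - s * ((skew a *ᵥ u) ⬝ᵥ w))) := by
        simp only [smul_dotProduct, dotProduct_smul, sub_dotProduct, smul_eq_mul]; ring
      rw [this, mul_pow]
      nlinarith [mul_le_mul_of_nonneg_left hw2 (sq_nonneg s)]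
    · rw [quatMat_norm_mul, hunit, hnorm _ hσw, one_mul]
  rcases h with h | h
  · exact ⟨σ, hσ, f, Or.inl rfl, fin f hff h⟩
  · exact ⟨σ, hσ, g, Or.inr rfl, fin g hgg h⟩

/-- Let $y>0$ solve $k^2y^2+y=1$. Then the gap is $k^2y^3/3$, while the equation for $x$ with
$A^2\le1$ forces $x\ge y$. As $y\le1$, this gives $y^3/3<x^2/2$. -/
theorem gapI_lt {k x A : ℝ} (hk : 0 < k) (hx : x = 1 - (k * x) ^ 2 * A ^ 2)
    (hx0 : 0 ≤ x) (hA : A ^ 2 ≤ 1) : gapI k < (k * x) ^ 2 / 2 := by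
  have hr : √(1 + 4 * k ^ 2) ^ 2 = 1 + 4 * k ^ 2 := Real.sq_sqrt (by positivity)
  have hr0 : 1 < √(1 + 4 * k ^ 2) := by
    apply Real.lt_sqrt_of_sq_lt; nlinarith
  set y := (-1 + √(1 + 4 * k ^ 2)) / (2 * k ^ 2) with hy
  have hk2 : 0 < k ^ 2 := by positivity
  have hy0 : 0 < y := by rw [hy]; apply div_pos <;> linarith
  have hy1 : -1 + √(1 + 4 * k ^ 2) = 2 * k ^ 2 * y := by rw [hy]; field_simp
  have hy2 : k ^ 2 * y ^ 2 + y = 1 := by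
    have h1 : √(1 + 4 * k ^ 2) = 1 + 2 * k ^ 2 * y := by linarith
    rw [h1] at hr
    have : k ^ 2 * (k ^ 2 * y ^ 2 + y - 1) = 0 := by nlinarith
    rcases mul_eq_zero.1 this with h | h
    · exact absurd h hk2.ne'
    · linarith
  have hyx : y ≤ x := by
    by_contra hlt
    push Not at hlt
    have h1 : x ^ 2 ≤ y ^ 2 := by nlinarith
    have h2 : (k * x) ^ 2 * A ^ 2 ≤ (k * x) ^ 2 := by nlinarith [sq_nonneg (k * x)]
    nlinarith [mul_le_mul_of_nonneg_left h1 hk2.le]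
  have hg : gapI k = k ^ 2 * y ^ 3 / 3 := by
    rw [gapI, hy1]; field_simp; ring
  have hyle : y ≤ 1 := by nlinarith [sq_nonneg y]
  rw [hg]
  have h3 : y ^ 2 ≤ x ^ 2 := by nlinarith
  have h4 : y ^ 3 ≤ y ^ 2 := by nlinarith [sq_nonneg y]
  have h5 : 0 < y ^ 2 := by positivity
  have h6 : y ^ 3 / 3 < x ^ 2 / 2 := by linarith
  nlinarith

/-- The two basis vectors orthogonal to the current axis, with Parseval's identity. Both signs of
each occur among the indices, $p$ and $p+3$ having opposite axes. -/
theorem Design.IsSixAxes.exists_frame {P : Design} (h : P.IsSixAxes) {q : ℕ} (hq : q ∈ P.Q) :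
    ∃ f g : Vec3, P.ν q ⬝ᵥ P.ν q = 1 ∧ f ⬝ᵥ f = 1 ∧ g ⬝ᵥ g = 1 ∧
      (∀ v w : Vec3, v ⬝ᵥ w = (v ⬝ᵥ P.ν q) * (w ⬝ᵥ P.ν q) + (v ⬝ᵥ f) * (w ⬝ᵥ f) +
        (v ⬝ᵥ g) * (w ⬝ᵥ g)) ∧
      ∀ σ : ℝ, (σ = 1 ∨ σ = -1) → ∀ w, (w = f ∨ w = g) → ∃ p ∈ P.Q, P.ν p = σ • w := by
  obtain ⟨-, hQ, e, he⟩ := h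
  have hn (p : Fin 3) : (e p).ofLp ⬝ᵥ (e p).ofLp = 1 := by
    have := e.orthonormal.1 p
    have h2 := EuclideanSpace.norm_sq_eq (e p)
    rw [this] at h2
    simp [Fin.sum_univ_three] at h2
    rw [dotProduct_three]; nlinarith
  have hexp (v w : Vec3) : v ⬝ᵥ w = ∑ p, (v ⬝ᵥ (e p).ofLp) * (w ⬝ᵥ (e p).ofLp) := by
    have := e.sum_inner_mul_inner (WithLp.toLp 2 v) (WithLp.toLp 2 w)
    simp only [PiLp.inner_apply, Fin.sum_univ_three, dotProduct_three] at this ⊢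
    simp at this
    linarith
  simp only [Fin.sum_univ_three] at hexp
  have hax (p : Fin 3) (σ : ℝ) (hσ : σ = 1 ∨ σ = -1) : ∃ r ∈ P.Q, P.ν r = σ • (e p).ofLp := by
    rcases hσ with rfl | rfl
    · exact ⟨p + 1, by rw [hQ, Finset.mem_Icc]; omega, by rw [(he p).1, one_smul]⟩
    · exact ⟨p + 1 + 3, by rw [hQ, Finset.mem_Icc]; omega, by
        rw [(he p).2, (he p).1, neg_smul, one_smul]⟩
  have hq' : ∃ (p : Fin 3) (τ : ℝ), τ ^ 2 = 1 ∧ P.ν q = τ • (e p).ofLp := by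
    rw [hQ, Finset.mem_Icc] at hq
    by_cases h3 : q ≤ 3
    · refine ⟨⟨q - 1, by omega⟩, 1, by norm_num, ?_⟩
      rw [one_smul, ← (he _).1]; congr 1; simp; omega
    · refine ⟨⟨q - 4, by omega⟩, -1, by norm_num, ?_⟩
      rw [neg_smul, one_smul, ← (he _).1, ← (he _).2]; congr 1; simp; omega
  obtain ⟨p, τ, hτ, hν⟩ := hq'
  have main (i j : Fin 3) (hex : ∀ v w : Vec3, v ⬝ᵥ w =
      (v ⬝ᵥ (e p).ofLp) * (w ⬝ᵥ (e p).ofLp) + (v ⬝ᵥ (e i).ofLp) * (w ⬝ᵥ (e i).ofLp) +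
        (v ⬝ᵥ (e j).ofLp) * (w ⬝ᵥ (e j).ofLp)) :
      ∃ f g : Vec3, P.ν q ⬝ᵥ P.ν q = 1 ∧ f ⬝ᵥ f = 1 ∧ g ⬝ᵥ g = 1 ∧
      (∀ v w : Vec3, v ⬝ᵥ w = (v ⬝ᵥ P.ν q) * (w ⬝ᵥ P.ν q) + (v ⬝ᵥ f) * (w ⬝ᵥ f) +
        (v ⬝ᵥ g) * (w ⬝ᵥ g)) ∧
      ∀ σ : ℝ, (σ = 1 ∨ σ = -1) → ∀ w, (w = f ∨ w = g) → ∃ p ∈ P.Q, P.ν p = σ • w := by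
    refine ⟨(e i).ofLp, (e j).ofLp, ?_, hn i, hn j, fun v w => ?_, ?_⟩
    · rw [hν, smul_dotProduct, dotProduct_smul, hn]
      simp only [smul_eq_mul]; linarith
    · rw [hν, hex v w]
      simp only [dotProduct_smul, smul_eq_mul]
      linear_combination (-(v ⬝ᵥ (e p).ofLp) * (w ⬝ᵥ (e p).ofLp)) * hτ
    · rintro σ hσ w (rfl | rfl)
      · exact hax i σ hσ
      · exact hax j σ hσ
  fin_cases p
  · exact main 1 2 (fun v w => by rw [hexp]; simp)
  · exact main 0 2 (fun v w => by rw [hexp]; simp; ring)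
  · exact main 0 1 (fun v w => by rw [hexp]; simp; ring)

theorem Design.IsSixAxes.exists_gap {P : Design} (h : P.IsSixAxes) (hk : 0 < P.k)
    (hk' : P.k < kBound P.A) {X : Mat3} (hX : X ∈ SO3) {q : ℕ} (hq : q ∈ P.Q)
    (hpsi : psi (P.A * warp P.A P.k (P.ν q) X) = 0) (h1 : warp P.A P.k (P.ν q) X ≠ 1) :
    ∃ p ∈ P.Q, potU P.A (warp P.A P.k (P.ν q) X) = 1 ∧
      potU P.A (warp P.A P.k (P.ν p) X) < 1 - gapI P.k := by
  have hA := h.1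
  have hb := barBounds_one
  rw [hA] at hpsi h1 hk' ⊢
  have hk2 := two_mul_sq_lt_one_of_lt_kBound hb hk hk'
  obtain ⟨f, g, huu, hff, hgg, hexp, hax⟩ := h.exists_frame hq
  obtain ⟨a, ha, hw, -⟩ :=
    exists_eigenvector_of_psi_eq_zero hb (warp_mem_SO3 hb hk hk2 huu hX) hpsi h1
  obtain ⟨h2, h3, σ, hσ, w, hw', h4⟩ := exists_axis_gap hk hk2 huu hff hgg hexp hX ha hw
  obtain ⟨p, hp, hνp⟩ := hax σ hσ w hw'
  refine ⟨p, hp, h2, ?_⟩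
  rw [hνp]
  have hau : (a ⬝ᵥ P.ν q) ^ 2 ≤ 1 := by
    have e1 := hexp a a
    rw [ha] at e1
    nlinarith [sq_nonneg (a ⬝ᵥ f), sq_nonneg (a ⬝ᵥ g)]
  have := gapI_lt hk h3 (potU_nonneg hb hX) hau
  linarith

theorem Design.IsSixAxes.admissible {P : Design} (h : P.IsSixAxes)
    (hk : 0 < P.k) (hk' : P.k < kBound P.A) (hδ : 0 < P.δ)
    (hgap : ∀ X p q, potU P.A (warp P.A P.k (P.ν q) X) = 1 →
      potU P.A (warp P.A P.k (P.ν p) X) < 1 - gapI P.k → P.δ < P.Φ X q - P.Φ X p) :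
    P.Admissible where
  bounds := h.1 ▸ barBounds_one
  k_pos := hk
  two_mul_k_sq_lt := two_mul_sq_lt_one_of_lt_kBound (h.1 ▸ barBounds_one) hk hk'
  nonempty := ⟨1, by simp [h.2.1]⟩
  unit q hq := by
    obtain ⟨f, g, huu, -⟩ := h.exists_frame hq
    exact huu
  δ_pos := hδ
  gap X hX q hq hpsi h1 := by
    obtain ⟨p, hp, h2, h3⟩ := h.exists_gap hk hk' hX hq hpsi h1
    exact ⟨p, hp, hgap X p q h2 h3⟩

theorem Design.IsD1.admissible {P : Design} (h : P.IsD1) : P.Admissible := by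
  obtain ⟨hkind, hs, ⟨hk, hk'⟩, hδ, hδ'⟩ := h
  refine hs.admissible hk hk' hδ fun X p q h1 h2 => ?_
  simp only [Design.Φ, hkind, h1]
  linarith

theorem Design.IsD2.admissible {P : Design} (h : P.IsD2) : P.Admissible := by
  obtain ⟨hkind, hs, ⟨hk, hk'⟩, hδ, hδ'⟩ := h
  refine hs.admissible hk hk' hδ fun X p q h1 h2 => ?_
  simp only [Design.Φ, hkind, potV, h1, sub_self, Real.sqrt_zero]
  rw [gapII] at hδ'
  -- At the critical point $V_A=2$, so the drop of $V_A$ is $2\sqrt{1-U_A}$ at the new axis; the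
  -- radicand exceeds `gapI`.
  have := Real.sqrt_le_sqrt (show gapI P.k ≤ 1 - potU P.A (warp P.A P.k (P.ν p) X) by linarith)
  linarith

/-! ### The two-axes designs -/

/-- Monotonicity of the gap at an undesired critical point in the two parameters `m` and `d`. -/
theorem gap_mono {k x v m d ξ L : ℝ} (hk2 : 2 * k ^ 2 < 1) (hL : 0 < L) (hLd : L ≤ d)
    (hξm : ξ ≤ m) (hx : x = m - (k * x) ^ 2 * d) (hx0 : 0 ≤ x) (hx1 : x ≤ 1)
    (hv : v = ξ - (k * v) ^ 2 * L) (hv0 : 0 ≤ v) (hv1 : v ≤ 1) :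
    4 * k ^ 2 * v ^ 2 * (1 - k ^ 2 * v ^ 2) * L ≤ 4 * (k * x) ^ 2 * (1 - (k * x) ^ 2) * d := by
  have hkv : (k * v) ^ 2 ≤ 1 / 2 := by
    rw [mul_pow]; nlinarith [sq_nonneg k, mul_le_mul_of_nonneg_left (show v ^ 2 ≤ 1 by nlinarith) (sq_nonneg k)]
  have hkx : (k * x) ^ 2 ≤ 1 / 2 := by
    rw [mul_pow]; nlinarith [sq_nonneg k, mul_le_mul_of_nonneg_left (show x ^ 2 ≤ 1 by nlinarith) (sq_nonneg k)]
  have e : 4 * k ^ 2 * v ^ 2 * (1 - k ^ 2 * v ^ 2) * L =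
      4 * ((k * v) ^ 2 * (1 - (k * v) ^ 2)) * L := by ring
  rw [e]
  -- If $v\le x$, use that $p(1-p)$ increases on $[0,\tfrac12]$. If $x\le v$, the two equations give
  -- $(kv)^2L=\xi-v\le m-x=(kx)^2d$, and the factor $1-(k\,\cdot)^2$ is larger at $x$.
  rcases le_total v x with h | h
  · have h1 : (k * v) ^ 2 ≤ (k * x) ^ 2 := by
      rw [mul_pow, mul_pow]
      exact mul_le_mul_of_nonneg_left (by nlinarith) (sq_nonneg k)
    have hp0 := sq_nonneg (k * v)
    generalize (k * v) ^ 2 = p at *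
    generalize (k * x) ^ 2 = r at *
    have h2 : p * (1 - p) ≤ r * (1 - r) := by nlinarith
    have hp : 0 ≤ p * (1 - p) := mul_nonneg hp0 (by linarith)
    nlinarith [mul_le_mul h2 hLd hL.le (hp.trans h2)]
  · have h1 : (k * x) ^ 2 ≤ (k * v) ^ 2 := by
      rw [mul_pow, mul_pow]
      exact mul_le_mul_of_nonneg_left (by nlinarith) (sq_nonneg k)
    have h2 : (k * v) ^ 2 * L ≤ (k * x) ^ 2 * d := by linarith
    have h3 : 0 ≤ (k * v) ^ 2 * L := mul_nonneg (sq_nonneg _) hL.le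
    generalize (k * v) ^ 2 = p at *
    generalize (k * x) ^ 2 = r at *
    nlinarith [mul_le_mul h2 (show 1 - p ≤ 1 - r by linarith) (by linarith) (h3.trans h2)]

/-- The constant $\bar V$ is the nonnegative root of the equation in `potU_of_warp_eq` in the worst
case $m=\xi$, $d=\Lambda$. -/
theorem Vbar_spec {A : Mat3} (h : BarBounds A) {l : Fin 3 → ℝ} (hL : 0 < capLambda l) {k : ℝ}
    (hk : 0 < k) :
    Vbar A l k = xi A - (k * Vbar A l k) ^ 2 * capLambda l ∧ 0 ≤ Vbar A l k ∧
      Vbar A l k ≤ 1 := by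
  have hxi := h.xi_pos
  have hD : 0 ≤ 4 * k ^ 2 * xi A * capLambda l := by positivity
  have hr : √(1 + 4 * k ^ 2 * xi A * capLambda l) ^ 2 = 1 + 4 * k ^ 2 * xi A * capLambda l :=
    Real.sq_sqrt (by linarith)
  have hr0 : 1 ≤ √(1 + 4 * k ^ 2 * xi A * capLambda l) := by
    apply Real.le_sqrt_of_sq_le; linarith
  have hkL : 0 < k ^ 2 * capLambda l := by positivity
  have hy0 : 0 ≤ Vbar A l k := by rw [Vbar]; apply div_nonneg <;> nlinarith
  have hy1 : -1 + √(1 + 4 * k ^ 2 * xi A * capLambda l) =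
      2 * (k ^ 2 * capLambda l) * Vbar A l k := by rw [Vbar]; field_simp
  generalize Vbar A l k = v at *
  have h1 : v = xi A - (k * v) ^ 2 * capLambda l := by
    rw [show √(1 + 4 * k ^ 2 * xi A * capLambda l) = 1 + 2 * (k ^ 2 * capLambda l) * v by
      linarith] at hr
    have : (k ^ 2 * capLambda l) * (v - (xi A - (k * v) ^ 2 * capLambda l)) = 0 := by nlinarith
    rcases mul_eq_zero.1 this with h | h
    · exact absurd h hkL.ne'
    · linarith
  refine ⟨h1, hy0, ?_⟩
  have := h.xi_le_one
  have := mul_nonneg (sq_nonneg (k * v)) hL.le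
  linarith

theorem gapIII_nonneg {A : Mat3} (h : BarBounds A) {l : Fin 3 → ℝ} (hL : 0 < capLambda l) {k : ℝ}
    (hk : 0 < k) (hk2 : 2 * k ^ 2 < 1) : 0 ≤ gapIII A l k := by
  obtain ⟨-, h0, h1⟩ := Vbar_spec h hL hk
  have h2 : k ^ 2 * Vbar A l k ^ 2 ≤ 1 := by
    nlinarith [mul_le_mul_of_nonneg_left (show Vbar A l k ^ 2 ≤ 1 by nlinarith) (sq_nonneg k)]
  rw [gapIII]
  have := sub_nonneg.2 h2
  positivity

/-- Concavity of the square root: its increments shrink as the base point grows. For $V_A$ the base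
point is $1-U_A\le1-\xi$. -/
theorem sqrt_add_sub_sqrt_mono {y y₀ G G₀ : ℝ} (hy : 0 ≤ y) (hyy : y ≤ y₀) (hG₀ : 0 ≤ G₀)
    (hG : G₀ ≤ G) : √(y₀ + G₀) - √y₀ ≤ √(y + G) - √y := by
  have h1 : √(y + G₀) ≤ √(y + G) := Real.sqrt_le_sqrt (by linarith)
  have h2 : √(y₀ + G₀) + √y ≤ √(y + G₀) + √y₀ := by
    have a1 := Real.sq_sqrt (show 0 ≤ y₀ + G₀ by linarith)
    have a2 := Real.sq_sqrt hy
    have a3 := Real.sq_sqrt (show 0 ≤ y + G₀ by linarith)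
    have a4 := Real.sq_sqrt (hy.trans hyy)
    have h3 : √(y₀ + G₀) * √y ≤ √(y + G₀) * √y₀ := by
      rw [← Real.sqrt_mul (by linarith), ← Real.sqrt_mul (by linarith)]
      apply Real.sqrt_le_sqrt; nlinarith
    -- After squaring, both sides contain the same sum $y+y_0+G_0$, and only the mixed products are
    -- compared.
    apply le_of_sq_le_sq _ (by positivity)
    nlinarith
  linarith

/-- An orthonormal eigenbasis may be left-handed. The sign $\det V=\pm1$ then appears in the cross
product and disappears on squaring. -/
theorem det_smul_mulVec_skew {V : Mat3} (hV' : V * Vᵀ = 1) (a u : Vec3) :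
    V.det • (V *ᵥ (skew a *ᵥ u)) = skew (V *ᵥ a) *ᵥ (V *ᵥ u) := by
  have h := congrArg (fun M => (V * M) *ᵥ u) (skew_mulVec_conj V a)
  simp only [← mul_assoc, hV', one_mul] at h
  rw [Matrix.mulVec_mulVec, Matrix.mulVec_mulVec, h, Matrix.mul_smul, Matrix.smul_mulVec]

theorem det_sq_eq_one {V : Mat3} (hV' : V * Vᵀ = 1) : V.det ^ 2 = 1 := by
  have := congrArg Matrix.det hV'
  rw [Matrix.det_mul, Matrix.det_transpose, Matrix.det_one] at this
  rw [sq, this]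

/-- An orthonormal eigenvector of a matrix with simple spectrum is a basis vector up to sign. -/
theorem exists_sq_eq_one_of_simple {m c : Fin 3 → ℝ} {μ : ℝ} (h01 : m 0 ≠ m 1) (h02 : m 0 ≠ m 2)
    (h12 : m 1 ≠ m 2) (hc : c ⬝ᵥ c = 1) (h : ∀ i, m i * c i = μ * c i) :
    ((c 0 ^ 2 = 1 ∧ c 1 = 0 ∧ c 2 = 0) ∧ μ = m 0) ∨ ((c 1 ^ 2 = 1 ∧ c 0 = 0 ∧ c 2 = 0) ∧ μ = m 1) ∨
      ((c 2 ^ 2 = 1 ∧ c 0 = 0 ∧ c 1 = 0) ∧ μ = m 2) := by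
  rw [dotProduct_three] at hc
  have hz (i : Fin 3) (hne : m i ≠ μ) : c i = 0 := by
    have : (m i - μ) * c i = 0 := by linarith [h i]
    exact (mul_eq_zero.1 this).resolve_left (sub_ne_zero.2 hne)
  by_cases h0 : m 0 = μ
  · have c1 := hz 1 (fun h => h01 (h0.trans h.symm))
    have c2 := hz 2 (fun h => h02 (h0.trans h.symm))
    rw [c1, c2] at hc
    exact Or.inl ⟨⟨by linarith, c1, c2⟩, h0.symm⟩
  have c0 := hz 0 h0
  by_cases h1 : m 1 = μ
  · have c2 := hz 2 (fun h => h12 (h1.trans h.symm))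
    rw [c0, c2] at hc
    exact Or.inr (Or.inl ⟨⟨by linarith, c0, c2⟩, h1.symm⟩)
  have c1 := hz 1 h1
  have hc2 : c 2 * c 2 = 1 := by rw [c0, c1] at hc; linarith
  refine Or.inr (Or.inr ⟨⟨by linarith, c0, c1⟩, ?_⟩)
  by_contra hne
  rw [hz 2 (fun h => hne h.symm)] at hc2
  norm_num at hc2

theorem capLambda_pos {l : Fin 3 → ℝ} (hl : 0 < l 0 ∧ l 0 < l 1 ∧ l 1 < l 2) : 0 < capLambda l := by
  obtain ⟨h0, h1, h2⟩ := hl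
  have h3 : 0 < l 1 := h0.trans h1
  have h4 : 0 < l 2 := h3.trans h2
  rw [capLambda]
  split_ifs
  · positivity
  · have : 0 < pairSum l := by
      simp only [pairSum, Fin.sum_univ_three]
      rw [show (Finset.univ.erase (0 : Fin 3)) = {1, 2} by decide,
        show (Finset.univ.erase (1 : Fin 3)) = {0, 2} by decide,
        show (Finset.univ.erase (2 : Fin 3)) = {0, 1} by decide]
      simp
      positivity
    rw [Fin.prod_univ_three]
    positivity

theorem pairSum_eq (l : Fin 3 → ℝ) : pairSum l = 2 * (l 0 * l 1 + l 0 * l 2 + l 1 * l 2) := by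
  simp only [pairSum, Fin.sum_univ_three]
  rw [show (Finset.univ.erase (0 : Fin 3)) = {1, 2} by decide,
    show (Finset.univ.erase (1 : Fin 3)) = {0, 2} by decide,
    show (Finset.univ.erase (2 : Fin 3)) = {0, 1} by decide]
  simp
  ring

/-- The right-hand sides are the drops of the quadratic form of $\bar A$ from each of the three
eigenvectors, scaled by $\lambda_2+\lambda_3$. In the second case the axis equalizes all three. In
the first case the last two are equal to the bound, and `SpreadEig` says that the first is no
smaller. -/
theorem capLambda_le_drop {l c : Fin 3 → ℝ} (hl : 0 < l 0 ∧ l 0 < l 1 ∧ l 1 < l 2)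
    (h1 : SpreadEig l → c 0 = 0 ∧ c 1 ^ 2 = l 1 / (l 1 + l 2) ∧ c 2 ^ 2 = l 2 / (l 1 + l 2))
    (h2 : ¬ SpreadEig l → ∀ i, c i ^ 2 = 1 - 4 * (∏ j ∈ Finset.univ.erase i, l j) / pairSum l) :
    capLambda l * (l 1 + l 2) ≤ (l 1 + l 2) - (l 0 + l 2) * c 2 ^ 2 - (l 0 + l 1) * c 1 ^ 2 ∧
    capLambda l * (l 1 + l 2) ≤ (l 0 + l 2) - (l 1 + l 2) * c 2 ^ 2 - (l 0 + l 1) * c 0 ^ 2 ∧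
    capLambda l * (l 1 + l 2) ≤ (l 0 + l 1) - (l 1 + l 2) * c 1 ^ 2 - (l 0 + l 2) * c 0 ^ 2 := by
  obtain ⟨p0, p1, p2⟩ := hl
  have q1 : 0 < l 1 := p0.trans p1
  have q2 : 0 < l 2 := q1.trans p2
  have hs : 0 < l 1 + l 2 := by linarith
  rw [capLambda]
  split_ifs with h
  · obtain ⟨e0, e1, e2⟩ := h1 h
    rw [e0, e1, e2, div_mul_cancel₀ _ hs.ne']
    rw [SpreadEig] at h
    refine ⟨?_, ?_, ?_⟩
    · rw [← sub_nonneg]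
      have : l 1 + l 2 - (l 0 + l 2) * (l 2 / (l 1 + l 2)) - (l 0 + l 1) * (l 1 / (l 1 + l 2)) - l 0 =
          2 * (l 1 * l 2 - l 0 * l 1 - l 0 * l 2) / (l 1 + l 2) := by field_simp; ring
      rw [this]; positivity
    · rw [mul_div_cancel₀ _ hs.ne']; linarith
    · rw [mul_div_cancel₀ _ hs.ne']; linarith
  · have e := h2 h
    have e0 := e 0; have e1 := e 1; have e2 := e 2
    rw [show (Finset.univ.erase (0 : Fin 3)) = {1, 2} by decide] at e0
    rw [show (Finset.univ.erase (1 : Fin 3)) = {0, 2} by decide] at e1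
    rw [show (Finset.univ.erase (2 : Fin 3)) = {0, 1} by decide] at e2
    simp at e0 e1 e2
    rw [e0, e1, e2, pairSum_eq, Fin.prod_univ_three]
    have hσ : 0 < l 0 * l 1 + l 0 * l 2 + l 1 * l 2 := by positivity
    refine ⟨le_of_eq ?_, le_of_eq ?_, le_of_eq ?_⟩ <;> field_simp <;> ring

/-- The data of a two-axes design in an eigenbasis of the weighting matrix. -/
theorem Design.IsTwoAxes.exists_diagonalization {P : Design} {l : Fin 3 → ℝ}
    (h : P.IsTwoAxes l) :
    ∃ V : Mat3, Vᵀ * V = 1 ∧ V * Vᵀ = 1 ∧ P.A = Vᵀ * Matrix.diagonal l * V ∧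
      ∃ u : Vec3, u ⬝ᵥ u = 1 ∧ P.ν 1 = u ∧ P.ν 2 = -u ∧
        (SpreadEig l → (V *ᵥ u) 0 = 0 ∧ (V *ᵥ u) 1 ^ 2 = l 1 / (l 1 + l 2) ∧
          (V *ᵥ u) 2 ^ 2 = l 2 / (l 1 + l 2)) ∧
        (¬ SpreadEig l →
          ∀ i, (V *ᵥ u) i ^ 2 = 1 - 4 * (∏ j ∈ Finset.univ.erase i, l j) / pairSum l) := by
  obtain ⟨-, -, -, v, hv, u, hu, h1, h2, h3, h4⟩ := h
  let V : Mat3 := Matrix.of fun i => (v i).ofLp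
  have hVV : V * Vᵀ = 1 := by
    ext i j
    have := (orthonormal_iff_ite.1 v.orthonormal) i j
    rw [Matrix.mul_apply, Matrix.one_apply, ← this]
    simp [V, PiLp.inner_apply, mul_comm]
  have hVV' : Vᵀ * V = 1 := mul_eq_one_comm.1 hVV
  have hAV : P.A * Vᵀ = Vᵀ * Matrix.diagonal l := by
    ext i j
    have := congrFun (hv j) i
    rw [Matrix.mul_diagonal]
    simp only [Matrix.mulVec, dotProduct] at this
    rw [Matrix.mul_apply]
    simpa [V, mul_comm] using this
  have hVu (i) : (V *ᵥ u) i = u ⬝ᵥ (v i).ofLp := by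
    rw [dotProduct_comm]; rfl
  refine ⟨V, hVV', hVV, ?_, u, hu, h1, h2, ?_, ?_⟩
  · rw [← hAV, mul_assoc, hVV', mul_one]
  · simpa only [hVu] using h3
  · simpa only [hVu] using h4

theorem Design.IsTwoAxes.bounds_and_drop {P : Design} {l : Fin 3 → ℝ} (h : P.IsTwoAxes l) :
    BarBounds P.A ∧ ∃ u : Vec3, u ⬝ᵥ u = 1 ∧ P.ν 1 = u ∧ P.ν 2 = -u ∧
      ∀ a : Vec3, a ⬝ᵥ a = 1 → bar P.A *ᵥ a = (a ⬝ᵥ (bar P.A *ᵥ a)) • a →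
        capLambda l ≤ quadDrop P.A a u := by
  obtain ⟨V, hV, hV', hA, u, hu, hu1, hu2, hs, hns⟩ := h.exists_diagonalization
  have hl := h.2.1
  have hlam := capLambda_le_drop hl hs hns
  obtain ⟨p0, p1, p2⟩ := hl
  set m : Fin 3 → ℝ := fun i => ((∑ j, l j) - l i) / 2 with hm
  have hB : bar P.A = Vᵀ * Matrix.diagonal m * V := bar_diagonalized hV hV' hA
  have m0 : m 0 = (l 1 + l 2) / 2 := by simp only [hm, Fin.sum_univ_three]; ring
  have m1 : m 1 = (l 0 + l 2) / 2 := by simp only [hm, Fin.sum_univ_three]; ring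
  have m2 : m 2 = (l 0 + l 1) / 2 := by simp only [hm, Fin.sum_univ_three]; ring
  have hm0 (i) : m i ≤ m 0 := by fin_cases i <;> simp only [Fin.mk_zero, Fin.mk_one, Fin.reduceFinMk, m0, m1, m2] <;> linarith
  have hm2 (i) : m 2 ≤ m i := by fin_cases i <;> simp only [Fin.mk_zero, Fin.mk_one, Fin.reduceFinMk, m0, m1, m2] <;> linarith
  have hsymm : P.Aᵀ = P.A := by
    rw [hA]; simp [Matrix.transpose_mul, mul_assoc]
  refine ⟨BarBounds.of_diagonalized hsymm hV hV' hB hm0 hm2 (by rw [m2]; linarith), u, hu, hu1,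
    hu2, fun a ha hev => ?_⟩
  have hM : eigMax (bar P.A) = m 0 := by rw [hB, eigMax_diagonalized hV hV' hm0]
  have hc : (V *ᵥ a) ⬝ᵥ (V *ᵥ a) = 1 := by rw [mulVec_dotProduct_of_orthogonal hV, ha]
  have hμ (i) : m i * (V *ᵥ a) i = (a ⬝ᵥ (bar P.A *ᵥ a)) * (V *ᵥ a) i := by
    have h1 := congrArg (fun w => (V *ᵥ w) i) hev
    conv at h1 =>
      lhs
      rw [hB, diagonalized_mulVec, Matrix.mulVec_mulVec, hV', Matrix.one_mulVec]
    rw [h1, Matrix.mulVec_smul]; rfl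
  have hw := det_smul_mulVec_skew hV' a u
  have hd := det_sq_eq_one hV'
  -- Only squares of the components matter, so the handedness of the eigenbasis is irrelevant.
  have hw2 (i) : (V *ᵥ (skew a *ᵥ u)) i ^ 2 = (skew (V *ᵥ a) *ᵥ (V *ᵥ u)) i ^ 2 := by
    rw [← hw, Pi.smul_apply, smul_eq_mul, mul_pow, hd, one_mul]
  have hq : (skew a *ᵥ u) ⬝ᵥ (bar P.A *ᵥ (skew a *ᵥ u)) =
      m 0 * (skew (V *ᵥ a) *ᵥ (V *ᵥ u)) 0 ^ 2 + m 1 * (skew (V *ᵥ a) *ᵥ (V *ᵥ u)) 1 ^ 2 +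
        m 2 * (skew (V *ᵥ a) *ᵥ (V *ᵥ u)) 2 ^ 2 := by
    rw [hB, diagonalized_dotProduct, dotProduct_three, ← hw2, ← hw2, ← hw2]; ring
  have hm0pos : 0 < m 0 := by rw [m0]; linarith
  rw [quadDrop, hM, le_div_iff₀ hm0pos, hq]
  simp only [skew_mulVec_apply]
  generalize V *ᵥ a = c at *
  generalize V *ᵥ u = w at *
  obtain ⟨l1, l2, l3⟩ := hlam
  rcases exists_sq_eq_one_of_simple (by rw [m0, m1]; intro h; linarith)
    (by rw [m0, m2]; intro h; linarith) (by rw [m1, m2]; intro h; linarith) hc hμ with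
    ⟨⟨s0, s1, s2⟩, hμ'⟩ | ⟨⟨s0, s1, s2⟩, hμ'⟩ | ⟨⟨s0, s1, s2⟩, hμ'⟩ <;>
  · rw [hμ', s1, s2, m0, m1, m2]
    ring_nf
    rw [s0]
    linarith

theorem Design.IsTwoAxes.exists_gap {P : Design} {l : Fin 3 → ℝ} (h : P.IsTwoAxes l)
    (hk : 0 < P.k) (hk' : P.k < kBound P.A) {X : Mat3} (hX : X ∈ SO3) {q : ℕ} (hq : q ∈ P.Q)
    (hpsi : psi (P.A * warp P.A P.k (P.ν q) X) = 0) (h1 : warp P.A P.k (P.ν q) X ≠ 1) :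
    ∃ p ∈ P.Q, xi P.A ≤ potU P.A (warp P.A P.k (P.ν q) X) ∧
      potU P.A (warp P.A P.k (P.ν q) X) ≤ 1 ∧
      potU P.A (warp P.A P.k (P.ν p) X) ≤
        potU P.A (warp P.A P.k (P.ν q) X) - gapIII P.A l P.k := by
  obtain ⟨hb, u, hu, hu1, hu2, hdrop⟩ := h.bounds_and_drop
  have hL := capLambda_pos h.2.1
  have hk2 := two_mul_sq_lt_one_of_lt_kBound hb hk hk'
  have hQ : P.Q = {1, 2} := h.2.2.1
  have main (w : Vec3) (hww : w ⬝ᵥ w = 1)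
      (hpsi : psi (P.A * warp P.A P.k w X) = 0) (h1 : warp P.A P.k w X ≠ 1)
      (hd : ∀ a : Vec3, a ⬝ᵥ a = 1 → bar P.A *ᵥ a = (a ⬝ᵥ (bar P.A *ᵥ a)) • a →
        capLambda l ≤ quadDrop P.A a w) :
      xi P.A ≤ potU P.A (warp P.A P.k w X) ∧ potU P.A (warp P.A P.k w X) ≤ 1 ∧
        potU P.A (warp P.A P.k (-w) X) ≤ potU P.A (warp P.A P.k w X) - gapIII P.A l P.k := by
    have hG := warp_mem_SO3 hb hk hk2 hww hX
    obtain ⟨a, ha, hw, hev⟩ := exists_eigenvector_of_psi_eq_zero hb hG hpsi h1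
    have hval : potU P.A (warp P.A P.k w X) = (a ⬝ᵥ (bar P.A *ᵥ a)) / eigMax (bar P.A) := by
      rw [hw, potU_quatMat hb.symm (by simp [ha])]
    have hxi : xi P.A ≤ (a ⬝ᵥ (bar P.A *ᵥ a)) / eigMax (bar P.A) := by
      rw [xi]
      apply div_le_div_of_nonneg_right _ hb.eigMax_pos.le
      simpa [ha] using hb.eigMin_le a
    refine ⟨hval ▸ hxi, potU_le_one hb hG, ?_⟩
    have e1 := potU_of_warp_eq hb hk hk2 hww hX ha hev hw
    have e2 := potU_warp_neg_of_warp_eq hb hk hk2 hww hX ha hev hw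
    obtain ⟨v1, v2, v3⟩ := Vbar_spec hb hL hk
    have := gap_mono hk2 hL (hd a ha hev) hxi e1 (potU_nonneg hb hX) (potU_le_one hb hX) v1 v2 v3
    rw [e2, hval, gapIII]
    linarith
  -- The drop is even in the axis, so one argument covers both indices.
  have hneg (a : Vec3) : quadDrop P.A a (-u) = quadDrop P.A a u := by
    simp [quadDrop, Matrix.mulVec_neg]
  have hq' : q = 1 ∨ q = 2 := by simpa [hQ] using hq
  rcases hq' with rfl | rfl
  · refine ⟨2, by simp [hQ], ?_⟩
    rw [hu1, hu2] at *
    exact main u hu hpsi h1 hdrop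
  · refine ⟨1, by simp [hQ], ?_⟩
    rw [hu2] at hpsi h1
    rw [hu1, hu2]
    have := main (-u) (by simpa using hu) hpsi h1 (by simpa only [hneg] using hdrop)
    rwa [neg_neg] at this

theorem Design.IsTwoAxes.admissible {P : Design} {l : Fin 3 → ℝ} (h : P.IsTwoAxes l)
    (hk : 0 < P.k) (hk' : P.k < kBound P.A) (hδ : 0 < P.δ)
    (hgap : ∀ X p q, 0 ≤ gapIII P.A l P.k → xi P.A ≤ potU P.A (warp P.A P.k (P.ν q) X) →
      potU P.A (warp P.A P.k (P.ν q) X) ≤ 1 →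
      potU P.A (warp P.A P.k (P.ν p) X) ≤
        potU P.A (warp P.A P.k (P.ν q) X) - gapIII P.A l P.k → P.δ < P.Φ X q - P.Φ X p) :
    P.Admissible := by
  obtain ⟨hb, u, hu, hu1, hu2, -⟩ := h.bounds_and_drop
  have hk2 := two_mul_sq_lt_one_of_lt_kBound hb hk hk'
  have hQ : P.Q = {1, 2} := h.2.2.1
  refine ⟨hb, hk, hk2, ⟨1, by simp [hQ]⟩, fun q hq => ?_, hδ, fun X hX q hq hpsi h1 => ?_⟩
  · have hq' : q = 1 ∨ q = 2 := by simpa [hQ] using hq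
    rcases hq' with rfl | rfl
    · rw [hu1, hu]
    · rw [hu2]; simpa using hu
  · obtain ⟨p, hp, h2, h3, h4⟩ := h.exists_gap hk hk' hX hq hpsi h1
    exact ⟨p, hp, hgap X p q (gapIII_nonneg hb (capLambda_pos h.2.1) hk hk2) h2 h3 h4⟩

theorem Design.IsD3.admissible {P : Design} (h : P.IsD3) : P.Admissible := by
  obtain ⟨hkind, l, hs, ⟨hk, hk'⟩, hδ, hδ'⟩ := h
  refine hs.admissible hk hk' hδ fun X p q h0 h1 h2 h3 => ?_
  simp only [Design.Φ, hkind]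
  linarith

theorem Design.IsD4.admissible {P : Design} (h : P.IsD4) : P.Admissible := by
  obtain ⟨hkind, l, hs, ⟨hk, hk'⟩, hδ, hδ'⟩ := h
  refine hs.admissible hk hk' hδ fun X p q h0 h1 h2 h3 => ?_
  simp only [Design.Φ, hkind, potV]
  rw [gapIV] at hδ'
  generalize potU P.A (warp P.A P.k (P.ν q) X) = y at *
  generalize potU P.A (warp P.A P.k (P.ν p) X) = z at *
  -- The drop of $V_A$ is twice the increment of the square root from $1-y$ to $1-z$. It is smallest
  -- at the largest base point $1-\xi$ and for the smallest increase of the argument.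
  have := sqrt_add_sub_sqrt_mono (y := 1 - y) (y₀ := 1 - xi P.A) (G := y - z)
    (by linarith) (by linarith) h0 (by linarith)
  rw [show 1 - y + (y - z) = 1 - z by ring] at this
  linarith

theorem admissible_of_isD {P : Design} (h : P.IsD1 ∨ P.IsD2 ∨ P.IsD3 ∨ P.IsD4) :
    P.Admissible := by
  rcases h with h | h | h | h
  exacts [h.admissible, h.admissible, h.admissible, h.admissible]

/-! ### Continuity of the potential functions -/

theorem continuous_potU (A : Mat3) : Continuous (potU A) := by
  unfold potU
  exact ((continuous_const.matrix_mul (continuous_const.sub continuous_id)).matrix_trace).div_const _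

/-- Continuity holds on all matrices, since `Real.arcsin` is constant outside $[-1,1]$. -/
theorem continuous_warp (A : Mat3) (k : ℝ) (n : Vec3) : Continuous (warp A k n) := by
  have h := continuous_potU A
  have hθ : Continuous fun X => 2 * Real.arcsin (k * potU A X) :=
    continuous_const.mul (Real.continuous_arcsin.comp (continuous_const.mul h))
  unfold warp warpRot angleAxis
  refine continuous_id.matrix_mul ((continuous_const.add ?_).add ?_)
  · exact (Real.continuous_sin.comp hθ).smul continuous_const
  · exact (continuous_const.sub (Real.continuous_cos.comp hθ)).smul continuous_const

theorem continuous_potU_warp (A : Mat3) (k : ℝ) (n : Vec3) :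
    Continuous fun X => potU A (warp A k n X) := (continuous_potU A).comp (continuous_warp A k n)

theorem Design.continuous_Φ (P : Design) (q : ℕ) : Continuous fun X => P.Φ X q := by
  have h := continuous_potU_warp P.A P.k (P.ν q)
  unfold Design.Φ
  cases P.kind
  · exact h
  · exact continuous_const.mul (continuous_const.sub (continuous_const.sub h).sqrt)

theorem continuous_psi : Continuous psi := by
  unfold psi
  refine continuous_pi fun i => ?_
  fin_cases i <;>
  · simp
    exact ((continuous_id.matrix_elem _ _).sub (continuous_id.matrix_elem _ _)).div_const _

theorem continuous_rotNorm : Continuous rotNorm := by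
  unfold rotNorm
  exact (((continuous_const.sub continuous_id).matrix_trace).div_const _).sqrt

theorem isClosed_SO3 : IsClosed (SO3 : Set Mat3) := by
  have : (SO3 : Set Mat3) = {X | X * Xᵀ = 1} ∩ {X | X.det = 1} := by
    ext X
    exact ⟨fun h => ⟨SO3.mul_transpose h, SO3.det_eq_one h⟩,
      fun h => SO3.of_mul_transpose h.1 h.2⟩
  rw [this]
  apply IsClosed.inter
  · exact isClosed_eq (continuous_id.matrix_mul continuous_id.matrix_transpose) continuous_const
  · exact isClosed_eq continuous_id.matrix_det continuous_const

theorem isCompact_SO3 : IsCompact (SO3 : Set Mat3) := by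
  have : IsCompact (Set.univ.pi fun _ : Fin 3 => Set.univ.pi fun _ : Fin 3 => Set.Icc (-1 : ℝ) 1) :=
    isCompact_univ_pi fun _ => isCompact_univ_pi fun _ => isCompact_Icc
  refine IsCompact.of_isClosed_subset (X := Mat3) this isClosed_SO3 fun X hX i _ j _ => ?_
  exact abs_le.1 (SO3.abs_apply_le hX i j)

/-! ### The flow set -/

theorem Design.minΦ_le (P : Design) (X : Mat3) {p : ℕ} (hp : p ∈ P.Q) : P.minΦ X ≤ P.Φ X p :=
  csInf_le (P.Q.finite_toSet.image _).bddBelow ⟨p, hp, rfl⟩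

theorem Design.argminΦ_nonempty (P : Design) (h : P.Q.Nonempty) (X : Mat3) :
    (P.argminΦ X).Nonempty := by
  have hne : ((fun p => P.Φ X p) '' (P.Q : Set ℕ)).Nonempty := (Finset.coe_nonempty.2 h).image _
  obtain ⟨p, hp, hpe⟩ := hne.csInf_mem (P.Q.finite_toSet.image _)
  exact ⟨p, hp, hpe⟩

/-- Replacing the minimum by finitely many inequalities makes closedness of the flow set immediate.
-/
theorem Design.mem_flowSet_iff (P : Design) {X : Mat3} {q : ℕ} :
    (X, q) ∈ P.flowSet ↔ X ∈ SO3 ∧ q ∈ P.Q ∧ ∀ p ∈ P.Q, P.Φ X q - P.Φ X p ≤ P.δ := by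
  simp only [Design.flowSet, Set.mem_ofPred_eq]
  refine and_congr_right fun _ => and_congr_right fun hq => ⟨fun h p hp => ?_, fun h => ?_⟩
  · have := P.minΦ_le X hp
    linarith
  · obtain ⟨p, hp, hpe⟩ := P.argminΦ_nonempty ⟨q, hq⟩ X
    rw [← hpe]
    exact h p hp

theorem Design.isClosed_flow (P : Design) (q : ℕ) : IsClosed {X | (X, q) ∈ P.flowSet} := by
  have : {X | (X, q) ∈ P.flowSet} = (SO3 : Set Mat3) ∩ {_X | q ∈ P.Q} ∩
      ⋂ p ∈ P.Q, {X | P.Φ X q - P.Φ X p ≤ P.δ} := by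
    ext X
    simp only [Set.mem_ofPred_eq, P.mem_flowSet_iff, Set.mem_inter_iff, Set.mem_iInter, and_assoc]
    rfl
  rw [this]
  refine (isClosed_SO3.inter isClosed_const).inter (isClosed_biInter fun p _ => ?_)
  exact isClosed_le ((P.continuous_Φ q).sub (P.continuous_Φ p)) continuous_const

theorem Design.isCompact_flow (P : Design) (q : ℕ) : IsCompact {X | (X, q) ∈ P.flowSet} :=
  isCompact_SO3.of_isClosed_subset (P.isClosed_flow q) fun _ h => h.1

/-! ### Bounds on the warped rotation -/

/-- The vector part of the product is $ce+sw$ with $\|w\|\le1$. The two estimates are Young's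
inequality from $\|ce-sw\|^2\ge0$ and $\|2ce-sw\|^2\ge0$. -/
theorem warp_quat_bounds {c s η : ℝ} {e n : Vec3} (hcs : c ^ 2 + s ^ 2 = 1)
    (hu : η ^ 2 + e ⬝ᵥ e = 1) (hn : n ⬝ᵥ n = 1) :
    rotNorm (quatMat η e * quatMat c (s • n)) ^ 2 ≤ 2 * rotNorm (quatMat η e) ^ 2 + 2 * s ^ 2 ∧
    rotNorm (quatMat η e * quatMat c (s • n)) ^ 2 ≤
      3 * rotNorm (quatMat η e) ^ 2 + 3 / 2 * s ^ 2 := by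
  have hv : c ^ 2 + (s • n) ⬝ᵥ (s • n) = 1 := by simp [hn]; linarith
  have hm := quatMat_norm_mul η c e (s • n)
  rw [hu, hv, one_mul] at hm
  rw [quatMat_mul, rotNorm_sq_quatMat hm, rotNorm_sq_quatMat hu]
  have e1 : η • s • n + c • e + skew e *ᵥ s • n = c • e + s • (η • n + skew e *ᵥ n) := by
    rw [Matrix.mulVec_smul, smul_add, smul_comm η s]; abel
  have hw : (η • n + skew e *ᵥ n) ⬝ᵥ (η • n + skew e *ᵥ n) ≤ 1 := by
    have : (η • n + skew e *ᵥ n) ⬝ᵥ (η • n + skew e *ᵥ n) =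
        (η ^ 2 + e ⬝ᵥ e) * (n ⬝ᵥ n) - (e ⬝ᵥ n) ^ 2 := by
      simp [dotProduct_three, skew_mulVec_apply]; ring
    rw [this, hu, hn]; nlinarith [sq_nonneg (e ⬝ᵥ n)]
  rw [e1]
  generalize η • n + skew e *ᵥ n = w at *
  have h1 := dotProduct_self_nonneg' (c • e - s • w)
  have h2 := dotProduct_self_nonneg' ((2 * c) • e - s • w)
  have h3 := dotProduct_self_nonneg' e
  have h4 := mul_le_mul_of_nonneg_left hw (sq_nonneg s)
  have h5 : c ^ 2 * (e ⬝ᵥ e) ≤ e ⬝ᵥ e := by nlinarith [sq_nonneg s]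
  simp only [add_dotProduct, dotProduct_add, sub_dotProduct, dotProduct_sub, smul_dotProduct,
    dotProduct_smul, smul_eq_mul, dotProduct_comm w e] at h1 h2 ⊢
  constructor <;> nlinarith

/-- Here $s^2\le|X|_I^2/2$. For the second bound, applied to $X=\Gamma\,\mathfrak R_A^\top$, the
coefficient $\tfrac32$ of $s^2$ leaves $\tfrac34|X|_I^2$, which can be absorbed; the coefficient $2$
could not be. -/
theorem rotNorm_warp_bounds {A : Mat3} (h : BarBounds A) {k : ℝ} (hk : 0 < k)
    (hk2 : 2 * k ^ 2 < 1) {n : Vec3} (hn : n ⬝ᵥ n = 1) {X : Mat3} (hX : X ∈ SO3) :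
    rotNorm (warp A k n X) ^ 2 ≤ 3 * rotNorm X ^ 2 ∧
      rotNorm X ^ 2 ≤ 12 * rotNorm (warp A k n X) ^ 2 := by
  have hG := warp_mem_SO3 h hk hk2 hn hX
  have hR := warpRot_mem_SO3 h hk hk2 hn hX
  obtain ⟨h0, h1, h2⟩ := mul_potU_bounds h hk hk2 hX
  obtain ⟨-, hU, hN⟩ := quad_quatMat_bounds h hX
  have hU0 := potU_nonneg h hX
  have hs : (k * potU A X) ^ 2 ≤ rotNorm X ^ 2 / 2 := by
    rw [mul_pow]
    have : potU A X ^ 2 ≤ rotNorm X ^ 2 := by nlinarith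
    nlinarith [sq_nonneg (potU A X), sq_nonneg k]
  have hW := warpRot_eq_quatMat h hk hk2 hn hX
  have hc : √(1 - (k * potU A X) ^ 2) ^ 2 = 1 - (k * potU A X) ^ 2 :=
    Real.sq_sqrt (by nlinarith)
  constructor
  · rw [warp, hW]
    obtain ⟨η, e, hu, rfl⟩ := SO3.exists_quat hX
    have := (warp_quat_bounds (c := √(1 - (k * potU A (quatMat η e)) ^ 2))
      (s := k * potU A (quatMat η e)) (by linarith) hu hn).1
    linarith
  · have hX' : X = warp A k n X * quatMat √(1 - (k * potU A X) ^ 2) ((-(k * potU A X)) • n) := by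
      rw [neg_smul, ← quatMat_transpose, ← hW, warp, mul_assoc, SO3.mul_transpose hR, mul_one]
    have : rotNorm X ^ 2 ≤ 3 * rotNorm (warp A k n X) ^ 2 + 3 / 2 * (-(k * potU A X)) ^ 2 := by
      conv_lhs => rw [hX']
      obtain ⟨η, e, hu, he⟩ := SO3.exists_quat hG
      rw [he]
      exact (warp_quat_bounds (by linarith) hu hn).2
    nlinarith

theorem potV_bounds {A X : Mat3} (h0 : 0 ≤ potU A X) (h1 : potU A X ≤ 1) :
    potU A X ≤ potV A X ∧ potV A X ≤ 2 * potU A X := by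
  rw [potV]
  have h2 := Real.sq_sqrt (show 0 ≤ 1 - potU A X by linarith)
  have h3 := Real.sqrt_nonneg (1 - potU A X)
  generalize √(1 - potU A X) = r at *
  have : r ≤ 1 := by nlinarith
  constructor <;> nlinarith

theorem Design.Admissible.Φ_bounds {P : Design} (h : P.Admissible) {X : Mat3} (hX : X ∈ SO3)
    {q : ℕ} (hq : q ∈ P.Q) :
    xi P.A / 12 * rotNorm X ^ 2 ≤ P.Φ X q ∧ P.Φ X q ≤ 6 * rotNorm X ^ 2 := by
  have hG := warp_mem_SO3 h.bounds h.k_pos h.two_mul_k_sq_lt (h.unit q hq) hX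
  obtain ⟨h1, h2⟩ := rotNorm_warp_bounds h.bounds h.k_pos h.two_mul_k_sq_lt (h.unit q hq) hX
  obtain ⟨h3, h4, h5⟩ := quad_quatMat_bounds h.bounds hG
  obtain ⟨h6, h7⟩ := potV_bounds (potU_nonneg h.bounds hG) (potU_le_one h.bounds hG)
  have h8 := potU_nonneg h.bounds hG
  have h9 := mul_le_mul_of_nonneg_left h2 h.bounds.xi_pos.le
  unfold Design.Φ
  cases P.kind <;> constructor <;> simp only <;> linarith

/-! ### The innovation vector -/

/-- The vector `[Xᵀ ∇Φ(X, q)]_⊗` for a rotation `X`. -/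
noncomputable def Design.innov (P : Design) (X : Mat3) (q : ℕ) : Vec3 :=
  let g := (1 / (4 * eigMax (bar P.A))) •
    ((theta P.A P.k (P.ν q) X)ᵀ *ᵥ psi (P.A * warp P.A P.k (P.ν q) X))
  match P.kind with
  | .U => g
  | .V => (√(1 - potU P.A (warp P.A P.k (P.ν q) X)))⁻¹ • g

theorem Design.psi_transpose_mul_gradΦ (P : Design) {X : Mat3} (hX : X ∈ SO3) (q : ℕ) :
    psi (Xᵀ * P.gradΦ X q) = P.innov X q := by
  have h1 : psi (Xᵀ * gradWarpU P.A P.k (P.ν q) X) = (1 / (4 * eigMax (bar P.A))) •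
      ((theta P.A P.k (P.ν q) X)ᵀ *ᵥ psi (P.A * warp P.A P.k (P.ν q) X)) := by
    rw [gradWarpU, Matrix.mul_smul, ← mul_assoc, SO3.transpose_mul hX, one_mul, psi_smul, psi_skew]
  unfold Design.gradΦ Design.innov
  cases P.kind
  · exact h1
  · simp only [gradWarpV]
    rw [Matrix.mul_smul, psi_smul, h1]

theorem theta_transpose_mulVec (A : Mat3) (k : ℝ) (n : Vec3) (X : Mat3) (y : Vec3) :
    (theta A k n X)ᵀ *ᵥ y = warpRot A k n X *ᵥ y +
      (n ⬝ᵥ y) • ((4 * k / (4 * eigMax (bar A) * √(1 - k ^ 2 * potU A X ^ 2))) •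
        psi (A * X)) := by
  rw [theta, Matrix.transpose_add, Matrix.transpose_transpose, Matrix.add_mulVec,
    Matrix.transpose_smul, Matrix.smul_mulVec, Matrix.transpose_vecMulVec,
    Matrix.vecMulVec_mulVec]
  congr 1
  ext i; simp; ring

/-- Any bound below 1 makes $\Theta_A^\top$ invertible. The estimate combines
$\|\psi(AX)\|^2\le4\lambda_{\max}^2(x-x^2)$ for $x=U_A(X)$ with $2k^2<1$. -/
theorem vnorm_theta_term_le {A : Mat3} (h : BarBounds A) {k : ℝ} (hk : 0 < k)
    (hk2 : 2 * k ^ 2 < 1) {X : Mat3} (hX : X ∈ SO3) :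
    vnorm ((4 * k / (4 * eigMax (bar A) * √(1 - k ^ 2 * potU A X ^ 2))) • psi (A * X)) ≤ 4 / 5 := by
  have hx0 := potU_nonneg h hX
  have hx1 := potU_le_one h hX
  have hL := h.eigMax_pos
  have hpsi : psi (A * X) ⬝ᵥ psi (A * X) ≤ 4 * eigMax (bar A) ^ 2 * (potU A X - potU A X ^ 2) := by
    obtain ⟨η, e, hu, rfl⟩ := SO3.exists_quat hX
    rw [psi_mul_quatMat_sq h.symm hu, potU_quatMat h.symm hu]
    have := h.sq_le_eigMax e
    have e1 : 4 * eigMax (bar A) ^ 2 * ((e ⬝ᵥ (bar A *ᵥ e)) / eigMax (bar A) -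
        ((e ⬝ᵥ (bar A *ᵥ e)) / eigMax (bar A)) ^ 2) =
        4 * (eigMax (bar A) * (e ⬝ᵥ (bar A *ᵥ e)) - (e ⬝ᵥ (bar A *ᵥ e)) ^ 2) := by
      field_simp
    rw [e1]; linarith
  have h1 : 0 < 1 - k ^ 2 * potU A X ^ 2 := by nlinarith [sq_nonneg k, sq_nonneg (potU A X)]
  have hr := Real.sq_sqrt h1.le
  have hr0 := Real.sqrt_pos.2 h1
  apply le_of_sq_le_sq _ (by norm_num)
  rw [vnorm_sq, smul_dotProduct, dotProduct_smul]
  generalize √(1 - k ^ 2 * potU A X ^ 2) = r at *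
  generalize potU A X = x at *
  generalize eigMax (bar A) = L at *
  generalize psi (A * X) ⬝ᵥ psi (A * X) = p at *
  have e2 : (4 * k / (4 * L * r)) • (4 * k / (4 * L * r)) • p = k ^ 2 * p / (L ^ 2 * r ^ 2) := by
    simp only [smul_eq_mul]; field_simp
  rw [e2, hr, div_le_iff₀ (by positivity)]
  have h2 : k ^ 2 * p ≤ k ^ 2 * (4 * L ^ 2 * (x - x ^ 2)) :=
    mul_le_mul_of_nonneg_left hpsi (sq_nonneg k)
  have h3 : 4 * k ^ 2 * (x - x ^ 2) ≤ (4 / 5) ^ 2 * (1 - k ^ 2 * x ^ 2) := by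
    -- The left-hand side is largest at $x=25/42$, with value $25/21<6/5$. Times $k^2<\tfrac12$ this
    -- is below $16/25$.
    have : 4 * x - 4 * x ^ 2 + 16 / 25 * x ^ 2 ≤ 6 / 5 := by nlinarith [sq_nonneg (x - 25 / 42)]
    nlinarith [mul_le_mul_of_nonneg_left this (sq_nonneg k)]
  nlinarith [mul_le_mul_of_nonneg_left h3 (sq_nonneg L)]

theorem warpRot_mulVec_axis {A : Mat3} (k : ℝ) (n : Vec3) (X : Mat3) :
    warpRot A k n X *ᵥ n = n := by
  have : skew n *ᵥ n = 0 := by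
    ext i; fin_cases i <;> simp [skew_mulVec_apply] <;> ring
  rw [warpRot, angleAxis, Matrix.add_mulVec, Matrix.add_mulVec, Matrix.smul_mulVec,
    Matrix.smul_mulVec, ← Matrix.mulVec_mulVec, this]
  simp

/-- The map is $y\mapsto\mathfrak R_Ay+(n\cdot y)p$ with $\|p\|\le\tfrac45$, and $\mathfrak R_A$
fixes $n$. Pairing with $n$ gives $(n\cdot y)(1+n\cdot p)$, hence controls $n\cdot y$ with constant
5; then $1+5\cdot\tfrac45=5$ controls $y$. -/
theorem vnorm_theta_transpose_bounds {A : Mat3} (h : BarBounds A) {k : ℝ} (hk : 0 < k)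
    (hk2 : 2 * k ^ 2 < 1) {n : Vec3} (hn : n ⬝ᵥ n = 1) {X : Mat3} (hX : X ∈ SO3) (y : Vec3) :
    vnorm y ≤ 5 * vnorm ((theta A k n X)ᵀ *ᵥ y) ∧
      vnorm ((theta A k n X)ᵀ *ᵥ y) ≤ 2 * vnorm y := by
  have hR := warpRot_mem_SO3 h hk hk2 hn hX
  have hp := vnorm_theta_term_le h hk hk2 hX
  rw [theta_transpose_mulVec]
  generalize (4 * k / (4 * eigMax (bar A) * √(1 - k ^ 2 * potU A X ^ 2))) • psi (A * X) = p at *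
  have hy := SO3.vnorm_mulVec hR y
  have hn1 : vnorm n = 1 := by rw [vnorm_eq_sqrt, hn, Real.sqrt_one]
  have ht : |n ⬝ᵥ y| ≤ vnorm y := by simpa [hn1] using abs_dotProduct_le n y
  have hnR : n ⬝ᵥ (warpRot A k n X *ᵥ y) = n ⬝ᵥ y := by
    have := SO3.mulVec_dotProduct_mulVec hR n y
    rwa [warpRot_mulVec_axis] at this
  generalize warpRot A k n X *ᵥ y = z at *
  have hp0 := vnorm_nonneg p
  have hnp : |n ⬝ᵥ p| ≤ 4 / 5 := by
    have := abs_dotProduct_le n p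
    rw [hn1, one_mul] at this
    linarith
  have h1 : vnorm ((n ⬝ᵥ y) • p) ≤ |n ⬝ᵥ y| * (4 / 5) := by
    rw [vnorm_smul]; exact mul_le_mul_of_nonneg_left hp (abs_nonneg _)
  constructor
  · have h2 : n ⬝ᵥ (z + (n ⬝ᵥ y) • p) = (n ⬝ᵥ y) * (1 + n ⬝ᵥ p) := by
      rw [dotProduct_add, hnR, dotProduct_smul, smul_eq_mul]; ring
    have h3 := abs_dotProduct_le n (z + (n ⬝ᵥ y) • p)
    rw [h2, abs_mul, hn1, one_mul] at h3
    have h4 : 1 / 5 ≤ |1 + n ⬝ᵥ p| := le_trans (by linarith [(abs_le.1 hnp).1]) (le_abs_self _)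
    have h5 : |n ⬝ᵥ y| * (1 / 5) ≤ vnorm (z + (n ⬝ᵥ y) • p) :=
      (mul_le_mul_of_nonneg_left h4 (abs_nonneg _)).trans h3
    have h6 := vnorm_add_le (z + (n ⬝ᵥ y) • p) (-((n ⬝ᵥ y) • p))
    rw [vnorm_neg, add_neg_cancel_right, hy] at h6
    linarith
  · have := vnorm_add_le z ((n ⬝ᵥ y) • p)
    have h0 := vnorm_nonneg y
    linarith

/-- All three come from $\|\psi(AY)\|^2=4(\|\bar Ae\|^2-(e\cdot\bar Ae)^2)$. The third shows that
$U_A=1$ forces $\psi=0$, which keeps $\nabla\Phi_{V_A}$ regular on the flow set. -/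
theorem vnorm_psi_bounds {A : Mat3} (h : BarBounds A) {Y : Mat3} (hY : Y ∈ SO3) :
    psi (A * Y) ⬝ᵥ psi (A * Y) ≤ 4 * eigMax (bar A) ^ 2 * rotNorm Y ^ 2 ∧
      4 * eigMin (bar A) ^ 2 * rotNorm Y ^ 2 * (1 - rotNorm Y ^ 2) ≤
        psi (A * Y) ⬝ᵥ psi (A * Y) ∧
      psi (A * Y) ⬝ᵥ psi (A * Y) ≤ 4 * eigMax (bar A) ^ 2 * (1 - potU A Y) := by
  obtain ⟨η, e, hu, rfl⟩ := SO3.exists_quat hY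
  have hL := h.eigMax_pos
  have hm := h.eigMin_pos
  have h1 := h.sq_le_eigMax e
  have h2 := h.le_eigMax e
  have h3 := h.eigMin_le e
  have h4 := dotProduct_self_nonneg' (bar A *ᵥ e - eigMin (bar A) • e)
  have h6 := dotProduct_self_nonneg' e
  have h5 : (e ⬝ᵥ (bar A *ᵥ e)) ^ 2 ≤ (e ⬝ᵥ e) * ((bar A *ᵥ e) ⬝ᵥ (bar A *ᵥ e)) := by
    have := abs_dotProduct_le e (bar A *ᵥ e)
    have h7 := pow_le_pow_left₀ (abs_nonneg _) this 2
    rwa [sq_abs, mul_pow, vnorm_sq, vnorm_sq] at h7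
  rw [psi_mul_quatMat_sq h.symm hu, rotNorm_sq_quatMat hu, potU_quatMat h.symm hu]
  simp only [sub_dotProduct, dotProduct_sub, smul_dotProduct, dotProduct_smul, smul_eq_mul,
    dotProduct_comm (bar A *ᵥ e) e] at h4
  have h8 : 4 * eigMax (bar A) ^ 2 * (1 - (e ⬝ᵥ (bar A *ᵥ e)) / eigMax (bar A)) =
      4 * eigMax (bar A) * (eigMax (bar A) - e ⬝ᵥ (bar A *ᵥ e)) := by field_simp
  rw [h8]
  have hle : e ⬝ᵥ e ≤ 1 := by nlinarith [sq_nonneg η]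
  generalize e ⬝ᵥ (bar A *ᵥ e) = b at *
  generalize (bar A *ᵥ e) ⬝ᵥ (bar A *ᵥ e) = w at *
  generalize e ⬝ᵥ e = N at *
  generalize eigMax (bar A) = L at *
  generalize eigMin (bar A) = m at *
  have hb : b ≤ L := by nlinarith
  refine ⟨?_, ?_, ?_⟩
  · nlinarith [mul_le_mul_of_nonneg_left h2 hL.le, sq_nonneg b]
  -- From $\|\bar Ae-me\|^2\ge0$ and $e\cdot\bar Ae\ge m\|e\|^2$.
  · have h9 : m ^ 2 * N ≤ w := by nlinarith
    nlinarith [mul_le_mul_of_nonneg_right h9 (show 0 ≤ 1 - N by linarith)]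
  · nlinarith [sq_nonneg (L - b)]

/-! ### Uniform bounds on the flow set -/

theorem exists_pos_forall_finset {Q : Finset ℕ} {p : ℕ → ℝ → Prop}
    (mono : ∀ q a b, a ≤ b → p q b → p q a) (h : ∀ q ∈ Q, ∃ m > 0, p q m) :
    ∃ m > 0, ∀ q ∈ Q, p q m := by
  induction Q using Finset.induction with
  | empty => exact ⟨1, one_pos, by simp⟩
  | insert a s _ ih =>
    obtain ⟨m, hm, hm'⟩ := ih fun q hq => h q (Finset.mem_insert_of_mem hq)
    obtain ⟨m', h1, h2⟩ := h a (Finset.mem_insert_self a s)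
    refine ⟨min m m', lt_min hm h1, fun q hq => ?_⟩
    rcases Finset.mem_insert.1 hq with rfl | hq
    · exact mono _ _ _ (min_le_right _ _) h2
    · exact mono _ _ _ (min_le_left _ _) (hm' q hq)

theorem exists_pos_le_of_compact {K : Set Mat3} (hK : IsCompact K) {f : Mat3 → ℝ}
    (hf : Continuous f) (hpos : ∀ X ∈ K, 0 < f X) : ∃ m > 0, ∀ X ∈ K, m ≤ f X := by
  rcases K.eq_empty_or_nonempty with rfl | hne
  · exact ⟨1, one_pos, by simp⟩
  · obtain ⟨X₀, h0, hmin⟩ := hK.exists_isMinOn hne hf.continuousOn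
    exact ⟨f X₀, hpos X₀ h0, fun X hX => hmin hX⟩

namespace Design.Admissible

variable {P : Design}

theorem warp_mem_SO3 (h : P.Admissible) {X : Mat3} (hX : X ∈ SO3) {q : ℕ} (hq : q ∈ P.Q) :
    warp P.A P.k (P.ν q) X ∈ SO3 :=
  HybridObserver.warp_mem_SO3 h.bounds h.k_pos h.two_mul_k_sq_lt (h.unit q hq) hX

/-- The hysteresis at work: an undesired critical point has a gap strictly larger than $\delta$,
while the flow set allows at most $\delta$. -/
theorem warp_eq_one_of_flow (h : P.Admissible) {X : Mat3} {q : ℕ} (hf : (X, q) ∈ P.flowSet)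
    (hpsi : psi (P.A * warp P.A P.k (P.ν q) X) = 0) : warp P.A P.k (P.ν q) X = 1 := by
  by_contra h1
  rw [P.mem_flowSet_iff] at hf
  obtain ⟨p, hp, hgap⟩ := h.gap X hf.1 q hf.2.1 hpsi h1
  have := hf.2.2 p hp
  linarith

theorem potU_warp_lt_one (h : P.Admissible) {X : Mat3} {q : ℕ} (hf : (X, q) ∈ P.flowSet) :
    potU P.A (warp P.A P.k (P.ν q) X) < 1 := by
  have hG := h.warp_mem_SO3 hf.1 hf.2.1
  refine lt_of_le_of_ne (potU_le_one h.bounds hG) fun h1 => ?_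
  have h2 := (vnorm_psi_bounds h.bounds hG).2.2
  rw [h1, sub_self, mul_zero] at h2
  have h3 := h.warp_eq_one_of_flow hf
    (eq_zero_of_dotProduct_self (le_antisymm h2 (dotProduct_self_nonneg' _)))
  rw [h3] at h1
  simp [potU] at h1

theorem exists_le_one_sub_potU (h : P.Admissible) : ∃ m > 0, ∀ q ∈ P.Q, ∀ X,
    (X, q) ∈ P.flowSet → m ≤ 1 - potU P.A (warp P.A P.k (P.ν q) X) := by
  refine exists_pos_forall_finset (fun q a b hab hb X hX => hab.trans (hb X hX)) fun q _ => ?_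
  exact exists_pos_le_of_compact (P.isCompact_flow q)
    (continuous_const.sub (continuous_potU_warp _ _ _))
    fun X hX => sub_pos.2 (h.potU_warp_lt_one hX)

/-- Compactness bounds $\psi$ away from zero where $|\Gamma|_I^2\ge\tfrac12$. Near the identity both
sides vanish, and the explicit quadratic bound takes over. -/
theorem exists_le_psi_sq (h : P.Admissible) : ∃ m > 0, ∀ q ∈ P.Q, ∀ X, (X, q) ∈ P.flowSet →
    m * rotNorm X ^ 2 ≤
      psi (P.A * warp P.A P.k (P.ν q) X) ⬝ᵥ psi (P.A * warp P.A P.k (P.ν q) X) := by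
  have h1 : ∃ m > 0, ∀ q ∈ P.Q, ∀ X ∈ {X | (X, q) ∈ P.flowSet} ∩
      {X | 1 / 2 ≤ rotNorm (warp P.A P.k (P.ν q) X) ^ 2}, m ≤
      psi (P.A * warp P.A P.k (P.ν q) X) ⬝ᵥ psi (P.A * warp P.A P.k (P.ν q) X) := by
    refine exists_pos_forall_finset (fun q a b hab hb X hX => hab.trans (hb X hX)) fun q _ => ?_
    have hw := continuous_warp P.A P.k (P.ν q)
    have hpsi := continuous_psi.comp (continuous_const.matrix_mul hw (A := fun _ => P.A))
    refine exists_pos_le_of_compact ((P.isCompact_flow q).inter_right ?_) ?_ ?_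
    · exact isClosed_le continuous_const ((continuous_rotNorm.comp hw).pow 2)
    · exact hpsi.dotProduct hpsi
    · rintro X ⟨hX, hX'⟩
      refine lt_of_le_of_ne (dotProduct_self_nonneg' _) fun h0 => ?_
      have := h.warp_eq_one_of_flow hX (eq_zero_of_dotProduct_self h0.symm)
      rw [Set.mem_ofPred_eq, this] at hX'
      norm_num [rotNorm] at hX'
  obtain ⟨m, hm, hm'⟩ := h1
  have hmin := h.bounds.eigMin_pos
  -- The factor $\tfrac16$ is $4\cdot\tfrac12\cdot\tfrac1{12}$: from $1-|\Gamma|_I^2\ge\tfrac12$ and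
  -- $|X|_I^2\le12|\Gamma|_I^2$.
  refine ⟨min m (eigMin (bar P.A) ^ 2 / 6), lt_min hm (by positivity), fun q hq X hX => ?_⟩
  have hN1 := (quad_quatMat_bounds h.bounds hX.1).2.2
  have hN0 := sq_nonneg (rotNorm X)
  by_cases hc : 1 / 2 ≤ rotNorm (warp P.A P.k (P.ν q) X) ^ 2
  · refine le_trans ?_ (hm' q hq X ⟨hX, hc⟩)
    nlinarith [min_le_left m (eigMin (bar P.A) ^ 2 / 6)]
  · push Not at hc
    have h2 := (vnorm_psi_bounds h.bounds (h.warp_mem_SO3 hX.1 hq)).2.1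
    have h3 := (rotNorm_warp_bounds h.bounds h.k_pos h.two_mul_k_sq_lt (h.unit q hq) hX.1).2
    have h4 : eigMin (bar P.A) ^ 2 / 6 * rotNorm X ^ 2 ≤ 4 * eigMin (bar P.A) ^ 2 *
        rotNorm (warp P.A P.k (P.ν q) X) ^ 2 * (1 - rotNorm (warp P.A P.k (P.ν q) X) ^ 2) := by
      have h5 := mul_le_mul_of_nonneg_left h3 (sq_nonneg (eigMin (bar P.A)))
      have h6 : 0 ≤ eigMin (bar P.A) ^ 2 * rotNorm (warp P.A P.k (P.ν q) X) ^ 2 := by positivity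
      nlinarith
    refine le_trans (le_trans ?_ h4) h2
    exact mul_le_mul_of_nonneg_right (min_le_right _ _) hN0

theorem exists_innov_bounds (h : P.Admissible) : ∃ c C : ℝ, 0 < c ∧ 0 < C ∧
    ∀ X q, (X, q) ∈ P.flowSet → c * rotNorm X ^ 2 ≤ P.innov X q ⬝ᵥ P.innov X q ∧
      vnorm (P.innov X q) ≤ C * rotNorm X := by
  obtain ⟨m, hm, hm'⟩ := h.exists_le_psi_sq
  obtain ⟨b, hb, hb'⟩ := h.exists_le_one_sub_potU
  have hL := h.bounds.eigMax_pos
  set L := eigMax (bar P.A) with hLdef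
  have hL0 := hL.ne'
  -- Here $400=16\cdot25$, from the prefactor $1/(4L)$ and the bound 5 for $\Theta_A^\top$. The
  -- extra term $2/\sqrt b$ serves the potential $V_A$, so that one constant fits both kinds.
  refine ⟨m / (400 * L ^ 2), 2 + 2 * (√b)⁻¹, by positivity, by positivity, fun X q hf => ?_⟩
  have hq := hf.2.1
  have hG := h.warp_mem_SO3 hf.1 hq
  have h1 := hm' q hq X hf
  obtain ⟨h2, h3⟩ := vnorm_theta_transpose_bounds h.bounds h.k_pos h.two_mul_k_sq_lt
    (h.unit q hq) hf.1 (psi (P.A * warp P.A P.k (P.ν q) X))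
  have h4 := (vnorm_psi_bounds h.bounds hG).1
  have h5 := (rotNorm_warp_bounds h.bounds h.k_pos h.two_mul_k_sq_lt (h.unit q hq) hf.1).1
  have hN : 0 ≤ rotNorm X := Real.sqrt_nonneg _
  have h6 : vnorm (psi (P.A * warp P.A P.k (P.ν q) X)) ≤ 4 * L * rotNorm X := by
    apply le_of_sq_le_sq _ (by positivity)
    rw [vnorm_sq]
    nlinarith [mul_le_mul_of_nonneg_left h5 (sq_nonneg L), sq_nonneg (L * rotNorm X)]
  have hlow : m / (400 * L ^ 2) * rotNorm X ^ 2 ≤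
      vnorm ((1 / (4 * L)) • ((theta P.A P.k (P.ν q) X)ᵀ *ᵥ
        psi (P.A * warp P.A P.k (P.ν q) X))) ^ 2 := by
    rw [vnorm_smul, mul_pow, sq_abs]
    have h7 : m * rotNorm X ^ 2 ≤ 25 * vnorm ((theta P.A P.k (P.ν q) X)ᵀ *ᵥ
        psi (P.A * warp P.A P.k (P.ν q) X)) ^ 2 := by
      rw [← vnorm_sq] at h1
      nlinarith [vnorm_nonneg (psi (P.A * warp P.A P.k (P.ν q) X))]
    rw [div_mul_eq_mul_div, div_le_iff₀ (by positivity)]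
    have e : (1 / (4 * L)) ^ 2 * vnorm ((theta P.A P.k (P.ν q) X)ᵀ *ᵥ
        psi (P.A * warp P.A P.k (P.ν q) X)) ^ 2 * (400 * L ^ 2) =
        25 * vnorm ((theta P.A P.k (P.ν q) X)ᵀ *ᵥ psi (P.A * warp P.A P.k (P.ν q) X)) ^ 2 := by
      field_simp; ring
    rw [e]; exact h7
  have hupp : vnorm ((1 / (4 * L)) • ((theta P.A P.k (P.ν q) X)ᵀ *ᵥ
        psi (P.A * warp P.A P.k (P.ν q) X))) ≤ 2 * rotNorm X := by
    rw [vnorm_smul, abs_of_pos (by positivity), div_mul_eq_mul_div, div_le_iff₀ (by positivity)]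
    linarith
  have hr0 : 0 < √b := Real.sqrt_pos.2 hb
  have hr1 : √b ≤ √(1 - potU P.A (warp P.A P.k (P.ν q) X)) :=
    Real.sqrt_le_sqrt (hb' q hq X hf)
  have hr2 : √(1 - potU P.A (warp P.A P.k (P.ν q) X)) ≤ 1 := by
    have := potU_nonneg h.bounds hG
    exact Real.sqrt_le_iff.2 ⟨zero_le_one, by linarith⟩
  rw [← vnorm_sq]
  unfold Design.innov
  simp only [← hLdef]
  generalize (1 / (4 * L)) • ((theta P.A P.k (P.ν q) X)ᵀ *ᵥ
        psi (P.A * warp P.A P.k (P.ν q) X)) = g at *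
  have hi := mul_nonneg (inv_nonneg.2 hr0.le) hN
  cases P.kind
  · refine ⟨hlow, ?_⟩
    simp only
    linarith
  · simp only
    generalize √(1 - potU P.A (warp P.A P.k (P.ν q) X)) = r at *
    have hr : 0 < r := hr0.trans_le hr1
    rw [vnorm_smul, abs_of_pos (inv_pos.2 hr)]
    constructor
    · rw [mul_pow]
      have : 1 ≤ r⁻¹ ^ 2 := one_le_pow₀ ((one_le_inv₀ hr).2 hr2)
      nlinarith [sq_nonneg (vnorm g)]
    · have h8 : r⁻¹ ≤ (√b)⁻¹ := inv_anti₀ hr0 hr1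
      have h9 : r⁻¹ * vnorm g ≤ (√b)⁻¹ * (2 * rotNorm X) :=
        mul_le_mul h8 hupp (vnorm_nonneg g) (inv_nonneg.2 hr0.le)
      linarith

end Design.Admissible

/-! ### Derivatives of matrix-valued curves -/

/-- Entrywise derivative of a matrix-valued curve. -/
def HasMatDeriv (M : ℝ → Mat3) (M' : Mat3) (t : ℝ) : Prop :=
  ∀ i j, HasDerivAt (fun s => M s i j) (M' i j) t

namespace HasMatDeriv

variable {M N : ℝ → Mat3} {M' N' : Mat3} {t : ℝ}

theorem const (C : Mat3) (t : ℝ) : HasMatDeriv (fun _ => C) 0 t :=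
  fun _ _ => hasDerivAt_const _ _

theorem mul (hM : HasMatDeriv M M' t) (hN : HasMatDeriv N N' t) :
    HasMatDeriv (fun s => M s * N s) (M' * N t + M t * N') t := by
  intro i j
  simp only [Matrix.mul_apply, Matrix.add_apply, ← Finset.sum_add_distrib]
  exact HasDerivAt.fun_sum fun k _ => (hM i k).mul (hN k j)

theorem add (hM : HasMatDeriv M M' t) (hN : HasMatDeriv N N' t) :
    HasMatDeriv (fun s => M s + N s) (M' + N') t := fun i j => (hM i j).add (hN i j)

theorem sub (hM : HasMatDeriv M M' t) (hN : HasMatDeriv N N' t) :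
    HasMatDeriv (fun s => M s - N s) (M' - N') t := fun i j => (hM i j).sub (hN i j)

theorem transpose (hM : HasMatDeriv M M' t) : HasMatDeriv (fun s => (M s)ᵀ) M'ᵀ t :=
  fun i j => hM j i

theorem smul_const {f : ℝ → ℝ} {f' : ℝ} (hf : HasDerivAt f f' t) (C : Mat3) :
    HasMatDeriv (fun s => f s • C) (f' • C) t := fun i j => hf.mul_const (C i j)

theorem trace (hM : HasMatDeriv M M' t) : HasDerivAt (fun s => (M s).trace) M'.trace t :=
  HasDerivAt.fun_sum fun i _ => hM i i

theorem psi (hM : HasMatDeriv M M' t) (i : Fin 3) :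
    HasDerivAt (fun s => HybridObserver.psi (M s) i) (HybridObserver.psi M' i) t := by
  fin_cases i
  · exact ((hM 2 1).sub (hM 1 2)).div_const 2
  · exact ((hM 0 2).sub (hM 2 0)).div_const 2
  · exact ((hM 1 0).sub (hM 0 1)).div_const 2

theorem mulVec {v : ℝ → Vec3} {v' : Vec3} (hM : HasMatDeriv M M' t)
    (hv : ∀ i, HasDerivAt (fun s => v s i) (v' i) t) (i : Fin 3) :
    HasDerivAt (fun s => (M s *ᵥ v s) i) ((M' *ᵥ v t + M t *ᵥ v') i) t := by
  simp only [Matrix.mulVec, dotProduct, Pi.add_apply, ← Finset.sum_add_distrib]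
  exact HasDerivAt.fun_sum fun k _ => (hM i k).mul (hv k)

end HasMatDeriv

theorem hasDerivAt_dotProduct {u v : ℝ → Vec3} {u' v' : Vec3} {t : ℝ}
    (hu : ∀ i, HasDerivAt (fun s => u s i) (u' i) t)
    (hv : ∀ i, HasDerivAt (fun s => v s i) (v' i) t) :
    HasDerivAt (fun s => u s ⬝ᵥ v s) (u' ⬝ᵥ v t + u t ⬝ᵥ v') t := by
  simp only [dotProduct, ← Finset.sum_add_distrib]
  exact HasDerivAt.fun_sum fun k _ => (hu k).mul (hv k)

theorem skew_cube {n : Vec3} (hn : n ⬝ᵥ n = 1) : skew n * skew n * skew n = -skew n := by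
  rw [dotProduct_three] at hn
  ext i j
  fin_cases i <;> fin_cases j <;>
    simp [Matrix.mul_apply, Fin.sum_univ_three, skew_apply] <;>
    first | ring1 | linear_combination n 0 * hn | linear_combination n 1 * hn
          | linear_combination n 2 * hn | linear_combination (-n 0) * hn
          | linear_combination (-n 1) * hn | linear_combination (-n 2) * hn

/-- Differentiating the Rodrigues formula and using $[n]_\times^3=-[n]_\times$. -/
theorem hasMatDeriv_angleAxis {θ : ℝ → ℝ} {θ' t : ℝ} (hθ : HasDerivAt θ θ' t) {n : Vec3}
    (hn : n ⬝ᵥ n = 1) :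
    HasMatDeriv (fun s => angleAxis (θ s) n) (angleAxis (θ t) n * skew (θ' • n)) t := by
  have h1 := HasMatDeriv.smul_const hθ.sin (skew n)
  have h2 := HasMatDeriv.smul_const (hθ.cos.const_sub 1) (skew n * skew n)
  have h3 := ((HasMatDeriv.const 1 t).add h1).add h2
  have e : angleAxis (θ t) n * skew (θ' • n) = 0 + (Real.cos (θ t) * θ') • skew n +
      (-(-Real.sin (θ t) * θ')) • (skew n * skew n) := by
    rw [angleAxis, skew_smul]
    simp only [add_mul, one_mul, Matrix.mul_smul, Matrix.smul_mul, skew_cube hn]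
    module
  rw [e]
  exact h3

theorem hasDerivAt_potU (A : Mat3) {X : ℝ → Mat3} {Ω : Vec3} {t : ℝ}
    (hX : HasMatDeriv X (X t * skew Ω) t) :
    HasDerivAt (fun s => potU A (X s))
      (2 * (psi (A * X t) ⬝ᵥ Ω) / (4 * eigMax (bar A))) t := by
  have h1 := ((HasMatDeriv.const A t).mul ((HasMatDeriv.const 1 t).sub hX)).trace.div_const
    (4 * eigMax (bar A))
  have e : (0 * (1 - X t) + A * (0 - X t * skew Ω)).trace = 2 * (psi (A * X t) ⬝ᵥ Ω) := by
    rw [zero_mul, zero_add, zero_sub, Matrix.mul_neg, Matrix.trace_neg, ← mul_assoc,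
      trace_mul_skew]
    ring
  rw [e] at h1
  exact h1

theorem theta_mulVec (A : Mat3) (k : ℝ) (n : Vec3) (X : Mat3) (y : Vec3) :
    theta A k n X *ᵥ y = (warpRot A k n X)ᵀ *ᵥ y +
      ((4 * k / (4 * eigMax (bar A) * √(1 - k ^ 2 * potU A X ^ 2))) * (psi (A * X) ⬝ᵥ y)) • n := by
  rw [theta, Matrix.add_mulVec, Matrix.smul_mulVec, Matrix.vecMulVec_mulVec]
  congr 1
  ext i; simp; ring

/-- This explains $\Theta_A$: it is the differential of the warping in body coordinates. The
transposed rotation comes from moving $[\Omega]_\times$ past the warping rotation, the rank-one term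
from the changing angle. -/
theorem hasMatDeriv_warp {A : Mat3} (h : BarBounds A) {k : ℝ} (hk : 0 < k)
    (hk2 : 2 * k ^ 2 < 1) {n : Vec3} (hn : n ⬝ᵥ n = 1) {X : ℝ → Mat3} {Ω : Vec3} {t : ℝ}
    (hXt : X t ∈ SO3) (hX : HasMatDeriv X (X t * skew Ω) t) :
    HasMatDeriv (fun s => warp A k n (X s))
      (warp A k n (X t) * skew (theta A k n (X t) *ᵥ Ω)) t := by
  obtain ⟨h0, h1, -⟩ := mul_potU_bounds h hk hk2 hXt
  have hR := warpRot_mem_SO3 h hk hk2 hn hXt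
  have hu := (hasDerivAt_potU A hX).const_mul k
  have ha := (Real.hasDerivAt_arcsin (by linarith : k * potU A (X t) ≠ -1) h1.ne).comp t hu
  have hrot := hasMatDeriv_angleAxis (ha.const_mul 2) hn
  have hw := hX.mul hrot
  have e : X t * skew Ω * warpRot A k n (X t) + X t * (warpRot A k n (X t) *
      skew ((2 * (1 / √(1 - (k * potU A (X t)) ^ 2) *
        (k * (2 * (psi (A * X t) ⬝ᵥ Ω) / (4 * eigMax (bar A)))))) • n)) =
      warp A k n (X t) * skew (theta A k n (X t) *ᵥ Ω) := by
    rw [theta_mulVec, skew_add, ← SO3.mul_skew_mul_transpose (SO3.transpose_mem hR),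
      Matrix.transpose_transpose, warp, mul_add]
    congr 1
    · have h2 := SO3.mul_transpose hR
      generalize warpRot A k n (X t) = R at *
      calc X t * skew Ω * R = X t * (R * Rᵀ) * skew Ω * R := by rw [h2, mul_one]
        _ = X t * R * (Rᵀ * skew Ω * R) := by simp only [mul_assoc]
    · rw [mul_assoc]
      congr 4
      rw [mul_pow]
      have := h.eigMax_pos.ne'
      field_simp
      ring
  rw [← e]
  exact hw

/-- The factor 2 is that of $\mathrm{tr}([x]_\times^\top[y]_\times)=2\,x\cdot y$, the metric of the
gradient. Flow-set membership keeps the square root in $V_A$ differentiable. -/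
theorem Design.Admissible.hasDerivAt_Φ {P : Design} (h : P.Admissible) {X : ℝ → Mat3} {Ω : Vec3}
    {t : ℝ} {q : ℕ} (hf : (X t, q) ∈ P.flowSet) (hX : HasMatDeriv X (X t * skew Ω) t) :
    HasDerivAt (fun s => P.Φ (X s) q) (2 * (P.innov (X t) q ⬝ᵥ Ω)) t := by
  have h1 := hasDerivAt_potU P.A
    (hasMatDeriv_warp h.bounds h.k_pos h.two_mul_k_sq_lt (h.unit q hf.2.1) hf.1 hX)
  have h2 := h.potU_warp_lt_one hf
  have e : ∀ y : Vec3, y ⬝ᵥ (theta P.A P.k (P.ν q) (X t) *ᵥ Ω) =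
      ((theta P.A P.k (P.ν q) (X t))ᵀ *ᵥ y) ⬝ᵥ Ω := fun y => by
    rw [Matrix.dotProduct_mulVec, Matrix.mulVec_transpose]
  rw [e] at h1
  have hL := h.bounds.eigMax_pos.ne'
  unfold Design.Φ Design.innov
  cases P.kind
  · simp only
    refine h1.congr_deriv ?_
    rw [smul_dotProduct, smul_eq_mul]
    ring
  · simp only
    have h3 := (((h1.const_sub 1).sqrt (by linarith)).const_sub 1).const_mul 2
    have hr : 0 < √(1 - potU P.A (warp P.A P.k (P.ν q) (X t))) := Real.sqrt_pos.2 (by linarith)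
    refine h3.congr_deriv ?_
    rw [smul_dotProduct, smul_dotProduct, smul_eq_mul, smul_eq_mul]
    field_simp

/-! ### Smoothness of the innovation -/

section Smooth

variable {E : Type*} [NormedAddCommGroup E] [NormedSpace ℝ E]

/-- Entrywise continuous differentiability of a matrix-valued map. -/
def MatC1At (M : E → Mat3) (z : E) : Prop := ∀ i j, ContDiffAt ℝ 1 (fun y => M y i j) z

namespace MatC1At

variable {M N : E → Mat3} {z : E}

theorem const (C : Mat3) (z : E) : MatC1At (fun _ => C) z := fun _ _ => contDiffAt_const

theorem mul (hM : MatC1At M z) (hN : MatC1At N z) : MatC1At (fun y => M y * N y) z := by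
  intro i j
  simp only [Matrix.mul_apply]
  exact ContDiffAt.sum fun k _ => (hM i k).mul (hN k j)

theorem add (hM : MatC1At M z) (hN : MatC1At N z) : MatC1At (fun y => M y + N y) z :=
  fun i j => (hM i j).add (hN i j)

theorem sub (hM : MatC1At M z) (hN : MatC1At N z) : MatC1At (fun y => M y - N y) z :=
  fun i j => (hM i j).sub (hN i j)

theorem transpose (hM : MatC1At M z) : MatC1At (fun y => (M y)ᵀ) z := fun i j => hM j i

theorem smul {f : E → ℝ} (hf : ContDiffAt ℝ 1 f z) (hM : MatC1At M z) :
    MatC1At (fun y => f y • M y) z := fun i j => hf.mul (hM i j)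

theorem trace (hM : MatC1At M z) : ContDiffAt ℝ 1 (fun y => (M y).trace) z :=
  ContDiffAt.sum fun i _ => hM i i

theorem psi (hM : MatC1At M z) (i : Fin 3) :
    ContDiffAt ℝ 1 (fun y => HybridObserver.psi (M y) i) z := by
  fin_cases i
  · exact ((hM 2 1).sub (hM 1 2)).div_const 2
  · exact ((hM 0 2).sub (hM 2 0)).div_const 2
  · exact ((hM 1 0).sub (hM 0 1)).div_const 2

theorem mulVec {v : E → Vec3} (hM : MatC1At M z) (hv : ∀ i, ContDiffAt ℝ 1 (fun y => v y i) z)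
    (i : Fin 3) : ContDiffAt ℝ 1 (fun y => (M y *ᵥ v y) i) z := by
  simp only [Matrix.mulVec, dotProduct]
  exact ContDiffAt.sum fun k _ => (hM i k).mul (hv k)

theorem skew {v : E → Vec3} (hv : ∀ i, ContDiffAt ℝ 1 (fun y => v y i) z) :
    MatC1At (fun y => HybridObserver.skew (v y)) z := by
  intro i j
  fin_cases i <;> fin_cases j <;> simp [skew_apply] <;>
    first | exact contDiffAt_const | exact hv _ | exact (hv _).neg

theorem potU (A : Mat3) (hM : MatC1At M z) :
    ContDiffAt ℝ 1 (fun y => HybridObserver.potU A (M y)) z :=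
  ((const A z).mul ((const 1 z).sub hM)).trace.div_const _

end MatC1At

/-- Smoothness is asserted entrywise along a map from a normed space, so that no norm on matrices
has to be chosen. It supplies the Lipschitz property needed for local existence. -/
theorem Design.Admissible.contDiffAt_innov {P : Design} (h : P.Admissible) {M : E → Mat3} {z : E}
    {q : ℕ} (hf : (M z, q) ∈ P.flowSet) (hM : MatC1At M z) (i : Fin 3) :
    ContDiffAt ℝ 1 (fun y => P.innov (M y) q i) z := by
  obtain ⟨h0, h1, h2⟩ := mul_potU_bounds h.bounds h.k_pos h.two_mul_k_sq_lt hf.1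
  have hu := hM.potU P.A
  have hθ : ContDiffAt ℝ 1 (fun y => 2 * Real.arcsin (P.k * potU P.A (M y))) z := by
    refine contDiffAt_const.mul ?_
    exact ContDiffAt.comp (g := Real.arcsin) z (Real.contDiffAt_arcsin (by linarith) h1.ne)
      (contDiffAt_const.mul hu)
  have hrot : MatC1At (fun y => warpRot P.A P.k (P.ν q) (M y)) z :=
    ((MatC1At.const 1 z).add (MatC1At.smul hθ.sin (MatC1At.const _ z))).add
      (MatC1At.smul (contDiffAt_const.sub hθ.cos) (MatC1At.const _ z))
  have hwarp : MatC1At (fun y => warp P.A P.k (P.ν q) (M y)) z := hM.mul hrot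
  have hpos : 0 < 1 - P.k ^ 2 * potU P.A (M z) ^ 2 := by rw [← mul_pow]; linarith
  have hsq : ContDiffAt ℝ 1 (fun y => √(1 - P.k ^ 2 * potU P.A (M y) ^ 2)) z :=
    (contDiffAt_const.sub (contDiffAt_const.mul (hu.pow 2))).sqrt hpos.ne'
  have hcoef : ContDiffAt ℝ 1 (fun y => 4 * P.k / (4 * eigMax (bar P.A) *
      √(1 - P.k ^ 2 * potU P.A (M y) ^ 2))) z :=
    contDiffAt_const.div (contDiffAt_const.mul hsq)
      (mul_ne_zero (mul_ne_zero four_ne_zero h.bounds.eigMax_pos.ne')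
        (Real.sqrt_pos.2 hpos).ne')
  have hpsi := ((MatC1At.const P.A z).mul hM).psi
  have htheta : MatC1At (fun y => theta P.A P.k (P.ν q) (M y)) z :=
    hrot.transpose.add (MatC1At.smul hcoef fun a b => contDiffAt_const.mul (hpsi b))
  have hg (i : Fin 3) : ContDiffAt ℝ 1 (fun y => ((1 / (4 * eigMax (bar P.A))) •
      ((theta P.A P.k (P.ν q) (M y))ᵀ *ᵥ psi (P.A * warp P.A P.k (P.ν q) (M y)))) i) z :=
    contDiffAt_const.mul (htheta.transpose.mulVec ((MatC1At.const P.A z).mul hwarp).psi i)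
  have h3 := h.potU_warp_lt_one hf
  have hpos' : 0 < 1 - potU P.A (warp P.A P.k (P.ν q) (M z)) := by linarith
  unfold Design.innov
  cases P.kind
  · exact hg i
  · exact (((contDiffAt_const.sub (hwarp.potU P.A)).sqrt hpos'.ne').inv
      (Real.sqrt_pos.2 hpos').ne').mul (hg i)

end Smooth

open MeasureTheory Set

/-! ### Absolutely continuous functions -/

section AbsolutelyContinuous

variable {f g : ℝ → ℝ} {a b c : ℝ}

theorem ac_congr (hf : AbsolutelyContinuousOnInterval f a b) (h : ∀ x ∈ uIcc a b, f x = g x) :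
    AbsolutelyContinuousOnInterval g a b := by
  rw [absolutelyContinuousOnInterval_iff] at hf ⊢
  intro ε hε
  obtain ⟨δ, hδ, hd⟩ := hf ε hε
  refine ⟨δ, hδ, fun E hE hlt => ?_⟩
  convert hd E hE hlt using 1
  refine Finset.sum_congr rfl fun i hi => ?_
  rw [h _ (hE.1 i hi).1, h _ (hE.1 i hi).2]

theorem ac_const (C : ℝ) : AbsolutelyContinuousOnInterval (fun _ => C) a b :=
  (LipschitzWith.const C).lipschitzOnWith.absolutelyContinuousOnInterval

theorem ac_sum {ι : Type*} {s : Finset ι} {F : ι → ℝ → ℝ}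
    (h : ∀ i ∈ s, AbsolutelyContinuousOnInterval (F i) a b) :
    AbsolutelyContinuousOnInterval (fun t => ∑ i ∈ s, F i t) a b := by
  classical
  induction s using Finset.induction with
  | empty => simpa using ac_const 0
  | insert i s hi ih =>
    simp only [Finset.sum_insert hi]
    exact (h i (Finset.mem_insert_self i s)).fun_add
      (ih fun j hj => h j (Finset.mem_insert_of_mem hj))

theorem ac_sub_eq_integral {F : ℝ → ℝ} (hf : AbsolutelyContinuousOnInterval f a b)
    (hF : ∀ᵐ t, t ∈ uIcc a b → HasDerivAt f (F t) t) : f b - f a = ∫ t in a..b, F t := by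
  rw [← hf.integral_deriv_eq_sub]
  apply intervalIntegral.integral_congr_ae
  filter_upwards [hF] with t ht hmem
  exact (ht (uIoc_subset_uIcc hmem)).deriv

theorem ae_mem_Ioo_of_mem_Icc (a b : ℝ) : ∀ᵐ t : ℝ, t ∈ Icc a b → t ∈ Ioo a b := by
  have h1 : ∀ᵐ t : ℝ, t ≠ a := by simp [ae_iff, measure_singleton]
  have h2 : ∀ᵐ t : ℝ, t ≠ b := by simp [ae_iff, measure_singleton]
  filter_upwards [h1, h2] with t ha hb ht
  exact ⟨lt_of_le_of_ne ht.1 ha.symm, lt_of_le_of_ne ht.2 hb⟩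

theorem ac_le_of_deriv_nonpos (hab : a ≤ b) (hf : AbsolutelyContinuousOnInterval f a b)
    (hd : ∀ᵐ t, t ∈ Ioo a b → ∃ d ≤ 0, HasDerivAt f d t) : f b ≤ f a := by
  have h1 : 0 ≤ ∫ t in a..b, -deriv f t := by
    apply intervalIntegral.integral_nonneg_of_ae_restrict hab
    rw [Filter.EventuallyLE, ae_restrict_iff' measurableSet_Icc]
    filter_upwards [hd, ae_mem_Ioo_of_mem_Icc a b] with t h1 h2 h3
    obtain ⟨d, hd, hfd⟩ := h1 (h2 h3)
    rw [hfd.deriv, Pi.zero_apply]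
    linarith
  rw [intervalIntegral.integral_neg, hf.integral_deriv_eq_sub] at h1
  linarith

theorem ac_id_mul (M : ℝ) : AbsolutelyContinuousOnInterval (fun t => M * t) a b :=
  (LipschitzWith.id.lipschitzOnWith.absolutelyContinuousOnInterval (f := id)).const_mul M

theorem ac_abs_sub_le (hab : a ≤ b) (hf : AbsolutelyContinuousOnInterval f a b) {M : ℝ}
    (hd : ∀ᵐ t, t ∈ Ioo a b → ∃ d, |d| ≤ M ∧ HasDerivAt f d t) :
    |f b - f a| ≤ M * (b - a) := by
  have h1 := ac_le_of_deriv_nonpos hab (hf.fun_sub (ac_id_mul M)) (by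
    filter_upwards [hd] with t ht hmem
    obtain ⟨d, hd, hfd⟩ := ht hmem
    exact ⟨d - M * 1, by linarith [(abs_le.1 hd).2], hfd.fun_sub ((hasDerivAt_id t).const_mul M)⟩)
  have h2 := ac_le_of_deriv_nonpos hab (hf.fun_neg.fun_sub (ac_id_mul M)) (by
    filter_upwards [hd] with t ht hmem
    obtain ⟨d, hd, hfd⟩ := ht hmem
    exact ⟨-d - M * 1, by linarith [(abs_le.1 hd).1],
      hfd.fun_neg.fun_sub ((hasDerivAt_id t).const_mul M)⟩)
  rw [abs_le]
  constructor <;> linarith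

/-- The integral form of the equation has a continuous integrand, so it can be differentiated at
every point. This upgrades the almost-everywhere error equations. -/
theorem ac_hasDerivAt_of_continuousOn {F : ℝ → ℝ} (hf : AbsolutelyContinuousOnInterval f a b)
    (hF : ContinuousOn F (Icc a b)) (hd : ∀ᵐ t, t ∈ Icc a b → HasDerivAt f (F t) t) {t : ℝ}
    (ht : t ∈ Ioo a b) : HasDerivAt f (F t) t := by
  have hab : a ≤ b := (ht.1.trans ht.2).le
  have key (x : ℝ) (hx : x ∈ Icc a b) : f x = f a + ∫ s in a..x, F s := by
    have hsub : uIcc a x ⊆ Icc a b := by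
      rw [uIcc_of_le hx.1]; exact Icc_subset_Icc_right hx.2
    have := ac_sub_eq_integral (hf.mono (by rwa [uIcc_of_le hab])) (by
      filter_upwards [hd] with s hs hmem
      exact hs (hsub hmem) : ∀ᵐ s, s ∈ uIcc a x → HasDerivAt f (F s) s)
    linarith
  have hint : IntervalIntegrable F volume a t := by
    apply ContinuousOn.intervalIntegrable
    rw [uIcc_of_le ht.1.le]
    exact hF.mono (Icc_subset_Icc_right ht.2.le)
  have hI := intervalIntegral.integral_hasDerivAt_right hint
    ((hF.mono Ioo_subset_Icc_self).stronglyMeasurableAtFilter isOpen_Ioo t ht)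
    (hF.continuousAt (Icc_mem_nhds ht.1 ht.2))
  refine (hI.const_add (f a)).congr_of_eventuallyEq ?_
  filter_upwards [Icc_mem_nhds ht.1 ht.2] with x hx
  exact key x hx

/-- A bounded derivative gives a Lipschitz bound on the open interval, which passes to the closure
by continuity. -/
theorem ac_of_deriv_bounded (hab : a < b) (hc : ContinuousOn f (Icc a b)) {M : ℝ}
    {f' : ℝ → ℝ} (hd : ∀ t ∈ Ioo a b, HasDerivAt f (f' t) t) (hM : ∀ t ∈ Ioo a b, |f' t| ≤ M) :
    AbsolutelyContinuousOnInterval f a b := by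
  have h1 : LipschitzOnWith M.toNNReal f (Ioo a b) := by
    refine (convex_Ioo a b).lipschitzOnWith_of_nnnorm_hasDerivWithin_le
      (fun t ht => (hd t ht).hasDerivWithinAt) fun t ht => ?_
    rw [← NNReal.coe_le_coe, coe_nnnorm, Real.norm_eq_abs]
    exact (hM t ht).trans (Real.le_coe_toNNReal M)
  have h2 := LipschitzOnWith.closure (by rwa [closure_Ioo hab.ne]) h1
  rw [closure_Ioo hab.ne, ← uIcc_of_le hab.le] at h2
  exact h2.absolutelyContinuousOnInterval

/-- On the union, $f$ equals $f(a)$ plus the integral of its derivative, because it does so on each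
piece. -/
theorem ac_trans (hab : a ≤ b) (hbc : b ≤ c) (h1 : AbsolutelyContinuousOnInterval f a b)
    (h2 : AbsolutelyContinuousOnInterval f b c) : AbsolutelyContinuousOnInterval f a c := by
  have i1 := h1.intervalIntegrable_deriv
  have i2 := h2.intervalIntegrable_deriv
  have hi := i1.trans i2
  have hac := (ac_const (a := a) (b := c) (f a)).fun_add
    (hi.absolutelyContinuousOnInterval_intervalIntegral (c := a) left_mem_uIcc)
  refine ac_congr hac fun x hx => ?_
  rw [uIcc_of_le (hab.trans hbc)] at hx
  rcases le_total x b with h | h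
  · have hs : uIcc a x ⊆ uIcc a b := by
      rw [uIcc_of_le hx.1, uIcc_of_le hab]; exact Icc_subset_Icc_right h
    rw [(h1.mono hs).integral_deriv_eq_sub]; ring
  · have hs : uIcc b x ⊆ uIcc b c := by
      rw [uIcc_of_le h, uIcc_of_le hbc]; exact Icc_subset_Icc_right hx.2
    rw [← intervalIntegral.integral_add_adjacent_intervals i1 (i2.mono_set hs),
      (h2.mono hs).integral_deriv_eq_sub, h1.integral_deriv_eq_sub]
    ring

/-- Entrywise absolute continuity of a matrix-valued curve. -/
def MatAC (M : ℝ → Mat3) (a b : ℝ) : Prop :=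
  ∀ i j, AbsolutelyContinuousOnInterval (fun t => M t i j) a b

theorem MatAC.mul {M N : ℝ → Mat3} (hM : MatAC M a b) (hN : MatAC N a b) :
    MatAC (fun t => M t * N t) a b := by
  intro i j
  simp only [Matrix.mul_apply]
  exact ac_sum fun k _ => (hM i k).fun_mul (hN k j)

theorem MatAC.transpose {M : ℝ → Mat3} (hM : MatAC M a b) : MatAC (fun t => (M t)ᵀ) a b :=
  fun i j => hM j i

theorem MatAC.mulVec {M : ℝ → Mat3} {v : ℝ → Vec3} (hM : MatAC M a b)
    (hv : ∀ i, AbsolutelyContinuousOnInterval (fun t => v t i) a b) (i : Fin 3) :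
    AbsolutelyContinuousOnInterval (fun t => (M t *ᵥ v t) i) a b := by
  simp only [Matrix.mulVec, dotProduct]
  exact ac_sum fun k _ => (hM i k).fun_mul (hv k)

theorem ac_dotProduct {u v : ℝ → Vec3}
    (hu : ∀ i, AbsolutelyContinuousOnInterval (fun t => u t i) a b)
    (hv : ∀ i, AbsolutelyContinuousOnInterval (fun t => v t i) a b) :
    AbsolutelyContinuousOnInterval (fun t => u t ⬝ᵥ v t) a b := by
  simp only [dotProduct]
  exact ac_sum fun k _ => (hu k).fun_mul (hv k)

theorem MatAC.psi {M : ℝ → Mat3} (hM : MatAC M a b) (i : Fin 3) :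
    AbsolutelyContinuousOnInterval (fun t => HybridObserver.psi (M t) i) a b := by
  have h (i j k l : Fin 3) :
      AbsolutelyContinuousOnInterval (fun t => (M t i j - M t k l) / 2) a b := by
    refine ac_congr (((hM i j).fun_sub (hM k l)).const_mul (1 / 2)) fun t _ => ?_
    ring
  fin_cases i
  · exact h 2 1 1 2
  · exact h 0 2 2 0
  · exact h 1 0 0 1

theorem MatAC.continuousOn {M : ℝ → Mat3} (hM : MatAC M a b) : ContinuousOn M (uIcc a b) :=
  continuousOn_pi.2 fun i => continuousOn_pi.2 fun j => (hM i j).continuousOn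

end AbsolutelyContinuous

/-! ### Error dynamics on an interval of flow -/

/-- The error system on an interval `S` of flow, with constant discrete variable `q`; `y` is the
bias estimation error. -/
structure FlowOn (P : Design) (γP γI : ℝ) (ω : ℝ → Vec3) (R : ℝ → Mat3) (q : ℕ) (S : Set ℝ)
    (Rh : ℝ → Mat3) (y : ℝ → Vec3) : Prop where
  ordConnected : S.OrdConnected
  nonneg : ∀ t ∈ S, 0 ≤ t
  mem_SO3 : ∀ t ∈ S, Rh t ∈ SO3
  ac_Rh : ∀ s ∈ S, ∀ t ∈ S, MatAC Rh s t
  ac_y : ∀ s ∈ S, ∀ t ∈ S, ∀ m, AbsolutelyContinuousOnInterval (fun r => y r m) s t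
  flow : ∀ t ∈ interior S, (R t * (Rh t)ᵀ, q) ∈ P.flowSet
  ode_Rh : ∀ᵐ t, t ∈ S → HasMatDeriv Rh
    (Rh t * skew (ω t + y t + γP • ((Rh t)ᵀ *ᵥ P.innov (R t * (Rh t)ᵀ) q))) t
  ode_y : ∀ᵐ t, t ∈ S → ∀ m, HasDerivAt (fun r => y r m)
    ((γI • ((Rh t)ᵀ *ᵥ P.innov (R t * (Rh t)ᵀ) q)) m) t

theorem Design.Admissible.continuousAt_innov {P : Design} (h : P.Admissible) {X : Mat3} {q : ℕ}
    (hf : (X, q) ∈ P.flowSet) : ContinuousAt (fun Y : Mat3 => P.innov Y q) X := by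
  refine continuousAt_pi.2 fun i => ?_
  have := (h.contDiffAt_innov (E := Fin 3 → Fin 3 → ℝ) (M := fun Y => Matrix.of Y) (z := X) hf
    (fun i j => (contDiff_apply_apply ℝ ℝ i j).contDiffAt) i).continuousAt
  exact this

theorem mulVec_transpose_mulVec {X : Mat3} (hX : X ∈ SO3) (v : Vec3) : X *ᵥ (Xᵀ *ᵥ v) = v := by
  rw [Matrix.mulVec_mulVec, SO3.mul_transpose hX, Matrix.one_mulVec]

/-- The derivative of the attitude error. -/
theorem hasMatDeriv_error {R Rh : ℝ → Mat3} {w v : Vec3} {t : ℝ}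
    (hR : HasMatDeriv R (R t * skew w) t) (hRh : HasMatDeriv Rh (Rh t * skew v) t)
    (hmem : Rh t ∈ SO3) :
    HasMatDeriv (fun s => R s * (Rh s)ᵀ) (R t * (Rh t)ᵀ * skew (Rh t *ᵥ (w - v))) t := by
  have h := hR.mul hRh.transpose
  have e : R t * (Rh t)ᵀ * skew (Rh t *ᵥ (w - v)) =
      R t * skew w * (Rh t)ᵀ + R t * (Rh t * skew v)ᵀ := by
    rw [← SO3.mul_skew_mul_transpose hmem, Matrix.transpose_mul, skew_transpose]
    have h1 := SO3.transpose_mul hmem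
    have h2 : skew (w - v) = skew w - skew v := by rw [sub_eq_add_neg, skew_add, skew_neg]; abel
    generalize Rh t = Q at *
    calc R t * Qᵀ * (Q * skew (w - v) * Qᵀ) = R t * (Qᵀ * Q) * skew (w - v) * Qᵀ := by
          simp only [mul_assoc]
      _ = _ := by rw [h1, mul_one, h2]; simp only [mul_sub, sub_mul, neg_mul, mul_neg, mul_assoc]; abel
  rw [e]
  exact h

namespace FlowOn

variable {P : Design} {γP γI : ℝ} {ω : ℝ → Vec3} {R : ℝ → Mat3} {q : ℕ} {S : Set ℝ}
  {Rh : ℝ → Mat3} {y : ℝ → Vec3}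

theorem ac_R (hR : IsAttitude ω R) {s t : ℝ} (hs : 0 ≤ s) (ht : 0 ≤ t) : MatAC R s t := by
  intro i j
  rcases le_total s t with h | h
  · exact hR.2.1 s t hs h i j
  · exact (hR.2.1 t s ht h i j).symm

theorem ac_error (hF : FlowOn P γP γI ω R q S Rh y) (hR : IsAttitude ω R) {s t : ℝ} (hs : s ∈ S)
    (ht : t ∈ S) : MatAC (fun r => R r * (Rh r)ᵀ) s t :=
  (ac_R hR (hF.nonneg s hs) (hF.nonneg t ht)).mul (hF.ac_Rh s hs t ht).transpose

theorem error_mem_SO3 (hF : FlowOn P γP γI ω R q S Rh y) (hR : IsAttitude ω R) {t : ℝ}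
    (ht : t ∈ S) : R t * (Rh t)ᵀ ∈ SO3 :=
  mul_mem (hR.1 t (hF.nonneg t ht)) (SO3.transpose_mem (hF.mem_SO3 t ht))

theorem continuousOn_y (hF : FlowOn P γP γI ω R q S Rh y) {s t : ℝ} (hs : s ∈ S) (ht : t ∈ S) :
    ContinuousOn y (uIcc s t) :=
  continuousOn_pi.2 fun i => (hF.ac_y s hs t ht i).continuousOn

theorem exists_Icc_subset {S : Set ℝ} {t : ℝ} (ht : t ∈ interior S) :
    ∃ a b, t ∈ Ioo a b ∧ Icc a b ⊆ interior S := by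
  obtain ⟨a, b, hab, hsub⟩ := mem_nhds_iff_exists_Ioo_subset.1 (isOpen_interior.mem_nhds ht)
  refine ⟨(a + t) / 2, (t + b) / 2, ⟨by linarith [hab.1], by linarith [hab.2]⟩, fun x hx => hsub ?_⟩
  exact ⟨by linarith [hx.1, hab.1], by linarith [hx.2, hab.2]⟩

theorem continuousOn_innov (hF : FlowOn P γP γI ω R q S Rh y) (h : P.Admissible)
    (hR : IsAttitude ω R) {a b : ℝ} (hab : a ≤ b) (hsub : Icc a b ⊆ interior S) :
    ContinuousOn (fun t => P.innov (R t * (Rh t)ᵀ) q) (Icc a b) := by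
  have ha := interior_subset (hsub (left_mem_Icc.2 hab))
  have hb := interior_subset (hsub (right_mem_Icc.2 hab))
  have hX := (hF.ac_error hR ha hb).continuousOn
  rw [uIcc_of_le hab] at hX
  intro t ht
  exact ContinuousAt.comp_continuousWithinAt (g := fun Y : Mat3 => P.innov Y q)
    (h.continuousAt_innov (hF.flow t (hsub ht))) (hX t ht)

/-- On the interior of an interval of flow, the error system is satisfied everywhere. -/
theorem hasMatDeriv_error (hF : FlowOn P γP γI ω R q S Rh y) (h : P.Admissible)
    (hR : IsAttitude ω R) {t : ℝ} (ht : t ∈ interior S) :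
    HasMatDeriv (fun s => R s * (Rh s)ᵀ) (R t * (Rh t)ᵀ *
      skew (-(Rh t *ᵥ y t) - γP • P.innov (R t * (Rh t)ᵀ) q)) t := by
  obtain ⟨a, b, hab, hsub⟩ := exists_Icc_subset ht
  have hle : a ≤ b := (hab.1.trans hab.2).le
  have ha := interior_subset (hsub (left_mem_Icc.2 hle))
  have hb := interior_subset (hsub (right_mem_Icc.2 hle))
  have hX := (hF.ac_error hR ha hb).continuousOn
  have hRh := (hF.ac_Rh a ha b hb).continuousOn
  have hy := hF.continuousOn_y ha hb
  have hi := hF.continuousOn_innov h hR hle hsub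
  rw [uIcc_of_le hle] at hX hRh hy
  have hΩ : ContinuousOn (fun t => -(Rh t *ᵥ y t) - γP • P.innov (R t * (Rh t)ᵀ) q) (Icc a b) := by
    refine ContinuousOn.sub (ContinuousOn.neg ?_) (hi.const_smul γP)
    exact (Continuous.matrix_mulVec continuous_fst continuous_snd :
      Continuous fun p : Mat3 × Vec3 => p.1 *ᵥ p.2).comp_continuousOn (hRh.prodMk hy)
  have hsk : Continuous skew := by
    refine continuous_pi fun i => continuous_pi fun j => ?_
    fin_cases i <;> fin_cases j <;> simp [skew_apply] <;> fun_prop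
  have hF' := (Continuous.matrix_mul continuous_fst continuous_snd :
      Continuous fun p : Mat3 × Mat3 => p.1 * p.2).comp_continuousOn
        (hX.prodMk (hsk.comp_continuousOn hΩ))
  intro i j
  refine ac_hasDerivAt_of_continuousOn (hF.ac_error hR ha hb i j)
    (F := fun t => (R t * (Rh t)ᵀ * skew (-(Rh t *ᵥ y t) - γP • P.innov (R t * (Rh t)ᵀ) q)) i j)
    ((continuous_id.matrix_elem i j).comp_continuousOn hF') ?_ hab
  filter_upwards [hR.2.2, hF.ode_Rh] with s h1 h2 hs
  have hsS := interior_subset (hsub hs)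
  have hmem := hF.mem_SO3 s hsS
  have := HybridObserver.hasMatDeriv_error (h1 (hF.nonneg s hsS)) (h2 hsS) hmem i j
  convert this using 4
  -- The angular velocity cancels. The remaining right-hand side is continuous in time, although
  -- $\omega$ need not be.
  rw [sub_add_eq_sub_sub, sub_add_eq_sub_sub, sub_self, zero_sub, Matrix.mulVec_sub,
    Matrix.mulVec_neg, Matrix.mulVec_smul, mulVec_transpose_mulVec hmem]

theorem hasDerivAt_y (hF : FlowOn P γP γI ω R q S Rh y) (h : P.Admissible)
    (hR : IsAttitude ω R) {t : ℝ} (ht : t ∈ interior S) (m : Fin 3) :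
    HasDerivAt (fun s => y s m) ((γI • ((Rh t)ᵀ *ᵥ P.innov (R t * (Rh t)ᵀ) q)) m) t := by
  obtain ⟨a, b, hab, hsub⟩ := exists_Icc_subset ht
  have hle : a ≤ b := (hab.1.trans hab.2).le
  have ha := interior_subset (hsub (left_mem_Icc.2 hle))
  have hb := interior_subset (hsub (right_mem_Icc.2 hle))
  have hRh := (hF.ac_Rh a ha b hb).continuousOn
  have hi := hF.continuousOn_innov h hR hle hsub
  rw [uIcc_of_le hle] at hRh
  have hβ : ContinuousOn (fun t => γI • ((Rh t)ᵀ *ᵥ P.innov (R t * (Rh t)ᵀ) q)) (Icc a b) := by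
    refine ContinuousOn.const_smul ?_ γI
    exact (Continuous.matrix_mulVec continuous_fst.matrix_transpose continuous_snd :
      Continuous fun p : Mat3 × Vec3 => p.1ᵀ *ᵥ p.2).comp_continuousOn (hRh.prodMk hi)
  refine ac_hasDerivAt_of_continuousOn (hF.ac_y a ha b hb m)
    (F := fun t => (γI • ((Rh t)ᵀ *ᵥ P.innov (R t * (Rh t)ᵀ) q)) m)
    ((continuous_apply m).comp_continuousOn hβ) ?_ hab
  filter_upwards [hF.ode_y] with s h1 hs
  exact h1 (interior_subset (hsub hs)) m

end FlowOn

/-! ### The Lyapunov function -/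

/-- The Lyapunov function `Φ + ‖b̃‖² / γ_I`. -/
noncomputable def lyap (P : Design) (γI : ℝ) (X : Mat3) (q : ℕ) (y : Vec3) : ℝ :=
  P.Φ X q + (y ⬝ᵥ y) / γI

theorem Design.Admissible.lyap_bounds {P : Design} (h : P.Admissible) {γI : ℝ}
    {X : Mat3} (hX : X ∈ SO3) {q : ℕ} (hq : q ∈ P.Q) (y : Vec3) :
    xi P.A / 12 * rotNorm X ^ 2 + vnorm y ^ 2 / γI ≤ lyap P γI X q y ∧
      lyap P γI X q y ≤ 6 * rotNorm X ^ 2 + vnorm y ^ 2 / γI := by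
  obtain ⟨h1, h2⟩ := h.Φ_bounds hX hq
  rw [lyap, vnorm_sq]
  constructor <;> linarith

namespace FlowOn

variable {P : Design} {γP γI : ℝ} {ω : ℝ → Vec3} {R : ℝ → Mat3} {q : ℕ} {S : Set ℝ}
  {Rh : ℝ → Mat3} {y : ℝ → Vec3}

/-- The weight $1/\gamma_I$ is chosen so that the terms $g\cdot\hat R\tilde b_\omega$ from the
potential and from the bias cancel. -/
theorem hasDerivAt_lyap (hF : FlowOn P γP γI ω R q S Rh y) (h : P.Admissible) (hγI : 0 < γI)
    (hR : IsAttitude ω R) {t : ℝ} (ht : t ∈ interior S) :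
    HasDerivAt (fun s => lyap P γI (R s * (Rh s)ᵀ) q (y s))
      (-2 * γP * (P.innov (R t * (Rh t)ᵀ) q ⬝ᵥ P.innov (R t * (Rh t)ᵀ) q)) t := by
  have h1 := h.hasDerivAt_Φ (X := fun s => R s * (Rh s)ᵀ) (hF.flow t ht)
    (hF.hasMatDeriv_error h hR ht)
  have h2 := hasDerivAt_dotProduct (hF.hasDerivAt_y h hR ht) (hF.hasDerivAt_y h hR ht)
  refine (h1.add (h2.div_const γI)).congr_deriv ?_
  generalize P.innov (R t * (Rh t)ᵀ) q = g
  have e : ((Rh t)ᵀ *ᵥ g) ⬝ᵥ y t = g ⬝ᵥ (Rh t *ᵥ y t) := by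
    rw [Matrix.dotProduct_mulVec, Matrix.mulVec_transpose]
  simp only [dotProduct_sub, dotProduct_neg, smul_dotProduct, dotProduct_smul, smul_eq_mul,
    dotProduct_comm (y t), e]
  field_simp
  ring

theorem continuousOn_lyap (hF : FlowOn P γP γI ω R q S Rh y) (hR : IsAttitude ω R) {s t : ℝ}
    (hs : s ∈ S) (ht : t ∈ S) :
    ContinuousOn (fun r => lyap P γI (R r * (Rh r)ᵀ) q (y r)) (uIcc s t) := by
  have hy := hF.continuousOn_y hs ht
  refine ((P.continuous_Φ q).comp_continuousOn (hF.ac_error hR hs ht).continuousOn).add ?_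
  exact ((Continuous.dotProduct continuous_id continuous_id).comp_continuousOn hy).div_const _

theorem Ioo_subset_interior (hF : FlowOn P γP γI ω R q S Rh y) {s t : ℝ} (hs : s ∈ S)
    (ht : t ∈ S) : Ioo s t ⊆ interior S :=
  interior_maximal (Ioo_subset_Icc_self.trans (hF.ordConnected.out hs ht)) isOpen_Ioo

theorem lyap_le (hF : FlowOn P γP γI ω R q S Rh y) (h : P.Admissible) (hγP : 0 < γP)
    (hγI : 0 < γI) (hR : IsAttitude ω R) {s t : ℝ} (hs : s ∈ S) (ht : t ∈ S) (hst : s ≤ t) :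
    lyap P γI (R t * (Rh t)ᵀ) q (y t) ≤ lyap P γI (R s * (Rh s)ᵀ) q (y s) := by
  have hc := hF.continuousOn_lyap (γI := γI) hR hs ht
  rw [uIcc_of_le hst] at hc
  have hd (r : ℝ) (hr : r ∈ interior (Icc s t)) := hF.hasDerivAt_lyap h hγI hR
    (hF.Ioo_subset_interior hs ht (by rwa [interior_Icc] at hr))
  refine antitoneOn_of_deriv_nonpos (convex_Icc s t) hc
    (fun r hr => (hd r hr).differentiableAt.differentiableWithinAt) (fun r hr => ?_)
    (left_mem_Icc.2 hst) (right_mem_Icc.2 hst) hst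
  rw [(hd r hr).deriv]
  have := dotProduct_self_nonneg' (P.innov (R r * (Rh r)ᵀ) q)
  nlinarith [mul_nonneg hγP.le this]

theorem ac_lyap (hF : FlowOn P γP γI ω R q S Rh y) (h : P.Admissible)
    (hγI : 0 < γI) (hR : IsAttitude ω R) {s t : ℝ} (hs : s ∈ S) (ht : t ∈ S) (hst : s < t) :
    AbsolutelyContinuousOnInterval (fun r => lyap P γI (R r * (Rh r)ᵀ) q (y r)) s t := by
  have hc := hF.continuousOn_lyap (γI := γI) hR hs ht
  rw [uIcc_of_le hst.le] at hc
  obtain ⟨c, C, -, hC, hb⟩ := h.exists_innov_bounds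
  have hi (r : ℝ) (hr : r ∈ Ioo s t) := hF.Ioo_subset_interior hs ht hr
  refine ac_of_deriv_bounded hst hc (fun r hr => hF.hasDerivAt_lyap h hγI hR (hi r hr))
    (M := 2 * |γP| * C ^ 2) fun r hr => ?_
  have hf := hF.flow r (hi r hr)
  have h1 := (hb _ _ hf).2
  have h2 := (quad_quatMat_bounds h.bounds hf.1).2.2
  have h3 : vnorm (P.innov (R r * (Rh r)ᵀ) q) ≤ C :=
    h1.trans (mul_le_of_le_one_right hC.le
      ((sq_le_one_iff₀ (Real.sqrt_nonneg _)).1 h2))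
  rw [← vnorm_sq, abs_mul, abs_mul, abs_of_nonneg (sq_nonneg (vnorm _))]
  norm_num
  gcongr
  exact vnorm_nonneg _

end FlowOn

/-! ### The cross term -/

theorem psi_mul_skew (M : Mat3) (w : Vec3) :
    psi (M * skew w) = (1 / 2 : ℝ) • (M.trace • w - Mᵀ *ᵥ w) := by
  ext i
  fin_cases i <;>
    simp [psi, Matrix.mul_apply, Fin.sum_univ_three, skew_apply, Matrix.trace, mulVec_three] <;> ring

theorem rotNorm_nonneg (X : Mat3) : 0 ≤ rotNorm X := Real.sqrt_nonneg _

theorem rotNorm_sq_le_one {X : Mat3} (hX : X ∈ SO3) : rotNorm X ^ 2 ≤ 1 :=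
  (quad_quatMat_bounds barBounds_one hX).2.2

theorem trace_eq_rotNorm {X : Mat3} (hX : X ∈ SO3) : X.trace = 3 - 4 * rotNorm X ^ 2 := by
  obtain ⟨η, e, hu, rfl⟩ := SO3.exists_quat hX
  rw [rotNorm_sq_quatMat hu, quatMat]
  simp only [dotProduct_three] at *
  simp [Matrix.trace, Fin.sum_univ_three, Matrix.vecMulVec_apply, skew_apply]
  linarith

theorem transpose_mulVec_dotProduct_ge {X : Mat3} (hX : X ∈ SO3) (v : Vec3) :
    (1 - 2 * rotNorm X ^ 2) * vnorm v ^ 2 ≤ (Xᵀ *ᵥ v) ⬝ᵥ v := by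
  obtain ⟨η, e, hu, rfl⟩ := SO3.exists_quat hX
  rw [rotNorm_sq_quatMat hu, vnorm_sq, quatMat_transpose, quatMat]
  have e1 : (((η ^ 2 - (-e) ⬝ᵥ (-e)) • (1 : Mat3) + (2 : ℝ) • Matrix.vecMulVec (-e) (-e) +
      (2 * η) • skew (-e)) *ᵥ v) ⬝ᵥ v = (η ^ 2 - e ⬝ᵥ e) * (v ⬝ᵥ v) + 2 * (e ⬝ᵥ v) ^ 2 := by
    simp only [dotProduct_three, mulVec_three, Matrix.add_apply, Matrix.smul_apply,
      Matrix.vecMulVec_apply, skew_apply, Matrix.one_apply]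
    simp
    ring
  rw [e1]
  have h : η ^ 2 - e ⬝ᵥ e = 1 - 2 * (e ⬝ᵥ e) := by linarith
  rw [h]
  nlinarith [sq_nonneg (e ⬝ᵥ v)]

theorem vnorm_psi_le {X : Mat3} (hX : X ∈ SO3) : vnorm (psi X) ≤ 2 * rotNorm X := by
  have h := (vnorm_psi_bounds barBounds_one hX).1
  rw [one_mul, eigMax_bar_one, ← vnorm_sq] at h
  apply le_of_sq_le_sq _ (by have := rotNorm_nonneg X; positivity)
  linarith

theorem dotProduct_le_of_vnorm_le {u v : Vec3} {a b : ℝ} (hu : vnorm u ≤ a) (hv : vnorm v ≤ b) :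
    u ⬝ᵥ v ≤ a * b :=
  (le_abs_self _).trans ((abs_dotProduct_le u v).trans
    (mul_le_mul hu hv (vnorm_nonneg v) ((vnorm_nonneg u).trans hu)))

/-- The derivative of the cross term is negative definite in the bias error. -/
theorem cross_deriv_le {X : Mat3} (hX : X ∈ SO3) {γP γI C c Y : ℝ} (hγP : 0 < γP) (hγI : 0 < γI)
    (hC : 0 < C) {u v g : Vec3} (hv : vnorm v ≤ Y) (hu : vnorm u ≤ c * vnorm v)
    (hg : vnorm g ≤ C * rotNorm X) :
    psi (X * skew (-(Xᵀ *ᵥ v) - γP • g)) ⬝ᵥ v + psi X ⬝ᵥ (u + γI • (X *ᵥ g)) ≤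
      -(1 / 2) * vnorm v ^ 2 + (5 * Y ^ 2 + 2 * (γP * C + c) ^ 2 + 2 * γI * C) * rotNorm X ^ 2 := by
  have hXt := SO3.transpose_mem hX
  have h1 := transpose_mulVec_dotProduct_ge hX v
  have hN := rotNorm_sq_le_one hX
  have ha := rotNorm_nonneg X
  have hv0 := vnorm_nonneg v
  have hp := vnorm_psi_le hX
  have h2 : (Xᵀ *ᵥ v) ⬝ᵥ v ≤ vnorm v * vnorm v :=
    dotProduct_le_of_vnorm_le (SO3.vnorm_mulVec hXt v).le le_rfl
  have h3 : (Xᵀ *ᵥ (Xᵀ *ᵥ v)) ⬝ᵥ v ≤ vnorm v * vnorm v :=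
    dotProduct_le_of_vnorm_le (by rw [SO3.vnorm_mulVec hXt, SO3.vnorm_mulVec hXt]) le_rfl
  have h4 := abs_le.1 ((abs_dotProduct_le g v).trans
    (mul_le_mul_of_nonneg_right hg hv0))
  have h5 : (Xᵀ *ᵥ g) ⬝ᵥ v ≤ C * rotNorm X * vnorm v :=
    dotProduct_le_of_vnorm_le (by rwa [SO3.vnorm_mulVec hXt]) le_rfl
  have h6 : psi X ⬝ᵥ u ≤ 2 * rotNorm X * (c * vnorm v) := dotProduct_le_of_vnorm_le hp hu
  have h7 : psi X ⬝ᵥ (X *ᵥ g) ≤ 2 * rotNorm X * (C * rotNorm X) :=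
    dotProduct_le_of_vnorm_le hp (by rwa [SO3.vnorm_mulVec hX])
  have e : psi (X * skew (-(Xᵀ *ᵥ v) - γP • g)) ⬝ᵥ v =
      -(1 / 2) * ((3 - 4 * rotNorm X ^ 2) * ((Xᵀ *ᵥ v) ⬝ᵥ v) - (Xᵀ *ᵥ (Xᵀ *ᵥ v)) ⬝ᵥ v) -
        γP / 2 * ((3 - 4 * rotNorm X ^ 2) * (g ⬝ᵥ v) - (Xᵀ *ᵥ g) ⬝ᵥ v) := by
    rw [psi_mul_skew, trace_eq_rotNorm hX, Matrix.mulVec_sub, Matrix.mulVec_neg,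
      Matrix.mulVec_smul]
    simp only [smul_dotProduct, sub_dotProduct, neg_dotProduct, smul_eq_mul]
    ring
  rw [e, dotProduct_add, dotProduct_smul, smul_eq_mul]
  clear e
  generalize (Xᵀ *ᵥ v) ⬝ᵥ v = p1 at *
  generalize (Xᵀ *ᵥ (Xᵀ *ᵥ v)) ⬝ᵥ v = p2 at *
  generalize g ⬝ᵥ v = p3 at *
  generalize (Xᵀ *ᵥ g) ⬝ᵥ v = p4 at *
  generalize psi X ⬝ᵥ u = p5 at *
  generalize psi X ⬝ᵥ (X *ᵥ g) = p6 at *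
  generalize rotNorm X = a at *
  generalize vnorm v = n at *
  -- The main term: $3p_1-p_2$ is at least $2n^2$ up to a multiple of $a^2n^2$. The factor $3-4a^2$
  -- may be negative, as $a\le1$ is all that is known, which is why the sign is split.
  have k1 : -(1 / 2) * ((3 - 4 * a ^ 2) * p1 - p2) ≤ -n ^ 2 + 5 * a ^ 2 * n ^ 2 := by
    have : (3 - 10 * a ^ 2) * n ^ 2 ≤ (3 - 4 * a ^ 2) * p1 := by
      rcases le_total 0 (3 - 4 * a ^ 2) with h | h
      · nlinarith [mul_le_mul_of_nonneg_left h1 h, mul_nonneg (mul_nonneg (sq_nonneg a) (sq_nonneg a)) (sq_nonneg n)]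
      · nlinarith [mul_le_mul_of_nonpos_left h2 h, mul_nonneg (sq_nonneg a) (sq_nonneg n)]
    nlinarith
  have k2 : -(γP / 2) * ((3 - 4 * a ^ 2) * p3 - p4) ≤ 2 * γP * C * a * n := by
    have hb : 0 ≤ C * a * n := by positivity
    have : -((3 - 4 * a ^ 2) * p3) ≤ 3 * (C * a * n) := by
      rcases le_total 0 (3 - 4 * a ^ 2) with h | h
      · nlinarith [mul_le_mul_of_nonneg_left h4.1 h, mul_nonneg (sq_nonneg a) hb]
      · nlinarith [mul_le_mul_of_nonpos_left h4.2 h]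
    have : -((3 - 4 * a ^ 2) * p3 - p4) ≤ 4 * (C * a * n) := by linarith
    nlinarith [mul_le_mul_of_nonneg_left this hγP.le]
  have k3 : γI * p6 ≤ γI * (2 * a * (C * a)) := mul_le_mul_of_nonneg_left h7 hγI.le
  have k4 : n ^ 2 ≤ Y ^ 2 := pow_le_pow_left₀ hv0 hv 2
  have k5 : 5 * a ^ 2 * n ^ 2 ≤ 5 * a ^ 2 * Y ^ 2 := by gcongr
  -- Completing the square absorbs the mixed term $2(\gamma_PC+c)an$ into $\tfrac12n^2$, half of the
  -- available decay.
  nlinarith [sq_nonneg (n - 2 * (γP * C + c) * a)]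

theorem abs_cross_le {X : Mat3} (hX : X ∈ SO3) (v : Vec3) :
    |psi X ⬝ᵥ v| ≤ rotNorm X ^ 2 + vnorm v ^ 2 := by
  have h1 := abs_dotProduct_le (psi X) v
  have h2 := mul_le_mul_of_nonneg_right (vnorm_psi_le hX) (vnorm_nonneg v)
  nlinarith [sq_nonneg (rotNorm X - vnorm v)]

namespace FlowOn

variable {P : Design} {γP γI : ℝ} {ω : ℝ → Vec3} {R : ℝ → Mat3} {q : ℕ} {S : Set ℝ}
  {Rh : ℝ → Mat3} {y : ℝ → Vec3}

theorem ac_cross (hF : FlowOn P γP γI ω R q S Rh y) (hR : IsAttitude ω R) {s t : ℝ} (hs : s ∈ S)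
    (ht : t ∈ S) :
    AbsolutelyContinuousOnInterval (fun r => psi (R r * (Rh r)ᵀ) ⬝ᵥ (R r *ᵥ y r)) s t :=
  ac_dotProduct (MatAC.psi (hF.ac_error hR hs ht))
    ((ac_R hR (hF.nonneg s hs) (hF.nonneg t ht)).mulVec (hF.ac_y s hs t ht))

/-- The cross term involves $R$ itself, so $\omega$ enters through $R[\omega]_\times\tilde b_\omega$
and the derivative exists only where $\dot R$ does. This is where boundedness of $\omega$ matters
for the decay. -/
theorem hasDerivAt_cross (hF : FlowOn P γP γI ω R q S Rh y) (h : P.Admissible)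
    (hR : IsAttitude ω R) {t : ℝ} (ht : t ∈ interior S)
    (hRt : HasMatDeriv R (R t * skew (ω t)) t) :
    HasDerivAt (fun r => psi (R r * (Rh r)ᵀ) ⬝ᵥ (R r *ᵥ y r))
      (psi (R t * (Rh t)ᵀ * skew (-((R t * (Rh t)ᵀ)ᵀ *ᵥ (R t *ᵥ y t)) -
          γP • P.innov (R t * (Rh t)ᵀ) q)) ⬝ᵥ (R t *ᵥ y t) +
        psi (R t * (Rh t)ᵀ) ⬝ᵥ (R t *ᵥ (skew (ω t) *ᵥ y t) +
          γI • ((R t * (Rh t)ᵀ) *ᵥ P.innov (R t * (Rh t)ᵀ) q))) t := by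
  have h1 := hF.hasMatDeriv_error h hR ht
  have h2 := hRt.mulVec (hF.hasDerivAt_y h hR ht)
  have h3 := hasDerivAt_dotProduct h1.psi h2
  refine h3.congr_deriv ?_
  have htS := interior_subset ht
  have e : (R t * (Rh t)ᵀ)ᵀ *ᵥ (R t *ᵥ y t) = Rh t *ᵥ y t := by
    rw [Matrix.transpose_mul, Matrix.transpose_transpose, Matrix.mulVec_mulVec, mul_assoc,
      SO3.transpose_mul (hR.1 t (hF.nonneg t htS)), mul_one]
  rw [e]
  simp only [Matrix.mulVec_mulVec, Matrix.mulVec_smul]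

/-- The Lyapunov function with the cross term decays exponentially along flows. -/
theorem cross_decay (hF : FlowOn P γP γI ω R q S Rh y) (h : P.Admissible)
    (hR : IsAttitude ω R) {ε rate : ℝ} {s t : ℝ} (hs : s ∈ S) (ht : t ∈ S) (hst : s ≤ t)
    (hγI : 0 < γI)
    (hd : ∀ r ∈ Ioo s t,
      -2 * γP * (P.innov (R r * (Rh r)ᵀ) q ⬝ᵥ P.innov (R r * (Rh r)ᵀ) q) +
      ε * (psi (R r * (Rh r)ᵀ * skew (-((R r * (Rh r)ᵀ)ᵀ *ᵥ (R r *ᵥ y r)) -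
          γP • P.innov (R r * (Rh r)ᵀ) q)) ⬝ᵥ (R r *ᵥ y r) +
        psi (R r * (Rh r)ᵀ) ⬝ᵥ (R r *ᵥ (skew (ω r) *ᵥ y r) +
          γI • ((R r * (Rh r)ᵀ) *ᵥ P.innov (R r * (Rh r)ᵀ) q))) ≤
      -rate * (lyap P γI (R r * (Rh r)ᵀ) q (y r) +
        ε * (psi (R r * (Rh r)ᵀ) ⬝ᵥ (R r *ᵥ y r)))) :
    Real.exp (rate * t) * (lyap P γI (R t * (Rh t)ᵀ) q (y t) +
        ε * (psi (R t * (Rh t)ᵀ) ⬝ᵥ (R t *ᵥ y t))) ≤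
      Real.exp (rate * s) * (lyap P γI (R s * (Rh s)ᵀ) q (y s) +
        ε * (psi (R s * (Rh s)ᵀ) ⬝ᵥ (R s *ᵥ y s))) := by
  rcases hst.eq_or_lt with rfl | hlt
  · rfl
  have hL := (hF.ac_lyap h hγI hR hs ht hlt).fun_add ((hF.ac_cross hR hs ht).const_mul ε)
  have hexp : AbsolutelyContinuousOnInterval (fun r => Real.exp (rate * r)) s t := by
    refine ac_of_deriv_bounded hlt (by fun_prop) (f' := fun r => Real.exp (rate * r) * rate)
      (M := Real.exp (|rate| * (|s| + |t|)) * |rate|)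
      (fun r _ => ?_) fun r hr => ?_
    · simpa using ((hasDerivAt_id r).const_mul rate).exp
    · rw [abs_mul, Real.abs_exp]
      refine mul_le_mul_of_nonneg_right (Real.exp_le_exp.2 ?_) (abs_nonneg _)
      refine (le_abs_self _).trans ?_
      rw [abs_mul]
      refine mul_le_mul_of_nonneg_left ?_ (abs_nonneg _)
      refine abs_le.2 ⟨?_, ?_⟩
      · linarith [hr.1, neg_abs_le s, abs_nonneg t]
      · linarith [hr.2, le_abs_self t, abs_nonneg s]
  refine ac_le_of_deriv_nonpos hst (hexp.fun_mul hL) ?_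
  filter_upwards [hR.2.2] with r h1 hr
  have hri := hF.Ioo_subset_interior hs ht hr
  have h2 := hF.hasDerivAt_lyap h hγI hR hri
  have h3 := hF.hasDerivAt_cross h hR hri (h1 (hF.nonneg r (interior_subset hri)))
  have h4 : HasDerivAt (fun r => Real.exp (rate * r)) (Real.exp (rate * r) * rate) r := by
    simpa using ((hasDerivAt_id r).const_mul rate).exp
  refine ⟨_, ?_, h4.fun_mul (h2.fun_add (h3.const_mul ε))⟩
  have h5 := hd r hr
  nlinarith [mul_le_mul_of_nonneg_left h5 (Real.exp_pos (rate * r)).le]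

end FlowOn

/-- Uniform constants for the Lyapunov function with the cross term. -/
theorem Design.Admissible.exists_cross_bounds {P : Design} (h : P.Admissible) {γP γI : ℝ}
    (hγP : 0 < γP) (hγI : 0 < γI) : ∃ c₁ c₂ : ℝ, 0 < c₁ ∧ 0 < c₂ ∧ ∀ c Y : ℝ, ∃ ε rate : ℝ,
      0 < rate ∧
      (∀ X ∈ SO3, ∀ q ∈ P.Q, ∀ v y : Vec3, vnorm v = vnorm y →
        c₁ * (rotNorm X ^ 2 + vnorm y ^ 2) ≤ lyap P γI X q y + ε * (psi X ⬝ᵥ v) ∧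
        lyap P γI X q y + ε * (psi X ⬝ᵥ v) ≤ c₂ * (rotNorm X ^ 2 + vnorm y ^ 2)) ∧
      ∀ X q, (X, q) ∈ P.flowSet → ∀ u v y : Vec3, vnorm v = vnorm y → vnorm v ≤ Y →
        vnorm u ≤ c * vnorm v →
        -2 * γP * (P.innov X q ⬝ᵥ P.innov X q) +
          ε * (psi (X * skew (-(Xᵀ *ᵥ v) - γP • P.innov X q)) ⬝ᵥ v +
            psi X ⬝ᵥ (u + γI • (X *ᵥ P.innov X q))) ≤
        -rate * (lyap P γI X q y + ε * (psi X ⬝ᵥ v)) := by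
  obtain ⟨c, C, hc, hC, hb⟩ := h.exists_innov_bounds
  have hξ := h.bounds.xi_pos
  -- The Lyapunov function is at least $2\varepsilon_0\|e\|^2$; a cross term of weight at most
  -- $\varepsilon_0$ costs at most half of that.
  set ε₀ := 1 / 2 * min (xi P.A / 12) (1 / γI) with hε₀
  have hε₀pos : 0 < ε₀ := by positivity
  have hle1 : 2 * ε₀ ≤ xi P.A / 12 := by
    have := min_le_left (xi P.A / 12) (1 / γI); linarith
  have hle2 : 2 * ε₀ ≤ 1 / γI := by
    have := min_le_right (xi P.A / 12) (1 / γI); linarith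
  have hγ : 0 < 1 / γI := by positivity
  set c₂ := 6 + 1 / γI + ε₀ with hc₂
  have hc₂pos : 0 < c₂ := by positivity
  -- Both comparison constants are fixed before the bounds `w` on $\omega$ and `Y` on the bias
  -- error, so the final $K$ does not depend on them.
  refine ⟨ε₀, c₂, hε₀pos, hc₂pos, fun w Y => ?_⟩
  set D := 5 * Y ^ 2 + 2 * (γP * C + w) ^ 2 + 2 * γI * C with hD
  have hD0 : 0 < D := by positivity
  -- With $\varepsilon D\le\gamma_Pc$, the cross term uses up at most half of the decay
  -- $2\gamma_Pc\,|\tilde R|_I^2$ of the Lyapunov function.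
  set ε := min ε₀ (γP * c / D) with hε
  have hεpos : 0 < ε := by positivity
  have hεle : ε ≤ ε₀ := min_le_left _ _
  have hεD : ε * D ≤ γP * c := by
    rw [← le_div_iff₀ hD0]; exact min_le_right _ _
  set μ := min (γP * c) (ε / 2) with hμ
  have hμpos : 0 < μ := by positivity
  have hbd (X) (hX : X ∈ SO3) (q) (hq : q ∈ P.Q) (v y : Vec3) (hvy : vnorm v = vnorm y) :
      ε₀ * (rotNorm X ^ 2 + vnorm y ^ 2) ≤ lyap P γI X q y + ε * (psi X ⬝ᵥ v) ∧
        lyap P γI X q y + ε * (psi X ⬝ᵥ v) ≤ c₂ * (rotNorm X ^ 2 + vnorm y ^ 2) := by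
    obtain ⟨h1, h2⟩ := h.lyap_bounds (γI := γI) hX hq y
    have h3 := abs_le.1 (abs_cross_le hX v)
    rw [hvy] at h3
    have hN : 0 ≤ rotNorm X ^ 2 := sq_nonneg _
    have hy : 0 ≤ vnorm y ^ 2 := sq_nonneg _
    rw [div_eq_mul_one_div (vnorm y ^ 2)] at h1 h2
    have h4 : ε * (rotNorm X ^ 2 + vnorm y ^ 2) ≤ ε₀ * (rotNorm X ^ 2 + vnorm y ^ 2) := by gcongr
    have h5 := mul_le_mul_of_nonneg_left h3.1 hεpos.le
    have h6 := mul_le_mul_of_nonneg_left h3.2 hεpos.le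
    have h7 := mul_le_mul_of_nonneg_right hle1 hN
    have h8 := mul_le_mul_of_nonneg_right hle2 hy
    have h9 := mul_nonneg hγ.le hN
    constructor
    · nlinarith
    · rw [hc₂]; nlinarith
  refine ⟨ε, μ / c₂, by positivity, hbd, fun X q hf u v y hvy hv hu => ?_⟩
  obtain ⟨h1, h2⟩ := hb X q hf
  have h3 := cross_deriv_le hf.1 hγP hγI hC hv hu h2
  have h4 := (hbd X hf.1 q hf.2.1 v y hvy).2
  have hN : 0 ≤ rotNorm X ^ 2 := sq_nonneg _
  have hy : 0 ≤ vnorm y ^ 2 := sq_nonneg _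
  rw [← hD, hvy] at h3
  have h5 := mul_le_mul_of_nonneg_left h3 hεpos.le
  have h6 := mul_le_mul_of_nonneg_left h1 hγP.le
  have h7 := mul_le_mul_of_nonneg_right hεD hN
  have h8 : μ * (rotNorm X ^ 2 + vnorm y ^ 2) ≤ γP * c * rotNorm X ^ 2 + ε / 2 * vnorm y ^ 2 := by
    have := mul_le_mul_of_nonneg_right (min_le_left (γP * c) (ε / 2)) hN
    have := mul_le_mul_of_nonneg_right (min_le_right (γP * c) (ε / 2)) hy
    rw [mul_add]; linarith
  have h9 : μ / c₂ * (lyap P γI X q y + ε * (psi X ⬝ᵥ v)) ≤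
      μ * (rotNorm X ^ 2 + vnorm y ^ 2) := by
    rw [div_mul_eq_mul_div, div_le_iff₀ hc₂pos]
    calc _ ≤ μ * (c₂ * (rotNorm X ^ 2 + vnorm y ^ 2)) := by gcongr
      _ = _ := by ring
  nlinarith

/-! ### Hybrid time domains -/

section Domain

variable {t₀ : ℝ} {E : Set (ℝ × ℕ)}

theorem IsHybridTimeDomain.ordConnected (hE : IsHybridTimeDomain t₀ E) (j : ℕ) :
    {t | (t, j) ∈ E}.OrdConnected := by
  obtain ⟨τ, -, -, rfl | ⟨N, I, hI, -, rfl⟩⟩ := hE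
  · exact ordConnected_Icc (a := τ j) (b := τ (j + 1))
  · rcases lt_trichotomy j N with h | rfl | h
    · convert ordConnected_Icc (a := τ j) (b := τ (j + 1)) using 1
      ext t; simp [h, h.ne]
    · convert hI using 1
      ext t; simp
    · convert ordConnected_empty (α := ℝ) using 1
      ext t; simp [h.not_gt, h.ne']

theorem IsHybridTimeDomain.le (hE : IsHybridTimeDomain t₀ E) {t : ℝ} {j : ℕ} (h : (t, j) ∈ E) :
    t₀ ≤ t := by
  obtain ⟨τ, hτ, rfl, rfl | ⟨N, I, -, hI, rfl⟩⟩ := hE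
  · exact (hτ (Nat.zero_le j)).trans h.1
  · rcases h with h | ⟨h1, h2⟩
    · exact (hτ (Nat.zero_le j)).trans h.2.1
    · exact (hτ (Nat.zero_le N)).trans (hI.2 h2)

theorem IsHybridTimeDomain.initial_mem (hE : IsHybridTimeDomain t₀ E) : (t₀, 0) ∈ E := by
  obtain ⟨τ, hτ, rfl, rfl | ⟨N, I, -, hI, rfl⟩⟩ := hE
  · exact ⟨le_rfl, hτ (Nat.zero_le _)⟩
  · rcases Nat.eq_zero_or_pos N with rfl | h
    · exact Or.inr ⟨rfl, hI.1⟩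
    · exact Or.inl ⟨h, le_rfl, hτ (Nat.zero_le _)⟩

theorem IsHybridTimeDomain.exists_jump (hE : IsHybridTimeDomain t₀ E) {t : ℝ} {j : ℕ}
    (h : (t, j + 1) ∈ E) : ∃ s ≤ t, (s, j) ∈ E ∧ (s, j + 1) ∈ E := by
  obtain ⟨τ, hτ, rfl, rfl | ⟨N, I, -, hI, rfl⟩⟩ := hE
  · exact ⟨τ (j + 1), h.1, ⟨hτ (Nat.le_succ _), le_rfl⟩, le_rfl, hτ (Nat.le_succ _)⟩
  · rcases h with h | ⟨h1, h2⟩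
    · exact ⟨τ (j + 1), h.2.1, Or.inl ⟨(Nat.lt_succ_self j).trans h.1, hτ (Nat.le_succ _), le_rfl⟩,
        Or.inl ⟨h.1, le_rfl, hτ (Nat.le_succ _)⟩⟩
    · subst h1
      exact ⟨τ (j + 1), hI.2 h2, Or.inl ⟨Nat.lt_succ_self j, hτ (Nat.le_succ _), le_rfl⟩,
        Or.inr ⟨rfl, hI.1⟩⟩

/-- Induction along a hybrid time domain. -/
theorem IsHybridTimeDomain.induction (hE : IsHybridTimeDomain t₀ E) {p : ℝ → ℕ → Prop}
    (h0 : p t₀ 0)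
    (hflow : ∀ j s t, (s, j) ∈ E → (t, j) ∈ E → s ≤ t → p s j → p t j)
    (hjump : ∀ j t, (t, j) ∈ E → (t, j + 1) ∈ E → p t j → p t (j + 1)) :
    ∀ j t, (t, j) ∈ E → p t j := by
  intro j
  induction j with
  | zero => exact fun t ht => hflow 0 t₀ t hE.initial_mem ht (hE.le ht) h0
  | succ j ih =>
    intro t ht
    obtain ⟨s, hst, h1, h2⟩ := hE.exists_jump ht
    exact hflow _ s t h2 ht hst (hjump j s h1 h2 (ih s h1))

end Domain

/-! ### Solutions -/

namespace Arc.IsSolution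

variable {P : Design} {γP γI t₀ : ℝ} {ω : ℝ → Vec3} {R : ℝ → Mat3} {b : Vec3} {x : Arc}

theorem beta_eq (hx : x.IsSolution P γP γI t₀ ω R b) (hR : IsAttitude ω R) (ht₀ : 0 ≤ t₀)
    {t : ℝ} {j : ℕ} (ht : (t, j) ∈ x.dom) :
    x.beta P R t j = (x.Rh t j)ᵀ *ᵥ P.innov (R t * (x.Rh t j)ᵀ) (x.q t j) := by
  rw [Arc.beta, Arc.Rt, P.psi_transpose_mul_gradΦ]
  exact mul_mem (hR.1 t (ht₀.trans (hx.isDomain.le ht))) (SO3.transpose_mem (hx.mem_SO3 t j ht))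

theorem flowOn (hx : x.IsSolution P γP γI t₀ ω R b) (hR : IsAttitude ω R) (ht₀ : 0 ≤ t₀)
    {s : ℝ} {j : ℕ} (hs : (s, j) ∈ x.dom) :
    FlowOn P γP γI ω R (x.q s j) (x.slice j) (fun t => x.Rh t j) (fun t => x.bt b t j) where
  ordConnected := hx.isDomain.ordConnected j
  nonneg t ht := ht₀.trans (hx.isDomain.le ht)
  mem_SO3 t ht := hx.mem_SO3 t j ht
  ac_Rh s hs t ht := hx.ac_Rh j s hs t ht
  ac_y s hs t ht m := (ac_const (b m)).fun_sub (hx.ac_bh j s hs t ht m)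
  flow t ht := by
    rw [hx.flow_q j s hs t (interior_subset ht)]
    exact hx.flow_mem j t ht
  ode_Rh := by
    filter_upwards [hx.flow_Rh j] with t h ht
    have := h ht
    rw [hx.beta_eq hR ht₀ ht, ← hx.flow_q j s hs t ht] at this
    rwa [add_sub_assoc] at this
  ode_y := by
    filter_upwards [hx.flow_bh j] with t h ht m
    have := (h ht m).const_sub (b m)
    rw [hx.beta_eq hR ht₀ ht, ← hx.flow_q j s hs t ht] at this
    simpa [Arc.bt] using this

theorem Rt_mem (hx : x.IsSolution P γP γI t₀ ω R b) (hR : IsAttitude ω R) (ht₀ : 0 ≤ t₀)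
    {t : ℝ} {j : ℕ} (ht : (t, j) ∈ x.dom) : x.Rt R t j ∈ SO3 :=
  (hx.flowOn hR ht₀ ht).error_mem_SO3 hR ht

theorem Rt_jump (hx : x.IsSolution P γP γI t₀ ω R b) {t : ℝ} {j : ℕ} (h1 : (t, j) ∈ x.dom)
    (h2 : (t, j + 1) ∈ x.dom) : x.Rt R t (j + 1) = x.Rt R t j := by
  rw [Arc.Rt, Arc.Rt, hx.jump_Rh t j h1 h2]

theorem bt_jump (hx : x.IsSolution P γP γI t₀ ω R b) {t : ℝ} {j : ℕ} (h1 : (t, j) ∈ x.dom)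
    (h2 : (t, j + 1) ∈ x.dom) : x.bt b t (j + 1) = x.bt b t j := by
  rw [Arc.bt, Arc.bt, hx.jump_bh t j h1 h2]

theorem lyap_jump (hx : x.IsSolution P γP γI t₀ ω R b) {t : ℝ} {j : ℕ} (h1 : (t, j) ∈ x.dom)
    (h2 : (t, j + 1) ∈ x.dom) :
    lyap P γI (x.Rt R t (j + 1)) (x.q t (j + 1)) (x.bt b t (j + 1)) + P.δ ≤
      lyap P γI (x.Rt R t j) (x.q t j) (x.bt b t j) := by
  rw [hx.Rt_jump h1 h2, hx.bt_jump h1 h2]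
  have h3 := (hx.jump_mem t j h1 h2).2.2
  have h4 := (hx.jump_q t j h1 h2).2
  simp only [lyap]
  simp only at h3
  linarith

/-- Each jump consumes at least `δ` of the Lyapunov function. -/
theorem lyap_add_le (hx : x.IsSolution P γP γI t₀ ω R b) (h : P.Admissible) (hγP : 0 < γP)
    (hγI : 0 < γI) (hR : IsAttitude ω R) (ht₀ : 0 ≤ t₀) {t : ℝ} {j : ℕ} (ht : (t, j) ∈ x.dom) :
    lyap P γI (x.Rt R t j) (x.q t j) (x.bt b t j) + P.δ * j ≤
      lyap P γI (x.Rt R t₀ 0) (x.q t₀ 0) (x.bt b t₀ 0) := by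
  refine hx.isDomain.induction (p := fun t j =>
    lyap P γI (x.Rt R t j) (x.q t j) (x.bt b t j) + P.δ * j ≤
      lyap P γI (x.Rt R t₀ 0) (x.q t₀ 0) (x.bt b t₀ 0)) (by simp) ?_ ?_ j t ht
  · intro j s t hs ht hst hp
    have := (hx.flowOn hR ht₀ hs).lyap_le h hγP hγI hR hs ht hst
    rw [← hx.flow_q j s hs t ht]
    simp only [Arc.Rt] at *
    linarith
  · intro j t h1 h2 hp
    have := hx.lyap_jump (γI := γI) h1 h2
    push_cast
    linarith

theorem err_nonneg (x : Arc) (R : ℝ → Mat3) (b : Vec3) (t : ℝ) (j : ℕ) : 0 ≤ x.err R b t j :=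
  Real.sqrt_nonneg _

theorem err_sq (x : Arc) (R : ℝ → Mat3) (b : Vec3) (t : ℝ) (j : ℕ) :
    x.err R b t j ^ 2 = rotNorm (x.Rt R t j) ^ 2 + vnorm (x.bt b t j) ^ 2 :=
  Real.sq_sqrt (by positivity)

theorem lyap_initial_le (hx : x.IsSolution P γP γI t₀ ω R b) (h : P.Admissible)
    (hγI : 0 < γI) (hR : IsAttitude ω R) (ht₀ : 0 ≤ t₀) :
    lyap P γI (x.Rt R t₀ 0) (x.q t₀ 0) (x.bt b t₀ 0) ≤ (6 + 1 / γI) * x.err R b t₀ 0 ^ 2 := by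
  have h0 := hx.isDomain.initial_mem
  have h1 := (h.lyap_bounds (γI := γI) (hx.Rt_mem hR ht₀ h0) (hx.mem_Q _ _ h0) (x.bt b t₀ 0)).2
  rw [err_sq]
  have h2 : 0 ≤ 1 / γI * rotNorm (x.Rt R t₀ 0) ^ 2 := by positivity
  rw [div_eq_mul_one_div] at h1
  nlinarith [sq_nonneg (vnorm (x.bt b t₀ 0))]

/-- The Lyapunov function is nonnegative, so its initial value divided by $\delta$ bounds the jumps.
-/
theorem jumps_le (hx : x.IsSolution P γP γI t₀ ω R b) (h : P.Admissible) (hγP : 0 < γP)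
    (hγI : 0 < γI) (hR : IsAttitude ω R) (ht₀ : 0 ≤ t₀) {t : ℝ} {j : ℕ} (ht : (t, j) ∈ x.dom) :
    (j : ℝ) ≤ (6 + 1 / γI) * x.err R b t₀ 0 ^ 2 / P.δ := by
  have h1 := hx.lyap_add_le h hγP hγI hR ht₀ ht
  have h2 := hx.lyap_initial_le h hγI hR ht₀
  have h3 := (h.lyap_bounds (γI := γI) (hx.Rt_mem hR ht₀ ht) (hx.mem_Q _ _ ht) (x.bt b t j)).1
  have h4 : 0 ≤ xi P.A / 12 * rotNorm (x.Rt R t j) ^ 2 + vnorm (x.bt b t j) ^ 2 / γI := by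
    have := h.bounds.xi_pos
    positivity
  rw [le_div_iff₀ h.δ_pos]
  linarith

theorem vnorm_bt_sq_le (hx : x.IsSolution P γP γI t₀ ω R b) (h : P.Admissible) (hγP : 0 < γP)
    (hγI : 0 < γI) (hR : IsAttitude ω R) (ht₀ : 0 ≤ t₀) {t : ℝ} {j : ℕ} (ht : (t, j) ∈ x.dom) :
    vnorm (x.bt b t j) ^ 2 ≤ (6 * γI + 1) * x.err R b t₀ 0 ^ 2 := by
  have h1 := hx.lyap_add_le h hγP hγI hR ht₀ ht
  have h2 := hx.lyap_initial_le h hγI hR ht₀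
  have h3 := (h.lyap_bounds (γI := γI) (hx.Rt_mem hR ht₀ ht) (hx.mem_Q _ _ ht) (x.bt b t j)).1
  have h4 : 0 ≤ xi P.A / 12 * rotNorm (x.Rt R t j) ^ 2 := by
    have := h.bounds.xi_pos
    positivity
  have h5 : 0 ≤ P.δ * j := mul_nonneg h.δ_pos.le (Nat.cast_nonneg j)
  have h6 : vnorm (x.bt b t j) ^ 2 / γI ≤ (6 + 1 / γI) * x.err R b t₀ 0 ^ 2 := by linarith
  rw [div_le_iff₀ hγI] at h6
  refine h6.trans_eq ?_
  field_simp

theorem finitelyManyJumps (hx : x.IsSolution P γP γI t₀ ω R b) (h : P.Admissible) (hγP : 0 < γP)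
    (hγI : 0 < γI) (hR : IsAttitude ω R) (ht₀ : 0 ≤ t₀) : x.FinitelyManyJumps :=
  ⟨⌈(6 + 1 / γI) * x.err R b t₀ 0 ^ 2 / P.δ⌉₊, fun _ _ ht =>
    Nat.cast_le.1 ((hx.jumps_le h hγP hγI hR ht₀ ht).trans (Nat.le_ceil _))⟩

end Arc.IsSolution

theorem Design.Admissible.exponentially_stable {P : Design} (h : P.Admissible) {γP γI : ℝ}
    (hγP : 0 < γP) (hγI : 0 < γI) :
    ∃ K : ℝ, 0 < K ∧ ∀ c r : ℝ, ∃ rate : ℝ, 0 < rate ∧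
      ∀ (t₀ : ℝ) (ω : ℝ → Vec3) (R : ℝ → Mat3) (b : Vec3), 0 ≤ t₀ → IsAttitude ω R →
        (∀ t, 0 ≤ t → vnorm (ω t) ≤ c) →
        ∀ x : Arc, x.IsSolution P γP γI t₀ ω R b → x.err R b t₀ 0 ≤ r →
          ∀ t j, (t, j) ∈ x.dom →
            x.err R b t j ≤ K * Real.exp (-rate * (t - t₀ + (j : ℝ))) * x.err R b t₀ 0 := by
  obtain ⟨c₁, c₂, hc₁, hc₂, hcd⟩ := h.exists_cross_bounds hγP hγI
  -- The square root converts the estimate for $\|e\|^2$; the factor `Real.exp 1` pays for all jumps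
  -- together.
  refine ⟨√(c₂ / c₁) * Real.exp 1, by positivity, fun c r => ?_⟩
  -- The a priori bound on the bias error from the Lyapunov function without cross term is needed
  -- before $\varepsilon$ can be chosen.
  obtain ⟨ε, rate, hrate, hbd, hdec⟩ := hcd c √((6 * γI + 1) * r ^ 2)
  set J := (6 + 1 / γI) * r ^ 2 / P.δ with hJ
  have hδ := h.δ_pos
  have hJ0 : 0 ≤ J := by positivity
  -- As $j\le J$, the second entry makes the rate times $j$ at most 1; the $+1$ covers $J=0$.
  refine ⟨min (rate / 2) (1 / (J + 1)), by positivity, ?_⟩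
  intro t₀ ω R b ht₀ hR hω x hx hr t j ht
  have hr2 : x.err R b t₀ 0 ^ 2 ≤ r ^ 2 := pow_le_pow_left₀ (Arc.IsSolution.err_nonneg ..) hr 2
  have hvn (s : ℝ) (i : ℕ) (hs : (s, i) ∈ x.dom) : vnorm (R s *ᵥ x.bt b s i) = vnorm (x.bt b s i) :=
    SO3.vnorm_mulVec (hR.1 s (ht₀.trans (hx.isDomain.le hs))) _
  have hY (s : ℝ) (i : ℕ) (hs : (s, i) ∈ x.dom) :
      vnorm (x.bt b s i) ≤ √((6 * γI + 1) * r ^ 2) := by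
    apply Real.le_sqrt_of_sq_le
    refine (hx.vnorm_bt_sq_le h hγP hγI hR ht₀ hs).trans ?_
    gcongr
  have hind := hx.isDomain.induction (p := fun t j =>
    Real.exp (rate * t) * (lyap P γI (x.Rt R t j) (x.q t j) (x.bt b t j) +
        ε * (psi (x.Rt R t j) ⬝ᵥ (R t *ᵥ x.bt b t j))) ≤
      Real.exp (rate * t₀) * (lyap P γI (x.Rt R t₀ 0) (x.q t₀ 0) (x.bt b t₀ 0) +
        ε * (psi (x.Rt R t₀ 0) ⬝ᵥ (R t₀ *ᵥ x.bt b t₀ 0)))) le_rfl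
    (fun i s t hs ht hst hp => by
      refine le_trans ?_ hp
      have hF := hx.flowOn hR ht₀ hs
      rw [← hx.flow_q i s hs t ht]
      refine hF.cross_decay h hR hs ht hst hγI fun u hu => ?_
      have hui := hF.Ioo_subset_interior hs ht hu
      have hudom : (u, i) ∈ x.dom := interior_subset (s := x.slice i) hui
      have hu0 := hF.nonneg u hudom
      refine hdec _ _ (hF.flow u hui) _ _ _ (hvn u i hudom)
        ((hvn u i hudom).trans_le (hY u i hudom)) ?_
      rw [SO3.vnorm_mulVec (hR.1 u hu0), SO3.vnorm_mulVec (hR.1 u hu0)]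
      exact (vnorm_skew_mulVec_le _ _).trans
        (mul_le_mul_of_nonneg_right (hω u hu0) (vnorm_nonneg _)))
    (fun i t h1 h2 hp => by
      refine le_trans ?_ hp
      have h3 := hx.lyap_jump (γI := γI) h1 h2
      rw [hx.Rt_jump h1 h2, hx.bt_jump h1 h2] at h3 ⊢
      gcongr
      linarith) j t ht
  have h0 := hx.isDomain.initial_mem
  have hb1 := (hbd _ (hx.Rt_mem hR ht₀ ht) _ (hx.mem_Q _ _ ht) _ _ (hvn t j ht)).1
  have hb2 := (hbd _ (hx.Rt_mem hR ht₀ h0) _ (hx.mem_Q _ _ h0) _ _ (hvn t₀ 0 h0)).2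
  rw [← Arc.IsSolution.err_sq] at hb1 hb2
  have hj := (hx.jumps_le h hγP hγI hR ht₀ ht).trans
    (by rw [hJ]; gcongr : _ ≤ J)
  have htt := hx.isDomain.le ht
  have he0 := Arc.IsSolution.err_nonneg x R b t₀ 0
  generalize x.err R b t j = e at *
  generalize x.err R b t₀ 0 = e₀ at *
  have h1 : e ^ 2 ≤ c₂ / c₁ * Real.exp (-rate * (t - t₀)) * e₀ ^ 2 := by
    have h2 : Real.exp (rate * t) * (c₁ * e ^ 2) ≤ Real.exp (rate * t₀) * (c₂ * e₀ ^ 2) :=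
      (mul_le_mul_of_nonneg_left hb1 (Real.exp_pos _).le).trans
        (hind.trans (mul_le_mul_of_nonneg_left hb2 (Real.exp_pos _).le))
    have h3 : Real.exp (-rate * (t - t₀)) = Real.exp (rate * t₀) / Real.exp (rate * t) := by
      rw [← Real.exp_sub]; congr 1; ring
    have h4 : c₂ / c₁ * Real.exp (-rate * (t - t₀)) * e₀ ^ 2 =
        Real.exp (rate * t₀) * (c₂ * e₀ ^ 2) / (Real.exp (rate * t) * c₁) := by
      rw [h3]; field_simp
    rw [h4, le_div_iff₀ (by positivity)]
    linarith
  have h2 : e ≤ √(c₂ / c₁) * Real.exp (-(rate / 2) * (t - t₀)) * e₀ := by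
    apply le_of_sq_le_sq _ (by positivity)
    refine h1.trans_eq ?_
    rw [mul_pow, mul_pow, Real.sq_sqrt (by positivity), ← Real.exp_nat_mul]
    congr 3
    push_cast
    ring
  refine h2.trans ?_
  rw [mul_assoc √(c₂ / c₁) (Real.exp 1), ← Real.exp_add]
  gcongr
  have k1 : min (rate / 2) (1 / (J + 1)) * (t - t₀) ≤ rate / 2 * (t - t₀) :=
    mul_le_mul_of_nonneg_right (min_le_left _ _) (by linarith)
  have k2 : min (rate / 2) (1 / (J + 1)) * j ≤ 1 := by
    calc _ ≤ 1 / (J + 1) * J :=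
          mul_le_mul (min_le_right _ _) hj (Nat.cast_nonneg j) (by positivity)
      _ ≤ 1 := by rw [one_div, inv_mul_le_iff₀ (by positivity)]; linarith
  linarith

/-! ### Modification of a solution on one interval of flow -/

/-- The arc `x` with the data on the interval of flow with index `n` replaced. -/
noncomputable def Arc.replace (x : Arc) (n : ℕ) (I : Set ℝ) (b : Vec3) (Rh : ℝ → Mat3)
    (y : ℝ → Vec3) (q : ℕ) : Arc where
  dom := {z | (z.2 ≠ n ∧ z ∈ x.dom) ∨ (z.2 = n ∧ z.1 ∈ I)}
  Rh t j := if j = n then Rh t else x.Rh t j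
  bh t j := if j = n then b - y t else x.bh t j
  q t j := if j = n then q else x.q t j

namespace Arc.IsSolution

variable {P : Design} {γP γI t₀ : ℝ} {ω : ℝ → Vec3} {R : ℝ → Mat3} {b : Vec3} {x : Arc}

/-- One statement covers both ways of extending a solution: prolonging the last interval of flow,
and adding a new interval after a jump. -/
theorem replace (hx : x.IsSolution P γP γI t₀ ω R b) (hR : IsAttitude ω R) {n : ℕ} {I : Set ℝ}
    {Rh : ℝ → Mat3} {y : ℝ → Vec3} {q : ℕ}
    (hE : IsHybridTimeDomain t₀ (x.replace n I b Rh y q).dom)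
    (hF : FlowOn P γP γI ω R q I Rh y) (hq : q ∈ P.Q)
    (hjump : ∀ t j, (t, j) ∈ x.dom → j + 1 = n → t ∈ I → (x.Rt R t j, x.q t j) ∈ P.jumpSet ∧
      q ∈ P.argminΦ (x.Rt R t j) ∧ Rh t = x.Rh t j ∧ b - y t = x.bh t j)
    (hnext : ∀ t, t ∈ I → (t, n + 1) ∉ x.dom) :
    (x.replace n I b Rh y q).IsSolution P γP γI t₀ ω R b := by
  have hs (j : ℕ) (hj : j ≠ n) : (x.replace n I b Rh y q).slice j = x.slice j := by
    ext t; simp [Arc.slice, Arc.replace, hj]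
  have hsn : (x.replace n I b Rh y q).slice n = I := by
    ext t; simp [Arc.slice, Arc.replace]
  have hd (t : ℝ) (j : ℕ) (hj : j ≠ n) : (t, j) ∈ (x.replace n I b Rh y q).dom ↔ (t, j) ∈ x.dom := by
    simp [Arc.replace, hj]
  have hdn (t : ℝ) : (t, n) ∈ (x.replace n I b Rh y q).dom ↔ t ∈ I := by
    simp [Arc.replace]
  have hRh (t : ℝ) (j : ℕ) (hj : j ≠ n) : (x.replace n I b Rh y q).Rh t j = x.Rh t j := if_neg hj
  have hRhn (t : ℝ) : (x.replace n I b Rh y q).Rh t n = Rh t := if_pos rfl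
  have hbh (t : ℝ) (j : ℕ) (hj : j ≠ n) : (x.replace n I b Rh y q).bh t j = x.bh t j := if_neg hj
  have hbhn (t : ℝ) : (x.replace n I b Rh y q).bh t n = b - y t := if_pos rfl
  have hqj (t : ℝ) (j : ℕ) (hj : j ≠ n) : (x.replace n I b Rh y q).q t j = x.q t j := if_neg hj
  have hqn (t : ℝ) : (x.replace n I b Rh y q).q t n = q := if_pos rfl
  have hRt (t : ℝ) (j : ℕ) (hj : j ≠ n) : (x.replace n I b Rh y q).Rt R t j = x.Rt R t j := by
    rw [Arc.Rt, Arc.Rt, hRh t j hj]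
  have hRtn (t : ℝ) : (x.replace n I b Rh y q).Rt R t n = R t * (Rh t)ᵀ := by
    rw [Arc.Rt, hRhn]
  have hβ (t : ℝ) (j : ℕ) (hj : j ≠ n) :
      (x.replace n I b Rh y q).beta P R t j = x.beta P R t j := by
    rw [Arc.beta, Arc.beta, hRt t j hj, hRh t j hj, hqj t j hj]
  have hβn (t : ℝ) (ht : t ∈ I) : (x.replace n I b Rh y q).beta P R t n =
      (Rh t)ᵀ *ᵥ P.innov (R t * (Rh t)ᵀ) q := by
    rw [Arc.beta, hRtn, hRhn, hqn, P.psi_transpose_mul_gradΦ (hF.error_mem_SO3 hR ht)]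
  generalize x.replace n I b Rh y q = z at *
  refine ⟨hE, ?_, ?_, ?_, ?_, ?_, ?_, ?_, ?_, ?_, ?_, ?_, ?_⟩
  · intro t j ht
    by_cases hj : j = n
    · subst hj; rw [hRhn]; exact hF.mem_SO3 t ((hdn t).1 ht)
    · rw [hRh t j hj]; exact hx.mem_SO3 t j ((hd t j hj).1 ht)
  · intro t j ht
    by_cases hj : j = n
    · subst hj; rwa [hqn]
    · rw [hqj t j hj]; exact hx.mem_Q t j ((hd t j hj).1 ht)
  · intro j
    by_cases hj : j = n
    · subst hj; simp only [hsn, hRhn]; exact hF.ac_Rh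
    · simp only [hs j hj, hRh _ j hj]; exact hx.ac_Rh j
  · intro j
    by_cases hj : j = n
    · subst hj; simp only [hsn, hbhn]
      exact fun s hs t ht m => (ac_const (b m)).fun_sub (hF.ac_y s hs t ht m)
    · simp only [hs j hj, hbh _ j hj]; exact hx.ac_bh j
  · intro j
    by_cases hj : j = n
    · subst hj; simp only [hsn, hRtn, hqn]; exact hF.flow
    · simp only [hs j hj, hRt _ j hj, hqj _ j hj]; exact hx.flow_mem j
  · intro j
    by_cases hj : j = n
    · subst hj; simp only [hqn, implies_true]
    · simp only [hs j hj, hqj _ j hj]; exact hx.flow_q j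
  · intro j
    by_cases hj : j = n
    · subst hj; simp only [hsn, hRhn, hbhn]
      filter_upwards [hF.ode_Rh] with t h ht
      have := h ht
      rw [hβn t ht, add_sub_assoc, sub_sub_cancel]
      exact this
    · simp only [hs j hj, hRh _ j hj, hbh _ j hj, hβ _ j hj]; exact hx.flow_Rh j
  · intro j
    by_cases hj : j = n
    · subst hj; simp only [hsn, hbhn]
      filter_upwards [hF.ode_y] with t h ht m
      rw [hβn t ht]
      exact (h ht m).const_sub (b m)
    · simp only [hs j hj, hbh _ j hj, hβ _ j hj]; exact hx.flow_bh j
  all_goals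
    intro t j h1 h2
    by_cases hj : j = n
    · subst hj
      exact absurd ((hd t _ (Nat.succ_ne_self j)).1 h2) (hnext t ((hdn t).1 h1))
    · rw [hd t j hj] at h1
      by_cases hj' : j + 1 = n
      · subst hj'
        obtain ⟨k1, k2, k3, k4⟩ := hjump t j h1 rfl ((hdn t).1 h2)
        simpa only [hRt t j hj, hRtn, hqj t j hj, hqn, hRh t j hj, hRhn, hbh t j hj, hbhn]
      · rw [hd t _ hj'] at h2
        simp only [hRt t j hj, hRh t j hj, hqj t j hj, hbh t j hj, hRh t _ hj', hqj t _ hj',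
          hbh t _ hj', hx.jump_mem t j h1 h2, hx.jump_q t j h1 h2, hx.jump_Rh t j h1 h2,
          hx.jump_bh t j h1 h2]

end Arc.IsSolution

theorem Arc.IsMaximalSolution.subset_slice {P : Design} {γP γI t₀ : ℝ} {ω : ℝ → Vec3}
    {R : ℝ → Mat3} {b : Vec3} {x : Arc} (hx : x.IsMaximalSolution P γP γI t₀ ω R b)
    (hR : IsAttitude ω R) {n : ℕ} {I : Set ℝ}
    {Rh : ℝ → Mat3} {y : ℝ → Vec3} {q : ℕ}
    (hE : IsHybridTimeDomain t₀ {z | (z.2 ≠ n ∧ z ∈ x.dom) ∨ (z.2 = n ∧ z.1 ∈ I)})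
    (hF : FlowOn P γP γI ω R q I Rh y) (hq : q ∈ P.Q)
    (hjump : ∀ t j, (t, j) ∈ x.dom → j + 1 = n → t ∈ I → (x.Rt R t j, x.q t j) ∈ P.jumpSet ∧
      q ∈ P.argminΦ (x.Rt R t j) ∧ Rh t = x.Rh t j ∧ y t = x.bt b t j)
    (hnext : ∀ t, t ∈ I → (t, n + 1) ∉ x.dom)
    (hext : ∀ t, (t, n) ∈ x.dom → t ∈ I ∧ Rh t = x.Rh t n ∧ y t = x.bt b t n ∧ q = x.q t n) :
    I ⊆ x.slice n := by
  have hsol := hx.1.replace hR (n := n) hE hF hq (fun t j h1 h2 h3 => by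
    obtain ⟨k1, k2, k3, k4⟩ := hjump t j h1 h2 h3
    exact ⟨k1, k2, k3, by rw [k4, Arc.bt, sub_sub_cancel]⟩) hnext
  have h := hx.2 _ hsol ⟨fun z hz => ?_, fun t j ht => ?_⟩
  · intro t ht
    rw [Arc.slice, Set.mem_ofPred_eq, ← h]
    exact Or.inr ⟨rfl, ht⟩
  · by_cases hj : z.2 = n
    · obtain ⟨t, j⟩ := z
      simp only at hj
      subst hj
      exact Or.inr ⟨rfl, (hext t hz).1⟩
    · exact Or.inl ⟨hj, hz⟩
  · by_cases hj : j = n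
    · subst hj
      obtain ⟨-, k2, k3, k4⟩ := hext t ht
      simp [Arc.replace, k2, k3, k4, Arc.bt]
    · simp [Arc.replace, hj]

/-! ### Extension of intervals of flow -/

theorem ac_refl (f : ℝ → ℝ) (a : ℝ) : AbsolutelyContinuousOnInterval f a a :=
  ac_congr (ac_const (f a)) fun x hx => by rw [uIcc_self, mem_singleton_iff] at hx; rw [hx]

/-- A bounded almost-everywhere derivative makes an absolutely continuous function Lipschitz on the
interval, and real Lipschitz functions extend to the line. The extension provides the limit at a
missing end point. -/
theorem exists_lipschitz_extension {f : ℝ → ℝ} {S : Set ℝ} (hS : S.OrdConnected)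
    (hac : ∀ s ∈ S, ∀ t ∈ S, AbsolutelyContinuousOnInterval f s t) {M : ℝ}
    (hd : ∀ᵐ t, t ∈ interior S → ∃ d, |d| ≤ M ∧ HasDerivAt f d t) :
    ∃ (g : ℝ → ℝ) (K : NNReal), LipschitzWith K g ∧ ∀ t ∈ S, g t = f t := by
  have hle (s t : ℝ) (hs : s ∈ S) (ht : t ∈ S) (hst : s ≤ t) : |f t - f s| ≤ M * |t - s| := by
    rw [abs_of_nonneg (sub_nonneg.2 hst)]
    refine ac_abs_sub_le hst (hac s hs t ht) ?_
    filter_upwards [hd] with r h1 hr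
    exact h1 (interior_maximal (Ioo_subset_Icc_self.trans (hS.out hs ht)) isOpen_Ioo hr)
  have hL : LipschitzOnWith M.toNNReal f S := by
    refine LipschitzOnWith.of_dist_le_mul fun t ht s hs => ?_
    rw [Real.dist_eq, Real.dist_eq]
    have h1 : |f t - f s| ≤ M * |t - s| := by
      rcases le_total s t with h | h
      · exact hle s t hs ht h
      · rw [abs_sub_comm, abs_sub_comm t]; exact hle t s ht hs h
    exact h1.trans (mul_le_mul_of_nonneg_right (Real.le_coe_toNNReal M) (abs_nonneg _))
  obtain ⟨g, hg, hfg⟩ := hL.extend_real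
  exact ⟨g, _, hg, fun t ht => (hfg ht).symm⟩

theorem abs_mul_skew_apply_le {X : Mat3} (hX : X ∈ SO3) (v : Vec3) (i j : Fin 3) :
    |(X * skew v) i j| ≤ 2 * vnorm v := by
  have h0 := abs_apply_le_vnorm v 0
  have h1 := abs_apply_le_vnorm v 1
  have h2 := abs_apply_le_vnorm v 2
  have key (a b : Fin 3) (s t : ℝ) (hs : |s| ≤ vnorm v) (ht : |t| ≤ vnorm v) :
      |X i a * s + X i b * t| ≤ 2 * vnorm v := by
    have k1 := mul_le_mul (SO3.abs_apply_le hX i a) hs (abs_nonneg _) zero_le_one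
    have k2 := mul_le_mul (SO3.abs_apply_le hX i b) ht (abs_nonneg _) zero_le_one
    have := abs_add_le (X i a * s) (X i b * t)
    rw [abs_mul, abs_mul] at this
    linarith
  rw [Matrix.mul_apply, Fin.sum_univ_three]
  fin_cases j
  · simpa [skew_apply] using key 1 2 (v 2) (-v 1) h2 (by rwa [abs_neg])
  · simpa [skew_apply] using key 0 2 (-v 2) (v 0) (by rwa [abs_neg]) h0
  · simpa [skew_apply] using key 0 1 (v 1) (-v 0) h1 (by rwa [abs_neg])

namespace FlowOn

variable {P : Design} {γP γI : ℝ} {ω : ℝ → Vec3} {R : ℝ → Mat3} {q : ℕ} {S : Set ℝ}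
  {Rh : ℝ → Mat3} {y : ℝ → Vec3}

theorem singleton {T : ℝ} (hT : 0 ≤ T) (h : Rh T ∈ SO3) : FlowOn P γP γI ω R q {T} Rh y where
  ordConnected := ordConnected_singleton
  nonneg t ht := by rw [mem_singleton_iff.1 ht]; exact hT
  mem_SO3 t ht := by rw [mem_singleton_iff.1 ht]; exact h
  ac_Rh s hs t ht i j := by
    rw [mem_singleton_iff.1 ht, mem_singleton_iff.1 hs]; exact ac_refl _ _
  ac_y s hs t ht m := by
    rw [mem_singleton_iff.1 ht, mem_singleton_iff.1 hs]; exact ac_refl _ _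
  flow t ht := by simp at ht
  ode_Rh := by
    have : ∀ᵐ t : ℝ, t ≠ T := by simp [ae_iff, measure_singleton]
    filter_upwards [this] with t h1 h2
    exact absurd h2 h1
  ode_y := by
    have : ∀ᵐ t : ℝ, t ≠ T := by simp [ae_iff, measure_singleton]
    filter_upwards [this] with t h1 h2
    exact absurd h2 h1

/-- Changing the curves outside of the interval of flow. -/
theorem congr {a b : ℝ} (hF : FlowOn P γP γI ω R q (Icc a b) Rh y) {Rh' : ℝ → Mat3}
    {y' : ℝ → Vec3} (h1 : ∀ t ∈ Icc a b, Rh' t = Rh t) (h2 : ∀ t ∈ Icc a b, y' t = y t) :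
    FlowOn P γP γI ω R q (Icc a b) Rh' y' where
  ordConnected := hF.ordConnected
  nonneg := hF.nonneg
  mem_SO3 t ht := by rw [h1 t ht]; exact hF.mem_SO3 t ht
  ac_Rh s hs t ht i j := ac_congr (hF.ac_Rh s hs t ht i j) fun r hr => by
    rw [h1 r (uIcc_subset_Icc hs ht hr)]
  ac_y s hs t ht m := ac_congr (hF.ac_y s hs t ht m) fun r hr => by
    rw [h2 r (uIcc_subset_Icc hs ht hr)]
  flow t ht := by rw [h1 t (interior_subset ht)]; exact hF.flow t ht
  ode_Rh := by
    filter_upwards [hF.ode_Rh, ae_mem_Ioo_of_mem_Icc a b] with t k1 k2 ht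
    rw [h1 t ht, h2 t ht]
    intro i j
    refine (k1 ht i j).congr_of_eventuallyEq ?_
    filter_upwards [Icc_mem_nhds (k2 ht).1 (k2 ht).2] with s hs
    rw [h1 s hs]
  ode_y := by
    filter_upwards [hF.ode_y, ae_mem_Ioo_of_mem_Icc a b] with t k1 k2 ht m
    rw [h1 t ht]
    refine (k1 ht m).congr_of_eventuallyEq ?_
    filter_upwards [Icc_mem_nhds (k2 ht).1 (k2 ht).2] with s hs
    rw [h2 s hs]

/-- The junction $b$ may be interior to the union but is interior to neither piece, so membership in
the flow set there has to be supplied. -/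
theorem append {a b c : ℝ} (hab : a ≤ b) (hbc : b ≤ c)
    (hF : FlowOn P γP γI ω R q (Icc a b) Rh y) (hG : FlowOn P γP γI ω R q (Icc b c) Rh y)
    (hb : (R b * (Rh b)ᵀ, q) ∈ P.flowSet) : FlowOn P γP γI ω R q (Icc a c) Rh y := by
  have hcases (t : ℝ) (ht : t ∈ Icc a c) : t ∈ Icc a b ∨ t ∈ Icc b c := by
    rcases le_total t b with h | h
    · exact Or.inl ⟨ht.1, h⟩
    · exact Or.inr ⟨h, ht.2⟩
  have hac {f : ℝ → ℝ} (h1 : AbsolutelyContinuousOnInterval f a b)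
      (h2 : AbsolutelyContinuousOnInterval f b c) (s : ℝ) (hs : s ∈ Icc a c) (t : ℝ)
      (ht : t ∈ Icc a c) : AbsolutelyContinuousOnInterval f s t :=
    (ac_trans hab hbc h1 h2).mono (by
      rw [uIcc_of_le (hab.trans hbc)]; exact uIcc_subset_Icc hs ht)
  refine ⟨ordConnected_Icc, ?_, ?_, ?_, ?_, ?_, ?_, ?_⟩
  · exact fun t ht => (hcases t ht).elim (hF.nonneg t) (hG.nonneg t)
  · exact fun t ht => (hcases t ht).elim (hF.mem_SO3 t) (hG.mem_SO3 t)
  · exact fun s hs t ht i j => hac (hF.ac_Rh a (left_mem_Icc.2 hab) b (right_mem_Icc.2 hab) i j)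
      (hG.ac_Rh b (left_mem_Icc.2 hbc) c (right_mem_Icc.2 hbc) i j) s hs t ht
  · exact fun s hs t ht m => hac (hF.ac_y a (left_mem_Icc.2 hab) b (right_mem_Icc.2 hab) m)
      (hG.ac_y b (left_mem_Icc.2 hbc) c (right_mem_Icc.2 hbc) m) s hs t ht
  · intro t ht
    rw [interior_Icc] at ht
    rcases lt_trichotomy t b with h | h | h
    · exact hF.flow t (by rw [interior_Icc]; exact ⟨ht.1, h⟩)
    · rw [h]; exact hb
    · exact hG.flow t (by rw [interior_Icc]; exact ⟨h, ht.2⟩)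
  · filter_upwards [hF.ode_Rh, hG.ode_Rh] with t h1 h2 ht
    exact (hcases t ht).elim h1 h2
  · filter_upwards [hF.ode_y, hG.ode_y] with t h1 h2 ht
    exact (hcases t ht).elim h1 h2

/-- A bounded flow extends to the right end point of its interval. -/
theorem exists_closure {a T : ℝ} (haT : a < T) (hF : FlowOn P γP γI ω R q (Ico a T) Rh y)
    (h : P.Admissible) (hγP : 0 < γP) (hγI : 0 < γI) {c Y : ℝ}
    (hω : ∀ t, 0 ≤ t → vnorm (ω t) ≤ c) (hy : ∀ t ∈ Ico a T, vnorm (y t) ≤ Y) :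
    ∃ (Rh' : ℝ → Mat3) (y' : ℝ → Vec3), FlowOn P γP γI ω R q (Icc a T) Rh' y' ∧
      ∀ t ∈ Ico a T, Rh' t = Rh t ∧ y' t = y t := by
  obtain ⟨_, C, -, hC, hb⟩ := h.exists_innov_bounds
  have hint : interior (Ico a T) = Ioo a T := interior_Ico
  have hg (t : ℝ) (ht : t ∈ interior (Ico a T)) :
      vnorm ((Rh t)ᵀ *ᵥ P.innov (R t * (Rh t)ᵀ) q) ≤ C := by
    rw [SO3.vnorm_mulVec (SO3.transpose_mem (hF.mem_SO3 t (interior_subset ht)))]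
    have hf := hF.flow t ht
    exact ((hb _ _ hf).2).trans (mul_le_of_le_one_right hC.le
      ((sq_le_one_iff₀ (rotNorm_nonneg _)).1 (rotNorm_sq_le_one hf.1)))
  have h1 (i j : Fin 3) := exists_lipschitz_extension hF.ordConnected
    (f := fun t => Rh t i j) (fun s hs t ht => hF.ac_Rh s hs t ht i j)
    (M := 2 * (c + Y + γP * C)) (by
      filter_upwards [hF.ode_Rh] with t k1 ht
      have htS := interior_subset ht
      refine ⟨_, ?_, k1 htS i j⟩
      refine (abs_mul_skew_apply_le (hF.mem_SO3 t htS) _ i j).trans ?_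
      refine mul_le_mul_of_nonneg_left ?_ zero_le_two
      refine (vnorm_add_le _ _).trans (add_le_add ((vnorm_add_le _ _).trans
        (add_le_add (hω t (hF.nonneg t htS)) (hy t htS))) ?_)
      rw [vnorm_smul, abs_of_pos hγP]
      exact mul_le_mul_of_nonneg_left (hg t ht) hγP.le)
  have h2 (m : Fin 3) := exists_lipschitz_extension hF.ordConnected
    (f := fun t => y t m) (fun s hs t ht => hF.ac_y s hs t ht m) (M := γI * C) (by
      filter_upwards [hF.ode_y] with t k1 ht
      refine ⟨_, ?_, k1 (interior_subset ht) m⟩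
      refine (abs_apply_le_vnorm _ m).trans ?_
      rw [vnorm_smul, abs_of_pos hγI]
      exact mul_le_mul_of_nonneg_left (hg t ht) hγI.le)
  choose G K hG hGe using h1
  choose g κ hgL hge using h2
  have hR' (t : ℝ) (ht : t ∈ Ico a T) : Matrix.of (fun i j => G i j t) = Rh t := by
    ext i j; exact hGe i j t ht
  have hy' (t : ℝ) (ht : t ∈ Ico a T) : (fun m => g m t) = y t := by
    ext m; exact hge m t ht
  refine ⟨fun t => Matrix.of fun i j => G i j t, fun t m => g m t, ?_,
    fun t ht => ⟨hR' t ht, hy' t ht⟩⟩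
  refine ⟨ordConnected_Icc, ?_, ?_, ?_, ?_, ?_, ?_, ?_⟩
  · exact fun t ht => (hF.nonneg a (left_mem_Ico.2 haT)).trans ht.1
  -- The limit at $T$ is a rotation because $SO(3)$ is closed.
  · have hcl : IsClosed {t : ℝ | (Matrix.of fun i j => G i j t : Mat3) ∈ SO3} :=
      isClosed_SO3.preimage (continuous_pi fun i => continuous_pi fun j => (hG i j).continuous)
    have hsub : Ico a T ⊆ {t : ℝ | (Matrix.of fun i j => G i j t : Mat3) ∈ SO3} := by
      intro t ht
      rw [mem_ofPred_eq, hR' t ht]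
      exact hF.mem_SO3 t ht
    have := closure_minimal hsub hcl
    rw [closure_Ico haT.ne] at this
    exact this
  · exact fun s hs t ht i j => (hG i j).lipschitzOnWith.absolutelyContinuousOnInterval
  · exact fun s hs t ht m => (hgL m).lipschitzOnWith.absolutelyContinuousOnInterval
  · intro t ht
    rw [interior_Icc] at ht
    simp only [hR' t (Ioo_subset_Ico_self ht)]
    exact hF.flow t (by rwa [hint])
  · filter_upwards [hF.ode_Rh, ae_mem_Ioo_of_mem_Icc a T] with t k1 k2 ht
    have ht' := Ioo_subset_Ico_self (k2 ht)
    rw [hR' t ht', hy' t ht']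
    intro i j
    refine (k1 ht' i j).congr_of_eventuallyEq ?_
    filter_upwards [Ioo_mem_nhds (k2 ht).1 (k2 ht).2] with s hs
    exact hGe i j s (Ioo_subset_Ico_self hs)
  · filter_upwards [hF.ode_y, ae_mem_Ioo_of_mem_Icc a T] with t k1 k2 ht m
    have ht' := Ioo_subset_Ico_self (k2 ht)
    rw [hR' t ht']
    refine (k1 ht' m).congr_of_eventuallyEq ?_
    filter_upwards [Ioo_mem_nhds (k2 ht).1 (k2 ht).2] with s hs
    exact hge m s (Ioo_subset_Ico_self hs)

end FlowOn

/-! ### Local existence of flows -/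

open Metric in
/-- Local solvability of an ordinary differential equation whose right-hand side is `C¹` in the
state and depends on time through a continuous curve. -/
theorem exists_local_solution {E F : Type*} [NormedAddCommGroup E] [NormedSpace ℝ E]
    [CompleteSpace E] [NormedAddCommGroup F] [NormedSpace ℝ F] {G : F × E → E} {ρ : ℝ → F} {T : ℝ}
    {x₀ : E} (hG : ContDiffAt ℝ 1 G (ρ T, x₀)) (hρ : ContinuousOn ρ (Ici T)) {U : Set E}
    (hU : U ∈ nhds x₀) :
    ∃ T₁ > T, ∃ (α : ℝ → E) (L : ℝ), α T = x₀ ∧ ∀ t ∈ Icc T T₁, α t ∈ U ∧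
      HasDerivWithinAt α (G (ρ t, α t)) (Icc T T₁) t ∧ ‖G (ρ t, α t)‖ ≤ L := by
  obtain ⟨K, s, hs, hl⟩ := hG.exists_lipschitzOnWith
  obtain ⟨a, ha, has⟩ := Metric.mem_nhds_iff.1 hs
  have hsub {u : F} {v : E} (hu : u ∈ ball (ρ T) a) (hv : v ∈ ball x₀ a) : (u, v) ∈ s :=
    has (by rw [← ball_prod_same]; exact ⟨hu, hv⟩)
  obtain ⟨η, hη, hρη⟩ : ∃ η > 0, ∀ t ∈ Icc T (T + η), ρ t ∈ ball (ρ T) a := by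
    obtain ⟨η, hη, h⟩ := Metric.continuousWithinAt_iff.1 (hρ T self_mem_Ici) a ha
    refine ⟨η / 2, half_pos hη, fun t ht => h ht.1 ?_⟩
    rw [Real.dist_eq, abs_of_nonneg (sub_nonneg.2 ht.1)]
    linarith [ht.2]
  have hGb {u : F} {v : E} (hu : u ∈ ball (ρ T) a) (hv : v ∈ ball x₀ a) :
      ‖G (u, v)‖ ≤ K * a + ‖G (ρ T, x₀)‖ := by
    have h1 := hl.dist_le_mul _ (hsub hu hv) _ (mem_of_mem_nhds hs)
    have h2 : dist (u, v) (ρ T, x₀) ≤ a := by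
      rw [Prod.dist_eq]; exact max_le (mem_ball.1 hu).le (mem_ball.1 hv).le
    have h3 : ‖G (u, v)‖ ≤ dist (G (u, v)) (G (ρ T, x₀)) + ‖G (ρ T, x₀)‖ := by
      rw [dist_eq_norm]; exact norm_le_norm_sub_add _ _
    have h4 : (K : ℝ) * dist (u, v) (ρ T, x₀) ≤ K * a := by gcongr
    linarith
  -- The summand 1 makes the speed bound positive, so that $a/(2L)$ is a valid time of existence.
  set L : ℝ := K * a + ‖G (ρ T, x₀)‖ + 1 with hL
  have hL0 : 0 < L := by positivity
  set τ := min η (a / 2 / L) with hτ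
  have hτ0 : 0 < τ := by positivity
  have hτη : Icc T (T + τ) ⊆ Icc T (T + η) := Icc_subset_Icc_right (by
    linarith [min_le_left η (a / 2 / L)])
  have hPL : IsPicardLindelof (fun t x => G (ρ t, x)) (tmin := T) (tmax := T + τ)
      ⟨T, left_mem_Icc.2 (by linarith)⟩ x₀ ⟨a / 2, (half_pos ha).le⟩ 0 ⟨L, hL0.le⟩ K := by
    have hb : closedBall x₀ (a / 2) ⊆ ball x₀ a := closedBall_subset_ball (half_lt_self ha)
    refine ⟨fun t ht => ?_, fun x hx => ?_, fun t ht x hx => ?_, ?_⟩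
    · refine LipschitzOnWith.of_dist_le_mul fun x hx z hz => ?_
      refine (hl.dist_le_mul _ (hsub (hρη t (hτη ht)) (hb hx)) _
        (hsub (hρη t (hτη ht)) (hb hz))).trans_eq ?_
      simp [Prod.dist_eq]
    · refine hl.continuousOn.comp ((hρ.mono Icc_subset_Ici_self).prodMk continuousOn_const)
        fun t ht => hsub (hρη t (hτη ht)) (hb hx)
    · refine (hGb (hρη t (hτη ht)) (hb hx)).trans ?_
      change _ ≤ L
      linarith
    · simp only [NNReal.coe_zero, sub_zero, add_sub_cancel_left, sub_self]
      rw [max_eq_left hτ0.le]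
      change L * τ ≤ a / 2
      calc L * τ ≤ L * (a / 2 / L) := by gcongr; exact min_le_right _ _
        _ = a / 2 := by field_simp
  obtain ⟨α, hα0, hα⟩ := hPL.exists_eq_forall_mem_Icc_hasDerivWithinAt₀
  simp only at hα0
  have hcont := (hα T (left_mem_Icc.2 (by linarith))).continuousWithinAt
  -- By continuity at $T$, on a shorter interval the solution stays both in $U$ and in the ball
  -- where $G$ is bounded.
  have hev := hcont.eventually (p := fun v => v ∈ U ∩ ball x₀ a) (by
    rw [hα0]; exact Filter.inter_mem hU (ball_mem_nhds x₀ ha))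
  obtain ⟨θ, hθ, hev⟩ := Metric.mem_nhdsWithin_iff.1 hev
  have hsub1 : Icc T (T + min τ (θ / 2)) ⊆ Icc T (T + τ) :=
    Icc_subset_Icc_right (by linarith [min_le_left τ (θ / 2)])
  refine ⟨T + min τ (θ / 2), lt_add_of_pos_right T (by positivity), α, K * a + ‖G (ρ T, x₀)‖, hα0, fun t ht => ?_⟩
  have h1 : α t ∈ U ∩ ball x₀ a := by
    refine hev ⟨?_, hsub1 ht⟩
    rw [mem_ball, Real.dist_eq, abs_of_nonneg (sub_nonneg.2 ht.1)]
    linarith [ht.2, min_le_right τ (θ / 2)]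
  exact ⟨h1.1, (hα t (hsub1 ht)).mono hsub1, hGb (hρη t (hτη (hsub1 ht))) h1.2⟩

/-- The derivative of the attitude estimate, recovered from the attitude error. -/
theorem hasMatDeriv_estimate {R X : ℝ → Mat3} {w y g : Vec3} {γ t : ℝ}
    (hR : HasMatDeriv R (R t * skew w) t)
    (hX : HasMatDeriv X (X t * skew (-((X t)ᵀ *ᵥ (R t *ᵥ y)) - γ • g)) t)
    (hRm : R t ∈ SO3) (hXm : X t ∈ SO3) :
    HasMatDeriv (fun s => (X s)ᵀ * R s)
      ((X t)ᵀ * R t * skew (w + y + γ • (((X t)ᵀ * R t)ᵀ *ᵥ g))) t := by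
  have h := hX.transpose.mul hR
  have hm : (X t)ᵀ * R t ∈ SO3 := mul_mem (SO3.transpose_mem hXm) hRm
  have e1 : -((X t)ᵀ *ᵥ (R t *ᵥ y)) - γ • g =
      -(((X t)ᵀ * R t) *ᵥ (y + γ • (((X t)ᵀ * R t)ᵀ *ᵥ g))) := by
    rw [Matrix.mulVec_add, Matrix.mulVec_smul, mulVec_transpose_mulVec hm,
      ← Matrix.mulVec_mulVec, neg_add, sub_eq_add_neg]
  have e2 : (X t)ᵀ * R t * skew (w + y + γ • (((X t)ᵀ * R t)ᵀ *ᵥ g)) =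
      (X t * skew (-((X t)ᵀ *ᵥ (R t *ᵥ y)) - γ • g))ᵀ * R t + (X t)ᵀ * (R t * skew w) := by
    have h1 := SO3.transpose_mul hm
    have h2 := SO3.mul_skew_mul_transpose hm (y + γ • (((X t)ᵀ * R t)ᵀ *ᵥ g))
    rw [e1, skew_neg, mul_neg, Matrix.transpose_neg, Matrix.transpose_mul (X t), skew_transpose, neg_mul, neg_mul, neg_mul,
      neg_neg, mul_assoc _ (X t)ᵀ, ← mul_assoc (X t)ᵀ, add_assoc w, skew_add, mul_add, ← h2]
    generalize (X t)ᵀ * R t = Q at *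
    rw [mul_assoc (Q * _), h1, mul_one, add_comm]
  rw [e2]
  exact h

/-- A flow can be started wherever no jump is possible. -/
theorem exists_flowOn {P : Design} (h : P.Admissible) {γP γI : ℝ} {ω : ℝ → Vec3} {R : ℝ → Mat3}
    (hR : IsAttitude ω R) {T : ℝ} (hT : 0 ≤ T) {q : ℕ} (hq : q ∈ P.Q) {Q₀ : Mat3}
    (hQ₀ : Q₀ ∈ SO3) (hnj : (R T * Q₀ᵀ, q) ∉ P.jumpSet) (y₀ : Vec3) :
    (R T * Q₀ᵀ, q) ∈ P.flowSet ∧ ∃ T₁ > T, ∃ (Rh : ℝ → Mat3) (y : ℝ → Vec3),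
      FlowOn P γP γI ω R q (Icc T T₁) Rh y ∧ Rh T = Q₀ ∧ y T = y₀ := by
  have hRT := hR.1 T hT
  have hX₀ : R T * Q₀ᵀ ∈ SO3 := mul_mem hRT (SO3.transpose_mem hQ₀)
  have hlt : P.Φ (R T * Q₀ᵀ) q - P.minΦ (R T * Q₀ᵀ) < P.δ := by
    by_contra hc
    exact hnj ⟨hX₀, hq, not_lt.1 hc⟩
  have hf : (R T * Q₀ᵀ, q) ∈ P.flowSet := ⟨hX₀, hq, hlt.le⟩
  refine ⟨hf, ?_⟩
  let F := Fin 3 → Fin 3 → ℝ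
  let M : F × F × Vec3 → Mat3 := fun z => Matrix.of z.2.1
  let N : F × F × Vec3 → Mat3 := fun z => Matrix.of z.1
  let g : F × F × Vec3 → Vec3 := fun z => P.innov (M z) q
  -- The system is solved for the attitude error and the bias error, with $R(t)$ as a continuous
  -- parameter. No regularity of $\omega$ is needed, and $\hat R=X^\top R$ is recovered afterwards.
  let G : F × F × Vec3 → F × Vec3 := fun z =>
    (M z * skew (-((M z)ᵀ *ᵥ (N z *ᵥ z.2.2)) - γP • g z), γI • (((M z)ᵀ * N z)ᵀ *ᵥ g z))
  let z₀ : F × F × Vec3 := (R T, R T * Q₀ᵀ, y₀)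
  have hM : MatC1At M z₀ := fun i j =>
    ((contDiff_apply_apply ℝ ℝ i j).comp (contDiff_fst.comp contDiff_snd)).contDiffAt
  have hN : MatC1At N z₀ := fun i j =>
    ((contDiff_apply_apply ℝ ℝ i j).comp contDiff_fst).contDiffAt
  have hv (i : Fin 3) : ContDiffAt ℝ 1 (fun z : F × F × Vec3 => z.2.2 i) z₀ :=
    ((contDiff_apply ℝ ℝ i).comp (contDiff_snd.comp contDiff_snd)).contDiffAt
  have hg (i : Fin 3) : ContDiffAt ℝ 1 (fun z => g z i) z₀ := h.contDiffAt_innov (M := M) (z := z₀) hf hM i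
  have hG : ContDiffAt ℝ 1 G z₀ := by
    refine ContDiffAt.prodMk (contDiffAt_pi.2 fun i => contDiffAt_pi.2 fun j => ?_)
      (contDiffAt_pi.2 fun i => ?_)
    · exact hM.mul (MatC1At.skew fun i => ((hM.transpose.mulVec (hN.mulVec hv) i).neg.sub
        (contDiffAt_const.mul (hg i)))) i j
    · exact contDiffAt_const.mul ((hM.transpose.mul hN).transpose.mulVec hg i)
  let ρ : ℝ → F := R
  have hρ : ContinuousOn ρ (Ici T) := by
    intro t ht
    have ht0 : 0 ≤ t := hT.trans ht
    have := MatAC.continuousOn (FlowOn.ac_R hR hT (show 0 ≤ t + 1 by linarith))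
    rw [uIcc_of_le (by linarith [mem_Ici.1 ht])] at this
    refine (this t ⟨ht, by linarith⟩).mono_of_mem_nhdsWithin ?_
    rw [← Ici_inter_Iic]
    exact Filter.inter_mem self_mem_nhdsWithin
      (mem_nhdsWithin_of_mem_nhds (Iic_mem_nhds (by linarith)))
  -- Outside the jump set the gap is strictly below $\delta$. This is an open condition, so the
  -- solution stays in the flow set for a short time.
  have hU : {v : F × Vec3 | ∀ p ∈ P.Q, P.Φ (Matrix.of v.1) q - P.Φ (Matrix.of v.1) p < P.δ} ∈
      nhds ((R T * Q₀ᵀ, y₀) : F × Vec3) := by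
    have hop : IsOpen {v : F × Vec3 | ∀ p ∈ P.Q,
        P.Φ (Matrix.of v.1) q - P.Φ (Matrix.of v.1) p < P.δ} := by
      have : {v : F × Vec3 | ∀ p ∈ P.Q, P.Φ (Matrix.of v.1) q - P.Φ (Matrix.of v.1) p < P.δ} =
          ⋂ p ∈ P.Q, {v : F × Vec3 | P.Φ (Matrix.of v.1) q - P.Φ (Matrix.of v.1) p < P.δ} := by
        ext v; simp
      rw [this]
      refine isOpen_biInter_finset fun p _ => isOpen_lt ?_ continuous_const
      exact ((P.continuous_Φ q).sub (P.continuous_Φ p)).comp continuous_fst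
    refine hop.mem_nhds fun p hp => ?_
    have := P.minΦ_le (R T * Q₀ᵀ) hp
    exact lt_of_le_of_lt (sub_le_sub_left this _) hlt
  obtain ⟨T₁, hT₁, α, L, hα0, hα⟩ := exists_local_solution (x₀ := ((R T * Q₀ᵀ, y₀) : F × Vec3))
    (ρ := ρ) (T := T) hG hρ hU
  let X : ℝ → Mat3 := fun t => Matrix.of (α t).1
  let y : ℝ → Vec3 := fun t => (α t).2
  have hXT : X T = R T * Q₀ᵀ := by
    change (α T).1 = _; rw [hα0]
  have hyT : y T = y₀ := by
    change (α T).2 = _; rw [hα0]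
  have hαd (t : ℝ) (ht : t ∈ Ioo T T₁) : HasDerivAt α (G (R t, α t)) t :=
    (hα t (Ioo_subset_Icc_self ht)).2.1.hasDerivAt (Icc_mem_nhds ht.1 ht.2)
  have hXd (t : ℝ) (ht : t ∈ Ioo T T₁) : HasMatDeriv X
      (X t * skew (-((X t)ᵀ *ᵥ (R t *ᵥ y t)) - γP • P.innov (X t) q)) t := fun i j =>
    hasDerivAt_pi.1 (hasDerivAt_pi.1
      ((ContinuousLinearMap.fst ℝ F Vec3).hasFDerivAt.comp_hasDerivAt t (hαd t ht)) i) j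
  have hyd (t : ℝ) (ht : t ∈ Ioo T T₁) (m : Fin 3) : HasDerivAt (fun s => y s m)
      ((γI • (((X t)ᵀ * R t)ᵀ *ᵥ P.innov (X t) q)) m) t :=
    hasDerivAt_pi.1
      ((ContinuousLinearMap.snd ℝ F Vec3).hasFDerivAt.comp_hasDerivAt t (hαd t ht)) m
  have hαc : ContinuousOn α (Icc T T₁) := fun t ht => (hα t ht).2.1.continuousWithinAt
  have hXac : MatAC X T T₁ := fun i j => by
    refine ac_of_deriv_bounded hT₁ (f := fun t => X t i j) ?_ (fun t ht => hXd t ht i j) (M := L)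
      fun t ht => ?_
    · exact ((continuous_apply_apply i j).comp continuous_fst).comp_continuousOn hαc
    · refine le_trans ?_ (hα t (Ioo_subset_Icc_self ht)).2.2
      exact (norm_le_pi_norm ((G (R t, α t)).1 i) j).trans
        ((norm_le_pi_norm (G (R t, α t)).1 i).trans (norm_fst_le _))
  have hyac (m : Fin 3) : AbsolutelyContinuousOnInterval (fun t => y t m) T T₁ := by
    refine ac_of_deriv_bounded hT₁ (f := fun t => y t m) ?_ (fun t ht => hyd t ht m) (M := L)
      fun t ht => ?_
    · exact ((continuous_apply m).comp continuous_snd).comp_continuousOn hαc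
    · refine le_trans ?_ (hα t (Ioo_subset_Icc_self ht)).2.2
      exact (norm_le_pi_norm (G (R t, α t)).2 m).trans (norm_snd_le _)
  -- The solution was found in the space of all matrices. $XX^\top$ has zero derivative, so $X$
  -- stays orthogonal; the determinant is $\pm1$ and, by the intermediate value theorem, cannot
  -- leave $1$.
  have hXX (t : ℝ) (ht : t ∈ Icc T T₁) : X t * (X t)ᵀ = 1 := by
    have h1 := hXac.mul hXac.transpose
    have h2 : X t * (X t)ᵀ = X T * (X T)ᵀ := by
      ext i j
      have h3 := ac_abs_sub_le ht.1 ((h1 i j).mono (by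
          rw [uIcc_of_le ht.1, uIcc_of_le hT₁.le]; exact Icc_subset_Icc_right ht.2)) (M := 0)
        (Filter.Eventually.of_forall fun s hs => ⟨_, ?_, ((hXd s ⟨hs.1, hs.2.trans_le ht.2⟩).mul
          (hXd s ⟨hs.1, hs.2.trans_le ht.2⟩).transpose) i j⟩)
      · rw [zero_mul] at h3
        exact sub_eq_zero.1 (abs_nonpos_iff.1 h3)
      · rw [Matrix.transpose_mul, skew_transpose, neg_mul, mul_neg, mul_assoc, add_neg_cancel]
        simp
    rw [h2, hXT, SO3.mul_transpose hX₀]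
  have hXm (t : ℝ) (ht : t ∈ Icc T T₁) : X t ∈ SO3 := by
    have hdsq (s : ℝ) (hs : s ∈ Icc T T₁) : (X s).det * (X s).det = 1 := by
      have := congrArg Matrix.det (hXX s hs)
      rwa [Matrix.det_mul, Matrix.det_transpose, Matrix.det_one] at this
    refine SO3.of_mul_transpose (hXX t ht) ?_
    rcases mul_self_eq_one_iff.1 (hdsq t ht) with h1 | h1
    · exact h1
    · exfalso
      have hc : ContinuousOn (fun s => (X s).det) (Icc T t) := by
        have := hXac.continuousOn
        rw [uIcc_of_le hT₁.le] at this
        exact (continuous_id.matrix_det (A := fun M : Mat3 => M)).comp_continuousOn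
          (this.mono (Icc_subset_Icc_right ht.2))
      obtain ⟨s, hs, hs0⟩ := intermediate_value_Icc' ht.1 hc (show (0 : ℝ) ∈ _ by
        rw [h1, hXT, SO3.det_eq_one hX₀]; norm_num)
      have := hdsq s ⟨hs.1, hs.2.trans ht.2⟩
      simp only at hs0
      rw [hs0] at this
      norm_num at this
  have hRm (t : ℝ) (ht : t ∈ Icc T T₁) : R t ∈ SO3 := hR.1 t (hT.trans ht.1)
  have hRX (t : ℝ) (ht : t ∈ Icc T T₁) : R t * ((X t)ᵀ * R t)ᵀ = X t := by
    rw [Matrix.transpose_mul, Matrix.transpose_transpose, ← mul_assoc,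
      SO3.mul_transpose (hRm t ht), one_mul]
  have hsubI {s t : ℝ} (hs : s ∈ Icc T T₁) (ht : t ∈ Icc T T₁) : uIcc s t ⊆ uIcc T T₁ := by
    rw [uIcc_of_le hT₁.le]; exact uIcc_subset_Icc hs ht
  refine ⟨T₁, hT₁, fun t => (X t)ᵀ * R t, y, ?_, ?_, hyT⟩
  · refine ⟨ordConnected_Icc, fun t ht => hT.trans ht.1, ?_, ?_, ?_, ?_, ?_, ?_⟩
    · exact fun t ht => mul_mem (SO3.transpose_mem (hXm t ht)) (hRm t ht)
    · exact fun s hs t ht i j => ((hXac.transpose.mul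
        (FlowOn.ac_R hR hT (hT.trans hT₁.le))) i j).mono (hsubI hs ht)
    · exact fun s hs t ht m => (hyac m).mono (hsubI hs ht)
    · intro t ht
      have ht' := interior_subset ht
      rw [hRX t ht', P.mem_flowSet_iff]
      exact ⟨hXm t ht', hq, fun p hp => ((hα t ht').1 p hp).le⟩
    · filter_upwards [hR.2.2, ae_mem_Ioo_of_mem_Icc T T₁] with t h1 h2 ht
      rw [hRX t ht]
      exact hasMatDeriv_estimate (h1 (hT.trans ht.1)) (hXd t (h2 ht)) (hRm t ht) (hXm t ht)
    · filter_upwards [ae_mem_Ioo_of_mem_Icc T T₁] with t h2 ht m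
      rw [hRX t ht]
      exact hyd t (h2 ht) m
  · change (X T)ᵀ * R T = Q₀
    rw [hXT, Matrix.transpose_mul, Matrix.transpose_transpose, mul_assoc,
      SO3.transpose_mul hRT, mul_one]

/-! ### Completeness of maximal solutions -/

theorem isHybridTimeDomain_last {t₀ : ℝ} {τ : ℕ → ℝ} (hτ : Monotone τ) (h0 : τ 0 = t₀) {N : ℕ}
    {I I' : Set ℝ} {E : Set (ℝ × ℕ)}
    (hE : E = {z | (z.2 < N ∧ τ z.2 ≤ z.1 ∧ z.1 ≤ τ (z.2 + 1)) ∨ (z.2 = N ∧ z.1 ∈ I)})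
    (hI' : I'.OrdConnected) (hl : IsLeast I' (τ N)) :
    IsHybridTimeDomain t₀ {z | (z.2 ≠ N ∧ z ∈ E) ∨ (z.2 = N ∧ z.1 ∈ I')} := by
  refine ⟨τ, hτ, h0, Or.inr ⟨N, I', hI', hl, ?_⟩⟩
  subst hE
  ext ⟨t, j⟩
  simp only [mem_ofPred_eq]
  constructor
  · rintro (⟨h1, h2 | h2⟩ | h)
    · exact Or.inl h2
    · exact absurd h2.1 h1
    · exact Or.inr h
  · rintro (h | h)
    · exact Or.inl ⟨h.1.ne, Or.inl h⟩
    · exact Or.inr h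

/-- All break points after the $N$-th are set to $T$: this closes the old last interval at $T$ and
lets the new one start there. -/
theorem isHybridTimeDomain_jump {t₀ : ℝ} {τ : ℕ → ℝ} (hτ : Monotone τ) (h0 : τ 0 = t₀) {N : ℕ}
    {T : ℝ} (hT : τ N ≤ T) {E : Set (ℝ × ℕ)}
    (hE : E = {z | (z.2 < N ∧ τ z.2 ≤ z.1 ∧ z.1 ≤ τ (z.2 + 1)) ∨ (z.2 = N ∧ z.1 ∈ Icc (τ N) T)}) :
    IsHybridTimeDomain t₀ {z | (z.2 ≠ N + 1 ∧ z ∈ E) ∨ (z.2 = N + 1 ∧ z.1 ∈ ({T} : Set ℝ))} := by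
  have hle (j : ℕ) (hj : j ≤ N) : (if j ≤ N then τ j else T) = τ j := if_pos hj
  have hgt (j : ℕ) (hj : N < j) : (if j ≤ N then τ j else T) = T := if_neg hj.not_ge
  refine ⟨fun j => if j ≤ N then τ j else T, fun i j hij => ?_, by simpa, Or.inr
    ⟨N + 1, {T}, ordConnected_singleton, by simp, ?_⟩⟩
  · simp only
    rcases le_or_gt j N with hj | hj
    · rw [hle i (hij.trans hj), hle j hj]; exact hτ hij
    · rw [hgt j hj]
      rcases le_or_gt i N with hi | hi
      · rw [hle i hi]; exact (hτ hi).trans hT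
      · rw [hgt i hi]
  · subst hE
    ext ⟨t, j⟩
    simp only [mem_ofPred_eq, mem_Icc]
    rcases lt_trichotomy j N with hj | rfl | hj
    · rw [hle j hj.le, hle (j + 1) hj]
      simp [hj, hj.ne, hj.trans (Nat.lt_succ_self N), (hj.trans (Nat.lt_succ_self N)).ne]
    · rw [hle j le_rfl, hgt (j + 1) (Nat.lt_succ_self j)]
      simp
    · have h1 : ¬ j < N + 1 := by omega
      simp [h1, hj.not_gt, hj.ne']

namespace Arc.IsMaximalSolution

variable {P : Design} {γP γI t₀ : ℝ} {ω : ℝ → Vec3} {R : ℝ → Mat3} {b : Vec3} {x : Arc}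
  {τ : ℕ → ℝ} {N : ℕ} {I : Set ℝ}

/-- The last interval of flow of a maximal solution cannot be extended. -/
theorem last_subset (hx : x.IsMaximalSolution P γP γI t₀ ω R b) (hR : IsAttitude ω R)
    (hτ : Monotone τ) (h0 : τ 0 = t₀) (hl : IsLeast I (τ N))
    (hE : x.dom = {z | (z.2 < N ∧ τ z.2 ≤ z.1 ∧ z.1 ≤ τ (z.2 + 1)) ∨ (z.2 = N ∧ z.1 ∈ I)})
    {I' : Set ℝ} (hII' : I ⊆ I') (hl' : τ N ∈ lowerBounds I') {Rh : ℝ → Mat3} {y : ℝ → Vec3}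
    (hF : FlowOn P γP γI ω R (x.q (τ N) N) I' Rh y)
    (hag : ∀ t ∈ I, Rh t = x.Rh t N ∧ y t = x.bt b t N) : I' ⊆ I := by
  have hN (t : ℝ) : (t, N) ∈ x.dom ↔ t ∈ I := by rw [hE]; simp
  have hs : x.slice N = I := Set.ext hN
  have hτN := (hN _).2 hl.1
  rw [← hs]
  refine hx.subset_slice hR (isHybridTimeDomain_last hτ h0 hE hF.ordConnected
    ⟨hII' hl.1, hl'⟩) hF (hx.1.mem_Q _ _ hτN) ?_ ?_ ?_
  · rintro t j h1 rfl h3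
    have h4 : t = τ (j + 1) := by
      refine le_antisymm ?_ (hl' h3)
      rw [hE] at h1
      rcases h1 with h1 | h1
      · exact h1.2.2
      · exact absurd h1.1 (Nat.succ_ne_self j).symm
    subst h4
    obtain ⟨k1, k2⟩ := hag _ hl.1
    exact ⟨hx.1.jump_mem _ j h1 hτN, hx.1.jump_q _ j h1 hτN,
      k1.trans (hx.1.jump_Rh _ j h1 hτN), k2.trans (hx.1.bt_jump h1 hτN)⟩
  · intro t _ h
    rw [hE] at h
    simp at h
  · intro t ht
    have htI := (hN t).1 ht
    exact ⟨hII' htI, (hag t htI).1, (hag t htI).2, hx.1.flow_q N _ hτN _ ht⟩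

/-- A maximal solution does not end in the jump set. -/
theorem not_mem_jumpSet (hx : x.IsMaximalSolution P γP γI t₀ ω R b) (hR : IsAttitude ω R)
    (h : P.Admissible) (ht₀ : 0 ≤ t₀) (hτ : Monotone τ) (h0 : τ 0 = t₀) {T : ℝ} (hT : τ N ≤ T)
    (hE : x.dom = {z | (z.2 < N ∧ τ z.2 ≤ z.1 ∧ z.1 ≤ τ (z.2 + 1)) ∨
      (z.2 = N ∧ z.1 ∈ Icc (τ N) T)}) : (x.Rt R T N, x.q T N) ∉ P.jumpSet := by
  intro hj
  have hTN : (T, N) ∈ x.dom := by rw [hE]; exact Or.inr ⟨rfl, hT, le_rfl⟩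
  have hnot (t : ℝ) (j : ℕ) (hj : N < j) : (t, j) ∉ x.dom := by
    rw [hE]; rintro (h1 | h1)
    · exact hj.not_gt h1.1
    · exact hj.ne' h1.1
  obtain ⟨p, hp⟩ := P.argminΦ_nonempty h.nonempty (x.Rt R T N)
  -- A jump adds the single point $(T,N+1)$. On a one-point interval the flow conditions are
  -- vacuous, so this already contradicts maximality.
  have hsub := hx.subset_slice hR (n := N + 1) (isHybridTimeDomain_jump hτ h0 hT hE)
    (FlowOn.singleton (q := p) (Rh := fun _ => x.Rh T N) (y := fun _ => x.bt b T N)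
      (ht₀.trans (hx.1.isDomain.le hTN)) (hx.1.mem_SO3 T N hTN)) hp.1
    (fun t j _ h2 h3 => by
      obtain rfl : j = N := by omega
      rw [mem_singleton_iff.1 h3]
      exact ⟨hj, hp, rfl, rfl⟩)
    (fun t _ => hnot t _ (by omega)) (fun t ht => absurd ht (hnot t _ (Nat.lt_succ_self N)))
  exact hnot T (N + 1) (Nat.lt_succ_self N) (hsub (mem_singleton T))

theorem isComplete (hx : x.IsMaximalSolution P γP γI t₀ ω R b) (h : P.Admissible) (hγP : 0 < γP)
    (hγI : 0 < γI) (hR : IsAttitude ω R) (ht₀ : 0 ≤ t₀) {c : ℝ}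
    (hω : ∀ t, 0 ≤ t → vnorm (ω t) ≤ c) : x.IsComplete := by
  obtain ⟨J, hJ⟩ := hx.1.finitelyManyJumps h hγP hγI hR ht₀
  by_contra hnc
  simp only [Arc.IsComplete, not_forall, not_exists, not_and, not_le] at hnc
  obtain ⟨M, hM⟩ := hnc
  -- Infinitely many intervals contradict the bound on jumps. So there is a last interval, and its
  -- supremum $T$ either belongs to it, when a jump or a local flow continues the solution, or does
  -- not, when the limit at $T$ extends it.
  obtain ⟨τ, hτ, h0, hE | ⟨N, I, hI, hl, hE⟩⟩ := hx.1.isDomain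
  · have : (τ (J + 1), J + 1) ∈ x.dom := by rw [hE]; exact ⟨le_rfl, hτ (Nat.le_succ _)⟩
    exact absurd (hJ _ _ this) (Nat.not_succ_le_self J)
  have hN (t : ℝ) : (t, N) ∈ x.dom ↔ t ∈ I := by rw [hE]; simp
  have hs : x.slice N = I := Set.ext hN
  have hτN := (hN _).2 hl.1
  have hbdd : BddAbove I := ⟨M, fun t ht => by
    have h1 := hM t N ((hN t).2 ht)
    have h2 : (0 : ℝ) ≤ N := Nat.cast_nonneg N
    linarith⟩
  have hF := hx.1.flowOn hR ht₀ hτN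
  rw [hs] at hF
  set T := sSup I with hT
  have hleT (t : ℝ) (ht : t ∈ I) : t ≤ T := le_csSup hbdd ht
  by_cases hTI : T ∈ I
  · have hII : I = Icc (τ N) T := Subset.antisymm (fun t ht => ⟨hl.2 ht, hleT t ht⟩)
      (hI.out hl.1 hTI)
    have hTN := (hN T).2 hTI
    have hnj := hx.not_mem_jumpSet hR h ht₀ hτ h0 (hleT _ hl.1) (hII ▸ hE)
    have hT0 := hF.nonneg T hTI
    have hqT := hx.1.flow_q N _ hτN _ hTN
    rw [← hqT] at hnj
    obtain ⟨hf, T₁, hT₁, Rh, y, hG, hRh, hy⟩ := exists_flowOn (γP := γP) (γI := γI) h hR hT0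
      (hx.1.mem_Q _ _ hτN) (hx.1.mem_SO3 _ _ hTN) hnj (x.bt b T N)
    have hag1 (t : ℝ) (ht : t ≤ T) : (if t ≤ T then x.Rh t N else Rh t) = x.Rh t N := if_pos ht
    have hag2 (t : ℝ) (ht : t ≤ T) : (if t ≤ T then x.bt b t N else y t) = x.bt b t N := if_pos ht
    have hag3 (t : ℝ) (ht : T ≤ t) : (if t ≤ T then x.Rh t N else Rh t) = Rh t := by
      split_ifs with h1
      · rw [le_antisymm h1 ht, hRh]
      · rfl
    have hag4 (t : ℝ) (ht : T ≤ t) : (if t ≤ T then x.bt b t N else y t) = y t := by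
      split_ifs with h1
      · rw [le_antisymm h1 ht, hy]
      · rfl
    have hF' := (hII ▸ hF).congr (fun t ht => hag1 t ht.2) (fun t ht => hag2 t ht.2)
    have hG' := hG.congr (fun t ht => hag3 t ht.1) (fun t ht => hag4 t ht.1)
    have hFG := hF'.append (hleT _ hl.1) hT₁.le hG' (by
      rw [hag1 T le_rfl]; exact hf)
    have hsub := hx.last_subset hR hτ h0 hl hE
      (hII ▸ Icc_subset_Icc_right hT₁.le) (fun t ht => ht.1) hFG
      (fun t ht => ⟨hag1 t (hleT t ht), hag2 t (hleT t ht)⟩)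
    exact absurd (hleT _ (hsub ⟨(hleT _ hl.1).trans hT₁.le, le_rfl⟩)) hT₁.not_ge
  · have hII : I = Ico (τ N) T := by
      refine Subset.antisymm (fun t ht => ⟨hl.2 ht, lt_of_le_of_ne (hleT t ht) ?_⟩) fun t ht => ?_
      · rintro rfl; exact hTI ht
      · obtain ⟨s, hs, hts⟩ := exists_lt_of_lt_csSup ⟨_, hl.1⟩ ht.2
        exact hI.out hl.1 hs ⟨ht.1, hts.le⟩
    have hlt : τ N < T := lt_of_le_of_ne (hleT _ hl.1) fun he => hTI (he ▸ hl.1)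
    have hy (t : ℝ) (ht : t ∈ Ico (τ N) T) :
        vnorm (x.bt b t N) ≤ √((6 * γI + 1) * x.err R b t₀ 0 ^ 2) :=
      Real.le_sqrt_of_sq_le (hx.1.vnorm_bt_sq_le h hγP hγI hR ht₀ ((hN t).2 (hII ▸ ht)))
    obtain ⟨Rh, y, hG, hag⟩ := (hII ▸ hF).exists_closure hlt h hγP hγI hω hy
    have hsub := hx.last_subset hR hτ h0 hl hE (hII ▸ Ico_subset_Icc_self) (fun t ht => ht.1) hG
      (fun t ht => hag t (hII ▸ ht))
    exact hTI (hsub ⟨hlt.le, le_rfl⟩)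

end Arc.IsMaximalSolution

end HybridObserver

theorem theorem2 (P : Design) (hP : P.IsD1 ∨ P.IsD2 ∨ P.IsD3 ∨ P.IsD4)
    (γP γI : ℝ) (hγP : 0 < γP) (hγI : 0 < γI) :
    -- for every bounded angular velocity, every solution has finitely many jumps,
    -- and every maximal solution is complete
    (∀ (t₀ : ℝ) (ω : ℝ → Vec3) (R : ℝ → Mat3) (b : Vec3), 0 ≤ t₀ → IsAttitude ω R →
      (∃ c : ℝ, ∀ t, 0 ≤ t → vnorm (ω t) ≤ c) →
      (∀ x : Arc, x.IsSolution P γP γI t₀ ω R b → x.FinitelyManyJumps) ∧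
      (∀ x : Arc, x.IsMaximalSolution P γP γI t₀ ω R b → x.IsComplete)) ∧
    -- exponential stability, uniformly in the initial time, in all the signals with `‖ω‖ ≤ c` and
    -- in all the solutions with initial error at most `r`, for arbitrary `c` and `r`
    (∃ K : ℝ, 0 < K ∧ ∀ c r : ℝ, ∃ rate : ℝ, 0 < rate ∧
      ∀ (t₀ : ℝ) (ω : ℝ → Vec3) (R : ℝ → Mat3) (b : Vec3), 0 ≤ t₀ → IsAttitude ω R →
        (∀ t, 0 ≤ t → vnorm (ω t) ≤ c) →
        ∀ x : Arc, x.IsSolution P γP γI t₀ ω R b → x.err R b t₀ 0 ≤ r →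
          ∀ t j, (t, j) ∈ x.dom →
            x.err R b t j ≤ K * Real.exp (-rate * (t - t₀ + (j : ℝ))) * x.err R b t₀ 0) := by
  have h := admissible_of_isD hP
  refine ⟨fun t₀ ω R b ht₀ hR ⟨c, hω⟩ =>
    ⟨fun x hx => hx.finitelyManyJumps h hγP hγI hR ht₀,
      fun x hx => hx.isComplete h hγP hγI hR ht₀ hω⟩,
    h.exponentially_stable hγP hγI⟩
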